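/- **Theorem (constructive bound on the colour-blind index).** For an edge-colouring (not necessarily proper) of a finite simple graph $G=(V,E)$ with colours $1,\dots,k$ and a vertex $v$, let $a_i(v)$ be the number of edges at $v$ that have colour $i$; the *palette* of $v$ is the sequence $(a_1(v),\dots,a_k(v))$ rearranged in non-decreasing order. Write $\delta=\delta(G)$ and $\Delta=\Delta(G)$ for the minimum and the maximum degree of $G$. There are a randomized algorithm and absolute constants $C,\kappa$ such that for every real $R\ge 1$ there is $\delta_0=\delta_0(R)$ with the following property. For every finite simple graph $G$ with $\delta(G)\ge\delta_0$ and $\Delta(G)\le R\,\delta(G)$: 1. there is an edge-colouring of $G$ with $6$ colours in which adjacent vertices have distinct palettes; 2. the algorithm, given $G$ as a list of its edges (for any numbering of the vertices and any order of the edges), finds such a colouring in $O(|E|(1+\Delta-\delta))$ time with high probability: whenever it halts, its output is such a colouring, and for every integer $s\ge 0$ the probability that it has not halted after $C\,s\,|E|\,(1+\Delta-\delta)$ steps is at most $|V|^{-s}$ (in particular its expected running time is $O(|E|(1+\Delta-\delta))$). Here an algorithm is a program of a random access machine whose registers and memory cells hold words of $w$ bits, for any $w\ge\kappa\lceil\log_2(|V|+|E|+2)\rceil$.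 One step is one addition, subtraction or multiplication of words, one access to memory, one branching, or one draw of a uniformly random element of $\{0,\dots,a-1\}$ for a word $a$ (draws are independent). -/

import Mathlib

open scoped ENNReal

universe u

/-! ### Palettes -/

namespace SimpleGraph

variable {V : Type u} {G : SimpleGraph V} {k : ℕ}

/-- The number of edges at the vertex `v` that have colour `i`, counted by their other endpoints. -/
noncomputable def colorCount (φ : G.EdgeLabeling (Fin k)) (v : V) (i : Fin k) : ℕ :=
  {x : V | ∃ h : G.Adj v x, φ ⟨s(v, x), h⟩ = i}.ncard

/-- The palette of `v`: its `k` colour counts, listed in non-decreasing order. -/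
noncomputable def palette (φ : G.EdgeLabeling (Fin k)) (v : V) : List ℕ :=
  (Finset.univ.val.map (colorCount φ v)).sort (· ≤ ·)

/-- A colour-blind person can distinguish neighbours in the (not necessarily proper)
edge-colouring `φ`: adjacent vertices have distinct palettes. -/
def DistinguishesNeighbors (φ : G.EdgeLabeling (Fin k)) : Prop :=
  ∀ x y : V, G.Adj x y → palette φ x ≠ palette φ y

/-- A presentation of a finite graph as an input: the vertices are numbered from `0`, and the
edges are listed in some order, each once, by their two endpoints in either order. -/
structure EdgeListing [Fintype V] (G : SimpleGraph V) [Fintype G.edgeSet] where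
  /-- the numbering of the vertices -/
  num : V ≃ Fin (Fintype.card V)
  /-- the list of the edges -/
  edge : Fin G.edgeFinset.card ≃ G.edgeSet
  /-- the endpoint of the `j`-th edge that is listed first -/
  fst : Fin G.edgeFinset.card → V
  /-- the endpoint of the `j`-th edge that is listed second -/
  snd : Fin G.edgeFinset.card → V
  edge_eq : ∀ j, (edge j : Sym2 V) = s(fst j, snd j)

end SimpleGraph

/-! ### Randomized random access machines with words of `w` bits -/

namespace WordRAM

/-- Programs. A register is named by a natural number. The arguments of an instruction are
registers, with the exception of the constant `k` in `const r k`. -/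
inductive Program : Type
  /-- `r := k` -/
  | const (r k : ℕ)
  /-- `r := a + b` -/
  | add (r a b : ℕ)
  /-- `r := a - b`, and `r := 0` if `a < b` -/
  | sub (r a b : ℕ)
  /-- `r := a * b` -/
  | mul (r a b : ℕ)
  /-- `r := mem[a]` -/
  | load (r a : ℕ)
  /-- `mem[a] := r` -/
  | store (a r : ℕ)
  /-- `r :=` a uniformly random element of `{0, …, a - 1}`, independent of all other draws;
  `r := 0` if `a = 0` -/
  | rand (r a : ℕ)
  /-- first `p`, then `q` -/
  | seq (p q : Program)
  /-- `if a < b then p else q` -/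
  | ifLt (a b : ℕ) (p q : Program)
  /-- `while a < b do p` -/
  | whileLt (a b : ℕ) (p : Program)

/-- The contents of the registers and of the memory cells. -/
structure Store where
  reg : ℕ → ℕ
  mem : ℕ → ℕ

/-- Write the word `x` into the register `r`; only the last `w` bits are kept. -/
def Store.setReg (w : ℕ) (σ : Store) (r x : ℕ) : Store :=
  { σ with reg := Function.update σ.reg r (x % 2 ^ w) }

/-- Write the word `x` into the memory cell `a`; only the last `w` bits are kept. -/
def Store.setMem (w : ℕ) (σ : Store) (a x : ℕ) : Store :=
  { σ with mem := Function.update σ.mem a (x % 2 ^ w) }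

/-- A configuration: what remains to be executed (the head of the list first), and the store. -/
structure Config where
  todo : List Program
  store : Store

/-- The machine has halted. -/
def Config.Halted (c : Config) : Prop :=
  c.todo = []

/-- The law of a uniformly random element of `{0, …, a - 1}` (of `0` if `a = 0`). -/
noncomputable def uniformBelow : ℕ → PMF ℕ
  | 0 => PMF.pure 0
  | a + 1 => (PMF.uniformOfFintype (Fin (a + 1))).map fun i => (i : ℕ)

/-- One step of the machine with words of `w` bits: the law of the next configuration. -/
noncomputable def step (w : ℕ) (c : Config) : PMF Config :=
  match c with
  | ⟨[], σ⟩ => PMF.pure ⟨[], σ⟩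
  | ⟨.const r k :: K, σ⟩ => PMF.pure ⟨K, σ.setReg w r k⟩
  | ⟨.add r a b :: K, σ⟩ => PMF.pure ⟨K, σ.setReg w r (σ.reg a + σ.reg b)⟩
  | ⟨.sub r a b :: K, σ⟩ => PMF.pure ⟨K, σ.setReg w r (σ.reg a - σ.reg b)⟩
  | ⟨.mul r a b :: K, σ⟩ => PMF.pure ⟨K, σ.setReg w r (σ.reg a * σ.reg b)⟩
  | ⟨.load r a :: K, σ⟩ => PMF.pure ⟨K, σ.setReg w r (σ.mem (σ.reg a))⟩
  | ⟨.store a r :: K, σ⟩ => PMF.pure ⟨K, σ.setMem w (σ.reg a) (σ.reg r)⟩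
  | ⟨.rand r a :: K, σ⟩ => (uniformBelow (σ.reg a)).map fun x => ⟨K, σ.setReg w r x⟩
  | ⟨.seq p q :: K, σ⟩ => PMF.pure ⟨p :: q :: K, σ⟩
  | ⟨.ifLt a b p q :: K, σ⟩ =>
      PMF.pure ⟨(if σ.reg a < σ.reg b then p else q) :: K, σ⟩
  | ⟨.whileLt a b p :: K, σ⟩ =>
      PMF.pure ⟨if σ.reg a < σ.reg b then p :: .whileLt a b p :: K else K, σ⟩

/-- The law of the configuration after `t` steps from `c`. -/
noncomputable def run (w : ℕ) : ℕ → Config → PMF Config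
  | 0, c => PMF.pure c
  | t + 1, c => (step w c).bind (run w t)

/-- The law of the configuration of the program `P` after `t` steps from the store `σ`. -/
noncomputable def runProgram (w : ℕ) (P : Program) (σ : Store) (t : ℕ) : PMF Config :=
  run w t ⟨[P], σ⟩

end WordRAM

namespace SimpleGraph

variable {V : Type u} [Fintype V] {G : SimpleGraph V} [Fintype G.edgeSet]

/-- The initial store: register `0` holds the number of vertices, register `1` the number of
edges, the memory cells `2 * j` and `2 * j + 1` hold the numbers of the endpoints of the `j`-th
edge, and everything else is `0`. -/
def EdgeListing.input (I : G.EdgeListing) : WordRAM.Store where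
  reg r := if r = 0 then Fintype.card V else if r = 1 then G.edgeFinset.card else 0
  mem a :=
    if h : a / 2 < G.edgeFinset.card then
      if a % 2 = 0 then (I.num (I.fst ⟨a / 2, h⟩) : ℕ) else (I.num (I.snd ⟨a / 2, h⟩) : ℕ)
    else 0

/-- The store `σ` holds the edge-colouring `φ` as output: with `m` the number of edges, the memory
cell `2 * m + j` holds the colour of the `j`-th edge. -/
def EdgeListing.IsOutput {k : ℕ} (I : G.EdgeListing) (σ : WordRAM.Store)
    (φ : G.EdgeLabeling (Fin k)) : Prop :=
  ∀ j : Fin G.edgeFinset.card, σ.mem (2 * G.edgeFinset.card + j) = (φ (I.edge j) : ℕ)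

end SimpleGraph

/-! The program colours all edges independently and uniformly at random, puts all vertices on a
stack, and scans the neighbours of the top vertex v. If a neighbour has the same palette as v, all
edges at v are recoloured at random, the neighbours of v join the stack, and a new scan begins. If
the scan of v ends without a conflict, v is popped. Every conflicting edge always has an endpoint on
the stack, so an empty stack means a solution. Palettes are compared without sorting, by a product
`key` that is symmetric in the colour counts and determines their multiset.

A conflict is rare. Given the colours of all edges not at v and of the edge to a neighbour u, the
palette of u is fixed, since no other edge at v reaches u. Equality leaves at most 6! = 720 count
vectors for v, and by the multinomial law each of them has probability of order δ^(-5/2)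
(`resampleAll_counts_le`, `resampleAll_key_eq_le`). A recolouring creates O(Δ²) = O(R²δ²) new
comparisons, so a comparison causes o(1) further ones on average.

The difficulty is that the current colouring is conditioned on the past. It is overcome by a
symmetry: the average A over the colours at v is self-adjoint for the uniform law, so E[1_conflict ·
Aψ] = E[A 1_conflict · ψ] ≤ p E[ψ] (`resampleAll_mul_resampleAll`). Thus the law of the colouring
after "conflict, then recolour" is at most p times the uniform law, and no history has to be
tracked. Let F(t, L, i) be the probability of failure after t steps with stack L and scan index i,
in the worst case over the stores and averaged over uniform colourings. In the branch without
conflict the indicator is dropped, which gives `meanFail_scan`: F(t, L, i) ≤ F(t - 400, L, i + 1) +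
p F(t - 400 - 200Δ, L', 0).

With weight(L) - i as the amount of pending work, exp(β(800(weight(L) - i) - t)), up to a shift of
t, dominates F as soon as exp(-400β) + p exp(β · O(Δ²)) ≤ 1 (`meanFail_le`). The rate β = log δ /
(4800(Δ+1)²) satisfies this for large δ (`decayRate_spec`), and β|E|(1+Δ-δ) is at least a constant
times log n (`log_le_decayRate_mul`), whence the bound n^(-s).

Halting with a wrong output counts as failure and is never left. Since the probability of failure
tends to 0, such a configuration is unreachable (`of_halted_of_failProb_small`). Existence of a
colouring follows because some run succeeds. -/

/-! ### Averaging operators for uniformly random colours. -/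

open Finset Function in
/-- The average of `φ` over the six values at the place `j` of a colouring. -/
noncomputable def resample (j : ℕ) (φ : (ℕ → ℕ) → ℝ≥0∞) (f : ℕ → ℕ) : ℝ≥0∞ :=
  (∑ c ∈ range 6, φ (update f j c)) / 6

/-- The average of `φ` over all values at the places in `l`. -/
noncomputable def resampleAll (l : List ℕ) (φ : (ℕ → ℕ) → ℝ≥0∞) : (ℕ → ℕ) → ℝ≥0∞ :=
  l.foldr resample φ

section Resampling

open Finset Function

theorem resampleAll_nil (φ : (ℕ → ℕ) → ℝ≥0∞) : resampleAll [] φ = φ := rfl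

theorem resampleAll_cons (j : ℕ) (l : List ℕ) (φ : (ℕ → ℕ) → ℝ≥0∞) :
    resampleAll (j :: l) φ = resample j (resampleAll l φ) := rfl

theorem resampleAll_append (l l' : List ℕ) (φ : (ℕ → ℕ) → ℝ≥0∞) :
    resampleAll (l ++ l') φ = resampleAll l (resampleAll l' φ) :=
  List.foldr_append

theorem resample_const (j : ℕ) (x : ℝ≥0∞) : resample j (fun _ => x) = fun _ => x := by
  funext f
  simp only [resample, sum_const, card_range, nsmul_eq_mul]
  rw [mul_comm]
  exact ENNReal.mul_div_cancel_right (by norm_num) (by norm_num)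

theorem resample_mono (j : ℕ) {φ ψ : (ℕ → ℕ) → ℝ≥0∞} (h : ∀ f, φ f ≤ ψ f) (f : ℕ → ℕ) :
    resample j φ f ≤ resample j ψ f :=
  ENNReal.div_le_div_right (sum_le_sum fun _ _ => h _) _

theorem resampleAll_const (l : List ℕ) (x : ℝ≥0∞) : resampleAll l (fun _ => x) = fun _ => x := by
  induction l with
  | nil => rfl
  | cons j l ih => rw [resampleAll_cons, ih, resample_const]

theorem resampleAll_mono (l : List ℕ) {φ ψ : (ℕ → ℕ) → ℝ≥0∞} (h : ∀ f, φ f ≤ ψ f) (f : ℕ → ℕ) :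
    resampleAll l φ f ≤ resampleAll l ψ f := by
  induction l generalizing f with
  | nil => exact h f
  | cons j l ih => exact resample_mono j ih f

theorem resample_add (j : ℕ) (φ ψ : (ℕ → ℕ) → ℝ≥0∞) :
    resample j (fun f => φ f + ψ f) = fun f => resample j φ f + resample j ψ f := by
  funext f
  simp only [resample, sum_add_distrib, ENNReal.add_div]

theorem resampleAll_add (l : List ℕ) (φ ψ : (ℕ → ℕ) → ℝ≥0∞) :
    resampleAll l (fun f => φ f + ψ f) = fun f => resampleAll l φ f + resampleAll l ψ f := by
  induction l with
  | nil => rfl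
  | cons j l ih => rw [resampleAll_cons, ih, resample_add]; rfl

theorem resampleAll_sum {ι : Type*} (l : List ℕ) (s : Finset ι) (φ : ι → (ℕ → ℕ) → ℝ≥0∞) :
    resampleAll l (fun f => ∑ i ∈ s, φ i f) = fun f => ∑ i ∈ s, resampleAll l (φ i) f := by
  classical
  induction s using Finset.induction_on with
  | empty => simpa using resampleAll_const l 0
  | insert i s hi ih => simp only [sum_insert hi, resampleAll_add, ih]

theorem resample_const_mul (j : ℕ) (x : ℝ≥0∞) (φ : (ℕ → ℕ) → ℝ≥0∞) :
    resample j (fun f => x * φ f) = fun f => x * resample j φ f := by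
  funext f
  simp only [resample, ← mul_sum, mul_div_assoc]

theorem resampleAll_const_mul (l : List ℕ) (x : ℝ≥0∞) (φ : (ℕ → ℕ) → ℝ≥0∞) :
    resampleAll l (fun f => x * φ f) = fun f => x * resampleAll l φ f := by
  induction l with
  | nil => rfl
  | cons j l ih => rw [resampleAll_cons, ih, resample_const_mul]; rfl

theorem resample_update (j c : ℕ) (φ : (ℕ → ℕ) → ℝ≥0∞) (f : ℕ → ℕ) :
    resample j φ (update f j c) = resample j φ f := by
  simp [resample]

/-- An average over the place j no longer depends on that place, so it leaves a further average over
j as a constant. -/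
theorem resample_mul (j : ℕ) (φ ψ : (ℕ → ℕ) → ℝ≥0∞) :
    resample j (fun f => φ f * resample j ψ f) = fun f => resample j φ f * resample j ψ f := by
  funext f
  conv_lhs => rw [resample]
  simp only [resample_update, ← sum_mul, ENNReal.mul_div_right_comm]
  rfl

theorem resample_idem (j : ℕ) (φ : (ℕ → ℕ) → ℝ≥0∞) :
    resample j (resample j φ) = resample j φ := by
  have h := resample_mul j (fun _ => 1) φ
  rw [resample_const] at h
  simpa using h

theorem resample_comm (j k : ℕ) (φ : (ℕ → ℕ) → ℝ≥0∞) :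
    resample j (resample k φ) = resample k (resample j φ) := by
  rcases eq_or_ne j k with rfl | h
  · rfl
  funext f
  simp only [resample, ENNReal.div_eq_inv_mul, ← mul_sum]
  rw [sum_comm]
  simp only [update_comm h]

theorem resampleAll_perm {l l' : List ℕ} (h : l.Perm l') (φ : (ℕ → ℕ) → ℝ≥0∞) :
    resampleAll l φ = resampleAll l' φ := by
  induction h with
  | nil => rfl
  | cons j _ ih => rw [resampleAll_cons, ih, resampleAll_cons]
  | swap j k l => simp only [resampleAll_cons, resample_comm]
  | trans _ _ h₁ h₂ => rw [h₁, h₂]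

/-- The tower property: averages commute and are idempotent, so the inner one is absorbed. -/
theorem resampleAll_resample {j : ℕ} {l : List ℕ} (h : j ∈ l) (φ : (ℕ → ℕ) → ℝ≥0∞) :
    resampleAll l (resample j φ) = resampleAll l φ := by
  have hp : l.Perm (l.erase j ++ [j]) :=
    (List.perm_cons_erase h).trans (List.perm_append_singleton j _).symm
  rw [resampleAll_perm hp, resampleAll_perm hp, resampleAll_append, resampleAll_append,
    resampleAll_cons, resampleAll_cons, resampleAll_nil, resampleAll_nil, resample_idem]

theorem resampleAll_mul_resample {j : ℕ} {l : List ℕ} (h : j ∈ l) (φ ψ : (ℕ → ℕ) → ℝ≥0∞) :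
    resampleAll l (fun f => φ f * resample j ψ f) =
      resampleAll l (fun f => resample j φ f * ψ f) := by
  rw [← resampleAll_resample h, resample_mul, ← resampleAll_resample h
    (fun f => resample j φ f * ψ f)]
  simp only [mul_comm (resample j φ _), resample_mul]

/-- Self-adjointness of the average over s, proved one place at a time. With φ the indicator of a
conflict at v, s the edges at v and ψ the probability of failure afterwards, the right side shows a
conditional conflict probability times failure from a fresh uniform colouring. -/
theorem resampleAll_mul_resampleAll {s l : List ℕ} (h : ∀ j ∈ s, j ∈ l)
    (φ ψ : (ℕ → ℕ) → ℝ≥0∞) :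
    resampleAll l (fun f => φ f * resampleAll s ψ f) =
      resampleAll l (fun f => resampleAll s φ f * ψ f) := by
  induction s generalizing φ ψ with
  | nil => rfl
  | cons j s ih =>
    have h' : ∀ k ∈ s, k ∈ l := fun k hk => h k (List.mem_cons_of_mem j hk)
    rw [resampleAll_perm (List.perm_append_singleton j s).symm φ, resampleAll_append,
      resampleAll_cons, resampleAll_cons, resampleAll_nil,
      resampleAll_mul_resample (h j List.mem_cons_self), ih h']

/-- The value of an average over the places in `l` only depends on the colourings that agree
with `f` off `l` and that have colours below six on `l`. -/
theorem resampleAll_congr {l : List ℕ} {φ ψ : (ℕ → ℕ) → ℝ≥0∞} {f : ℕ → ℕ}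
    (h : ∀ g : ℕ → ℕ, (∀ k, k ∉ l → g k = f k) → (∀ k ∈ l, g k < 6) → φ g = ψ g) :
    resampleAll l φ f = resampleAll l ψ f := by
  induction l generalizing f φ ψ with
  | nil => exact h f (fun _ _ => rfl) (by simp)
  | cons j l ih =>
    simp only [resampleAll_cons, resample]
    congr 1
    refine sum_congr rfl fun c hc => ?_
    by_cases hj : j ∈ l
    · refine ih fun g hg hg' => h g (fun k hk => ?_) (fun k hk => ?_)
      · rw [List.mem_cons, not_or] at hk
        rw [hg k hk.2, update_of_ne hk.1]
      · rcases List.mem_cons.1 hk with rfl | hk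
        · exact hg' k hj
        · exact hg' k hk
    · refine ih fun g hg hg' => h g (fun k hk => ?_) (fun k hk => ?_)
      · rw [List.mem_cons, not_or] at hk
        rw [hg k hk.2, update_of_ne hk.1]
      · rcases List.mem_cons.1 hk with rfl | hk
        · rw [hg k hj, update_self]; exact mem_range.1 hc
        · exact hg' k hk

/-! ### The multinomial law of the colour counts. -/

theorem sum_countP_eq_length {l : List ℕ} {g : ℕ → ℕ} (h : ∀ k ∈ l, g k < 6) :
    ∑ c ∈ range 6, l.countP (fun k => g k = c) = l.length := by
  induction l with
  | nil => simp
  | cons j l ih =>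
    have hj : g j ∈ range 6 := mem_range.2 (h j List.mem_cons_self)
    simp only [List.countP_cons, sum_add_distrib, decide_eq_true_eq,
      ih fun k hk => h k (List.mem_cons_of_mem j hk), List.length_cons]
    rw [sum_ite_eq (range 6) (g j) (fun _ => 1), if_pos hj]

/-- The law of the colour counts is multinomial. -/
theorem resampleAll_counts_mul_le {l : List ℕ} (hl : l.Nodup) (z f : ℕ → ℕ) :
    resampleAll l (fun g => if ∀ c ∈ range 6, l.countP (fun k => g k = c) = z c then 1 else 0) f *
      ((6 ^ l.length * ∏ c ∈ range 6, (z c).factorial : ℕ) : ℝ≥0∞) ≤ (l.length.factorial : ℕ) := by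
  induction l generalizing z f with
  | nil =>
    rw [resampleAll_nil]
    by_cases h : ∀ c ∈ range 6, ([] : List ℕ).countP (fun k => f k = c) = z c
    · have : ∏ c ∈ range 6, (z c).factorial = 1 :=
        prod_eq_one fun c hc => by rw [← h c hc]; rfl
      rw [if_pos h, this]
      simp
    · rw [if_neg h, zero_mul]
      exact zero_le
  | cons j l ih =>
    have hj : j ∉ l := (List.nodup_cons.1 hl).1
    have hl' : l.Nodup := (List.nodup_cons.1 hl).2
    set φ : (ℕ → ℕ) → ℝ≥0∞ :=
      fun g => if ∀ c ∈ range 6, (j :: l).countP (fun k => g k = c) = z c then 1 else 0 with hφ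
    -- Counts that do not add up to the number of places cannot occur.
    by_cases hz : ∑ c ∈ range 6, z c = l.length + 1
    swap
    · have : resampleAll (j :: l) φ f = 0 := by
        rw [resampleAll_congr (ψ := fun _ => 0), resampleAll_const]
        intro g _ hg
        simp only [hφ]
        rw [if_neg]
        intro hc
        apply hz
        rw [← List.length_cons (a := j), ← sum_countP_eq_length hg]
        exact sum_congr rfl fun c hc' => (hc c hc').symm
      simp [this]
    -- Condition on the colour c at the first place: the remaining places must realise z with z c
    -- lowered by one, which accounts for the factor z c. Summing over c gives the length of the
    -- whole list, hence its factorial.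
    have key : ∀ c ∈ range 6, resampleAll l φ (update f j c) *
        ((6 ^ l.length * ∏ c ∈ range 6, (z c).factorial : ℕ) : ℝ≥0∞) ≤
          ((z c * l.length.factorial : ℕ) : ℝ≥0∞) := by
      intro c hc
      rcases Nat.eq_zero_or_pos (z c) with h0 | hpos
      · have : resampleAll l φ (update f j c) = 0 := by
          rw [resampleAll_congr (ψ := fun _ => 0), resampleAll_const]
          intro g hg _
          simp only [hφ]
          rw [if_neg]
          intro hc'
          have := hc' c hc
          rw [List.countP_cons, hg j hj, update_self, h0] at this
          simp at this
        simp [this]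
      · have : resampleAll l φ (update f j c) = resampleAll l
            (fun g => if ∀ d ∈ range 6, l.countP (fun k => g k = d) = update z c (z c - 1) d then 1
              else 0) (update f j c) := by
          refine resampleAll_congr fun g hg _ => ?_
          simp only [hφ]
          congr 1
          refine propext (forall₂_congr fun d hd => ?_)
          rw [List.countP_cons, hg j hj, update_self]
          rcases eq_or_ne d c with rfl | hdc
          · simp; omega
          · simp [update_of_ne hdc, hdc.symm]
        rw [this]
        have hprod : ∏ d ∈ range 6, (z d).factorial =
            z c * ∏ d ∈ range 6, (update z c (z c - 1) d).factorial := by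
          rw [← mul_prod_erase _ _ hc, ← mul_prod_erase _ (fun d => (update z c _ d).factorial) hc,
            update_self, ← mul_assoc, Nat.mul_factorial_pred hpos.ne']
          congr 1
          exact prod_congr rfl fun d hd => by rw [update_of_ne (ne_of_mem_erase hd)]
        rw [hprod]
        calc _ = (z c : ℝ≥0∞) * (_ * ((6 ^ l.length *
              ∏ d ∈ range 6, (update z c (z c - 1) d).factorial : ℕ) : ℝ≥0∞)) := by
              push_cast; ring
          _ ≤ _ := by
              push_cast
              gcongr
              exact_mod_cast ih hl' _ _
    rw [resampleAll_cons, resample, List.length_cons, pow_succ]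
    calc _ = (∑ c ∈ range 6, resampleAll l φ (update f j c)) *
          ((6 ^ l.length * ∏ c ∈ range 6, (z c).factorial : ℕ) : ℝ≥0∞) * (6 / 6) := by
          push_cast
          simp only [ENNReal.div_eq_inv_mul]; ring
      _ = ∑ c ∈ range 6, resampleAll l φ (update f j c) *
          ((6 ^ l.length * ∏ c ∈ range 6, (z c).factorial : ℕ) : ℝ≥0∞) := by
          rw [ENNReal.div_self (by norm_num) (by norm_num), mul_one, sum_mul]
      _ ≤ ∑ c ∈ range 6, ((z c * l.length.factorial : ℕ) : ℝ≥0∞) := sum_le_sum key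
      _ = _ := by rw [← Nat.cast_sum, ← sum_mul, hz, Nat.factorial_succ]

/-- The factors between q and z are compared one by one with q: those above are at least q, those
below at most q. -/
theorem factorial_mul_pow_le_factorial_mul_pow (q z : ℕ) :
    q.factorial * q ^ z ≤ z.factorial * q ^ q := by
  rcases le_total q z with h | h
  · calc q.factorial * q ^ z = q.factorial * q ^ (z - q) * q ^ q := by
          rw [mul_assoc, ← pow_add, Nat.sub_add_cancel h]
      _ ≤ _ := Nat.mul_le_mul_right _ (Nat.factorial_mul_pow_sub_le_factorial h)
  · calc q.factorial * q ^ z = z.factorial * q.descFactorial (q - z) * q ^ z := by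
          rw [← Nat.factorial_mul_descFactorial (Nat.sub_le q z), Nat.sub_sub_self h]
      _ ≤ z.factorial * q ^ (q - z) * q ^ z := by gcongr; exact Nat.descFactorial_le_pow _ _
      _ = _ := by rw [mul_assoc, ← pow_add, Nat.sub_add_cancel h]

/-- The balanced vector minimises the product of factorials: in the product of the previous
inequality over six colours the powers of q agree and cancel. -/
theorem factorial_pow_six_le {q : ℕ} {z : ℕ → ℕ} (h : ∑ c ∈ range 6, z c = 6 * q) :
    q.factorial ^ 6 ≤ ∏ c ∈ range 6, (z c).factorial := by
  have h1 : ∏ c ∈ range 6, (q.factorial * q ^ z c) ≤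
      ∏ c ∈ range 6, ((z c).factorial * q ^ q) :=
    prod_le_prod' fun c _ => factorial_mul_pow_le_factorial_mul_pow q (z c)
  rw [prod_mul_distrib, prod_mul_distrib, prod_pow_eq_pow_sum, h] at h1
  simp only [prod_const, card_range, ← pow_mul, mul_comm q 6] at h1
  refine Nat.le_of_mul_le_mul_right h1 ?_
  rcases Nat.eq_zero_or_pos q with rfl | hq
  · simp
  · positivity

/-- The bound for the central multinomial coefficient, squared to keep the exponent 5/2 integral. In
the induction step the new factors of (6q+6)! are paired around 6q+3, and (6q+3)²(q+2) ≤ 36(q+1)³ is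
used to the fifth power. -/
theorem factorial_six_mul_sq_le (q : ℕ) :
    (6 * q).factorial ^ 2 * (q + 1) ^ 5 ≤ (6 ^ (6 * q) * q.factorial ^ 6) ^ 2 := by
  induction q with
  | zero => simp
  | succ q ih =>
    have hf : (6 * (q + 1)).factorial = (6 * q).factorial *
        ((6 * q + 1) * (6 * q + 5) * ((6 * q + 2) * (6 * q + 4)) * (6 * q + 3)) * (6 * (q + 1)) := by
      rw [show 6 * (q + 1) = 6 * q + 1 + 1 + 1 + 1 + 1 + 1 by ring]
      simp only [Nat.factorial_succ]
      ring
    have h3 : (6 * q + 3) ^ 2 * (q + 1 + 1) ≤ 36 * (q + 1) ^ 3 := by nlinarith [sq_nonneg q]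
    have hP : ((6 * q + 1) * (6 * q + 5) * ((6 * q + 2) * (6 * q + 4)) * (6 * q + 3)) ≤
        (6 * q + 3) ^ 5 := by
      have h1 : (6 * q + 1) * (6 * q + 5) ≤ (6 * q + 3) ^ 2 := by nlinarith
      have h2 : (6 * q + 2) * (6 * q + 4) ≤ (6 * q + 3) ^ 2 := by nlinarith
      calc _ ≤ (6 * q + 3) ^ 2 * (6 * q + 3) ^ 2 * (6 * q + 3) := by gcongr
        _ = _ := by ring
    rw [hf]
    have hstep : ((6 * q + 3) ^ 5) ^ 2 * (6 * (q + 1)) ^ 2 * (q + 1 + 1) ^ 5 ≤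
        (6 ^ 6 * (q + 1) ^ 6) ^ 2 * (q + 1) ^ 5 := by
      calc _ = ((6 * q + 3) ^ 2 * (q + 1 + 1)) ^ 5 * (6 * (q + 1)) ^ 2 := by ring
        _ ≤ (36 * (q + 1) ^ 3) ^ 5 * (6 * (q + 1)) ^ 2 := by gcongr
        _ = _ := by ring
    calc _ ≤ ((6 * q).factorial * (6 * q + 3) ^ 5 * (6 * (q + 1))) ^ 2 * (q + 1 + 1) ^ 5 := by
          gcongr
      _ = (6 * q).factorial ^ 2 *
          (((6 * q + 3) ^ 5) ^ 2 * (6 * (q + 1)) ^ 2 * (q + 1 + 1) ^ 5) := by ring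
      _ ≤ (6 * q).factorial ^ 2 * ((6 ^ 6 * (q + 1) ^ 6) ^ 2 * (q + 1) ^ 5) := by gcongr
      _ = (6 * q).factorial ^ 2 * (q + 1) ^ 5 * (6 ^ 6 * (q + 1) ^ 6) ^ 2 := by ring
      _ ≤ (6 ^ (6 * q) * q.factorial ^ 6) ^ 2 * (6 ^ 6 * (q + 1) ^ 6) ^ 2 := by gcongr
      _ = _ := by rw [Nat.factorial_succ, mul_add, pow_add, mul_pow (q + 1)]; ring

/-- Prescribed colour counts of `6 q` random colours have probability at most `(q + 1) ^ (-5/2)`. -/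
theorem resampleAll_counts_le {l : List ℕ} {q : ℕ} (hl : l.Nodup) (hq : l.length = 6 * q)
    (z f : ℕ → ℕ) :
    resampleAll l (fun g => if ∀ c ∈ range 6, l.countP (fun k => g k = c) = z c then 1 else 0) f ≤
      ENNReal.ofReal (((q : ℝ) + 1) ^ (-(5 / 2) : ℝ)) := by
  by_cases hz : ∑ c ∈ range 6, z c = 6 * q
  swap
  · rw [resampleAll_congr (ψ := fun _ => 0), resampleAll_const]
    · exact zero_le
    intro g _ hg
    rw [if_neg]
    intro hc
    apply hz
    rw [← hq, ← sum_countP_eq_length hg]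
    exact sum_congr rfl fun c hc' => (hc c hc').symm
  have h1 := resampleAll_counts_mul_le hl z f
  have h2 := factorial_pow_six_le hz
  have h3 := factorial_six_mul_sq_le q
  rw [hq] at h1
  generalize hxdef : resampleAll l
    (fun g => if ∀ c ∈ range 6, l.countP (fun k => g k = c) = z c then 1 else 0) f = x at h1 ⊢
  have hle1 : x ≤ 1 := by
    rw [← hxdef]
    calc _ ≤ resampleAll l (fun _ => 1) f := resampleAll_mono l (fun g => by split_ifs <;> simp) f
      _ = 1 := by rw [resampleAll_const]
  have hx : x ≠ ⊤ := ne_top_of_le_ne_top ENNReal.one_ne_top hle1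
  clear hxdef
  obtain ⟨x, rfl⟩ : ∃ y : NNReal, x = y := ⟨x.toNNReal, (ENNReal.coe_toNNReal hx).symm⟩
  rw [ENNReal.le_ofReal_iff_toReal_le (by simp) (by positivity), ENNReal.coe_toReal]
  have h4 : (x : ℝ) * (6 ^ (6 * q) * q.factorial ^ 6 : ℕ) ≤ (6 * q).factorial := by
    have h1' : x * ((6 ^ (6 * q) * ∏ c ∈ range 6, (z c).factorial : ℕ) : NNReal) ≤
      ((6 * q).factorial : NNReal) := by exact_mod_cast h1
    have h1'' : (x : ℝ) * ((6 ^ (6 * q) * ∏ c ∈ range 6, (z c).factorial : ℕ) : ℝ) ≤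
      ((6 * q).factorial : ℝ) := by exact_mod_cast h1'
    refine le_trans ?_ h1''
    gcongr
  have h5 : ((6 * q).factorial : ℝ) ^ 2 * (q + 1) ^ 5 ≤ ((6 ^ (6 * q) * q.factorial ^ 6 : ℕ) : ℝ) ^ 2 := by
    exact_mod_cast h3
  have hM : (0 : ℝ) < (6 ^ (6 * q) * q.factorial ^ 6 : ℕ) := by
    have := q.factorial_pos
    exact_mod_cast (by positivity : 0 < 6 ^ (6 * q) * q.factorial ^ 6)
  set M : ℝ := ((6 ^ (6 * q) * q.factorial ^ 6 : ℕ) : ℝ)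
  -- Compare squares, in which the half-integral exponent disappears.
  have h6 : (x : ℝ) ^ 2 * (q + 1) ^ 5 ≤ 1 := by
    have : (x : ℝ) ^ 2 * (q + 1) ^ 5 * M ^ 2 ≤ 1 * M ^ 2 := by
      calc _ = (x * M) ^ 2 * ((q : ℝ) + 1) ^ 5 := by ring
        _ ≤ ((6 * q).factorial : ℝ) ^ 2 * (q + 1) ^ 5 := by gcongr
        _ ≤ _ := by linarith
    exact le_of_mul_le_mul_right this (by positivity)
  have hq1 : (0 : ℝ) < (q : ℝ) + 1 := by positivity
  have h7 : ((((q : ℝ) + 1) ^ (-(5 / 2) : ℝ))) ^ 2 * ((q : ℝ) + 1) ^ 5 = 1 := by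
    rw [← Real.rpow_natCast, ← Real.rpow_natCast, ← Real.rpow_mul hq1.le, ← Real.rpow_add hq1]
    norm_num
  refine le_of_sq_le_sq ?_ (by positivity)
  refine le_of_mul_le_mul_right (a := ((q : ℝ) + 1) ^ 5) ?_ (by positivity)
  rw [h7]; exact h6

end Resampling

section Resampling

theorem resampleAll_le_of_le {l : List ℕ} {φ ψ : (ℕ → ℕ) → ℝ≥0∞} {f : ℕ → ℕ}
    (h : ∀ g : ℕ → ℕ, (∀ k, k ∉ l → g k = f k) → (∀ k ∈ l, g k < 6) → φ g ≤ ψ g) :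
    resampleAll l φ f ≤ resampleAll l ψ f := by
  -- On the relevant colourings φ equals min φ ψ, which is below ψ everywhere.
  rw [resampleAll_congr (ψ := fun g => min (φ g) (ψ g)) fun g h1 h2 => (min_eq_left (h g h1 h2)).symm]
  exact resampleAll_mono l (fun g => min_le_right _ _) f

end Resampling

/-! ### A product that determines a multiset. -/

section Keys

open Finset Polynomial

/-- The coefficients are the digits of the value in base N. -/
theorem Polynomial.coeff_eq_of_eval_eq {N : ℕ} (i : ℕ) (P Q : ℕ[X]) (hP : ∀ i, P.coeff i < N)
    (hQ : ∀ i, Q.coeff i < N) (h : P.eval N = Q.eval N) : P.coeff i = Q.coeff i := by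
  have hN : 0 < N := (Nat.zero_le _).trans_lt (hP 0)
  have e : ∀ R : ℕ[X], R.eval N = R.divX.eval N * N + R.coeff 0 := fun R => by
    conv_lhs => rw [← divX_mul_X_add R]
    simp
  have h0 : P.coeff 0 = Q.coeff 0 := by
    have := congrArg (· % N) h
    simpa [e P, e Q, Nat.mod_eq_of_lt (hP 0), Nat.mod_eq_of_lt (hQ 0)] using this
  induction i generalizing P Q with
  | zero => exact h0
  | succ i ih =>
    rw [← coeff_divX, ← coeff_divX]
    have hd : P.divX.eval N = Q.divX.eval N := by
      rw [e P, e Q, h0] at h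
      exact Nat.eq_of_mul_eq_mul_right hN (Nat.add_right_cancel h)
    refine ih P.divX Q.divX (fun i => by rw [coeff_divX]; exact hP _)
      (fun i => by rw [coeff_divX]; exact hQ _) hd ?_
    have := congrArg (· % N) hd
    simpa [e P.divX, e Q.divX, Nat.mod_eq_of_lt (hP 1), Nat.mod_eq_of_lt (hQ 1), coeff_divX]
      using this

theorem Polynomial.coeff_le_eval_one (P : ℕ[X]) (i : ℕ) : P.coeff i ≤ P.eval 1 := by
  rw [eval_eq_sum, Polynomial.sum]
  by_cases h : i ∈ P.support
  · calc P.coeff i = P.coeff i * 1 ^ i := by simp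
      _ ≤ _ := single_le_sum (f := fun i => P.coeff i * 1 ^ i) (fun _ _ => Nat.zero_le _) h
  · rw [notMem_support_iff.1 h]; exact Nat.zero_le _

/-- If `N` is large compared to the elements of two multisets `s` and `t` of the same size, then
the product of all `N + x` determines the multiset. -/
theorem Multiset.eq_of_prod_add_eq {s t : Multiset ℕ} {M N : ℕ} (hs : ∀ x ∈ s, x ≤ M)
    (ht : ∀ x ∈ t, x ≤ M) (hN : (M + 1) ^ s.card < N) (hst : s.card = t.card)
    (h : (s.map fun x => N + x).prod = (t.map fun x => N + x).prod) : s = t := by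
  have heval : ∀ (r : Multiset ℕ) (y : ℕ), (r.map fun x => X + C x).prod.eval y =
      (r.map fun x => y + x).prod := fun r y => by
    rw [eval_multiset_prod, Multiset.map_map]; simp
  -- Each coefficient is at most the value at 1, which is a product of factors 1 + x ≤ M + 1.
  have hcoeff : ∀ r : Multiset ℕ, (∀ x ∈ r, x ≤ M) → r.card = s.card →
      ∀ i, (r.map fun x => X + C x).prod.coeff i < N := fun r hr hc i => by
    refine ((coeff_le_eval_one _ i).trans ?_).trans_lt hN
    rw [heval, ← hc]
    calc _ ≤ (r.map fun _ => M + 1).prod :=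
          Multiset.prod_map_le_prod_map _ _ fun x hx => by have := hr x hx; omega
      _ = _ := by simp
  have hpoly : (s.map fun x => X + C x).prod = (t.map fun x => X + C x).prod :=
    Polynomial.ext fun i => coeff_eq_of_eval_eq i _ _ (hcoeff s hs rfl) (hcoeff t ht hst.symm)
      (by simpa only [heval, Nat.cast_id] using h)
  -- Over the integers the multiset is read off from the roots -x.
  have hroots : ∀ r : Multiset ℕ, ((r.map fun x => X + C x).prod.map (Nat.castRingHom ℤ)).roots =
      r.map fun x : ℕ => -(x : ℤ) := fun r => by
    rw [← roots_multiset_prod_X_sub_C (r.map fun x : ℕ => -(x : ℤ)), Polynomial.map_multiset_prod,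
      Multiset.map_map, Multiset.map_map]
    simp
  have := hroots t
  rw [← hpoly, hroots s] at this
  exact Multiset.map_injective (fun x y hxy => by simpa using hxy) this

end Keys

/-! ### Graphs as edge arrays and the probability of a conflict. -/

/-- A simple graph on the vertices `0, …, n - 1` with the edges `a j, b j` for `j < m`. -/
structure EdgeArray where
  n : ℕ
  m : ℕ
  a : ℕ → ℕ
  b : ℕ → ℕ
  a_lt : ∀ j < m, a j < n
  b_lt : ∀ j < m, b j < n
  ne : ∀ j < m, a j ≠ b j
  simple : ∀ j < m, ∀ k < m, ∀ u v, u ≠ v → (a j = u ∨ b j = u) → (a j = v ∨ b j = v) →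
    (a k = u ∨ b k = u) → (a k = v ∨ b k = v) → j = k

namespace EdgeArray

open Finset

variable (E : EdgeArray)

/-- The edges with numbers below `k` at the vertex `u`. -/
def star (k u : ℕ) : List ℕ :=
  (List.range k).filter fun j => E.a j = u ∨ E.b j = u

/-- The degree of the vertex `u`. -/
def deg (u : ℕ) : ℕ := (E.star E.m u).length

/-- The other endpoint of the edge `j` at the vertex `u`. -/
def other (u j : ℕ) : ℕ := E.a j + E.b j - u

/-- The number of edges of colour `c` at `u` among the first `k` edges. -/
def count (k : ℕ) (f : ℕ → ℕ) (u c : ℕ) : ℕ :=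
  (E.star k u).countP fun j => f j = c

/-- A symmetric function of the colour counts at `u`, which determines the palette of `u`. -/
def key (f : ℕ → ℕ) (u : ℕ) : ℕ :=
  ∏ c ∈ range 6, (E.m ^ 7 + E.count E.m f u c)

variable {E}

theorem mem_star {k u j : ℕ} : j ∈ E.star k u ↔ j < k ∧ (E.a j = u ∨ E.b j = u) := by
  simp [star]

theorem nodup_star (k u : ℕ) : (E.star k u).Nodup :=
  List.nodup_range.filter _

theorem length_star_le (k u : ℕ) : (E.star k u).length ≤ k :=
  (List.length_filter_le _ _).trans_eq List.length_range

theorem star_succ (k u : ℕ) :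
    E.star (k + 1) u = E.star k u ++ if E.a k = u ∨ E.b k = u then [k] else [] := by
  rw [star, star, List.range_succ, List.filter_append]
  congr 1
  split_ifs with h <;> simp [h]

theorem count_le (k : ℕ) (f : ℕ → ℕ) (u c : ℕ) : E.count k f u c ≤ k :=
  List.countP_le_length.trans (length_star_le k u)

theorem other_spec {u j : ℕ} (h : j ∈ E.star E.m u) :
    E.other u j < E.n ∧ E.other u j ≠ u ∧ (E.a j = E.other u j ∨ E.b j = E.other u j) := by
  obtain ⟨hj, h⟩ := mem_star.1 h
  have h1 := E.a_lt j hj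
  have h2 := E.b_lt j hj
  have h3 := E.ne j hj
  unfold other
  omega

theorem endpoint_eq {u j v : ℕ} (h : j ∈ E.star E.m u) (hv : E.a j = v ∨ E.b j = v) :
    v = u ∨ v = E.other u j := by
  obtain ⟨hj, h⟩ := mem_star.1 h
  unfold other
  omega

theorem count_update_of_ne {f : ℕ → ℕ} {u j x : ℕ} (h : j ∉ E.star E.m u) :
    E.count E.m (Function.update f j x) u = E.count E.m f u := by
  funext c
  refine List.countP_congr fun i hi => ?_
  rw [Function.update_of_ne]
  rintro rfl
  exact h hi

theorem key_update_of_ne {f : ℕ → ℕ} {u j x : ℕ} (h : j ∉ E.star E.m u) :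
    E.key (Function.update f j x) u = E.key f u := by
  rw [key, key, count_update_of_ne h]

theorem sum_length_star {k : ℕ} (hk : k ≤ E.m) :
    ∑ u ∈ range E.n, (E.star k u).length = 2 * k := by
  induction k with
  | zero => simp [star]
  | succ k ih =>
    have h1 := E.a_lt k (by omega)
    have h2 := E.b_lt k (by omega)
    have h3 := E.ne k (by omega)
    have : ∀ u ∈ range E.n, (E.star (k + 1) u).length =
        (E.star k u).length + ((if u = E.a k then 1 else 0) + if u = E.b k then 1 else 0) := by
      intro u _
      rw [star_succ, List.length_append]
      congr 1
      by_cases ha : E.a k = u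
      · simp [ha, show u ≠ E.b k from ha ▸ h3]
      · by_cases hb : E.b k = u
        · simp [ha, hb, Ne.symm ha]
        · simp [ha, hb, Ne.symm ha, Ne.symm hb]
    rw [sum_congr rfl this, sum_add_distrib, ih (by omega), sum_add_distrib, sum_ite_eq',
      sum_ite_eq', if_pos (mem_range.2 h1), if_pos (mem_range.2 h2)]
    ring

/-- The base m⁷ exceeds (m+1)⁶ once m > 64, because (m+1)⁶ ≤ (2m)⁶ = 64m⁶. This direction serves the
probability estimate only. -/
theorem map_count_perm_of_key_eq (hm : 65 ≤ E.m) {f g : ℕ → ℕ} {u v : ℕ}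
    (h : E.key f u = E.key g v) :
    ((List.range 6).map (E.count E.m f u)).Perm ((List.range 6).map (E.count E.m g v)) := by
  rw [← Multiset.coe_eq_coe]
  refine Multiset.eq_of_prod_add_eq (M := E.m) (N := E.m ^ 7) ?_ ?_ ?_ (by simp) ?_
  · simp only [Multiset.mem_coe, List.mem_map]
    rintro _ ⟨c, -, rfl⟩
    exact count_le _ _ _ _
  · simp only [Multiset.mem_coe, List.mem_map]
    rintro _ ⟨c, -, rfl⟩
    exact count_le _ _ _ _
  · simp only [Multiset.coe_card, List.length_map, List.length_range]
    calc (E.m + 1) ^ 6 ≤ (2 * E.m) ^ 6 := by gcongr; omega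
      _ = 64 * E.m ^ 6 := by ring
      _ < E.m * E.m ^ 6 := by gcongr; omega
      _ = _ := by ring
  · have : ∀ (f : ℕ → ℕ) (u : ℕ), (Multiset.map (fun x => E.m ^ 7 + x)
        ((List.range 6).map (E.count E.m f u) : Multiset ℕ)).prod = E.key f u := fun f u => by
      rw [← Multiset.map_coe, Multiset.map_map]
      rfl
    rw [this, this, h]

/-- Given everything but the colours at `u`, a neighbour of `u` has the same key as `u` with
probability at most `720 (q + 1) ^ (-5/2)`. -/
theorem resampleAll_key_eq_le (hm : 65 ≤ E.m) {u j : ℕ} (hj : j ∈ E.star E.m u) (f : ℕ → ℕ) :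
    resampleAll (E.star E.m u) (fun g => if E.key g u = E.key g (E.other u j) then 1 else 0) f ≤
      720 * ENNReal.ofReal ((((E.deg u - 1) / 6 : ℕ) + 1 : ℝ) ^ (-(5 / 2) : ℝ)) := by
  classical
  set q := (E.deg u - 1) / 6 with hq
  set p := ENNReal.ofReal (((q : ℝ) + 1) ^ (-(5 / 2) : ℝ)) with hp
  set v := E.other u j with hv
  set l := (E.star E.m u).erase j with hl
  have hlen : l.length = E.deg u - 1 := List.length_erase_of_mem hj
  -- Exactly 6q edges other than j are kept random. The edge j and the at most five left over are
  -- fixed first.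
  set l₂ := l.drop (l.length - 6 * q) with hl₂
  set l₁ := j :: l.take (l.length - 6 * q) with hl₁
  have hlen₂ : l₂.length = 6 * q := by
    rw [hl₂, List.length_drop]; omega
  have hperm : (E.star E.m u).Perm (l₁ ++ l₂) := by
    refine (List.perm_cons_erase hj).trans ?_
    rw [hl₁, hl₂, List.cons_append, List.take_append_drop]
  have hnodup : (l₁ ++ l₂).Nodup := hperm.nodup_iff.1 (nodup_star _ _)
  obtain ⟨-, hnodup₂, hdisj⟩ := List.nodup_append.1 hnodup
  rw [resampleAll_perm hperm, resampleAll_append]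
  refine (resampleAll_mono l₁ (ψ := fun _ => 720 * p) (fun g => ?_) f).trans_eq
    (by rw [resampleAll_const])
  -- In a simple graph j is the only edge joining u and v, so the random edges do not change the
  -- counts at v.
  have hlv : ∀ k ∈ l₂, k ∉ E.star E.m v := by
    intro k hk hkv
    have hku : k ∈ E.star E.m u := hperm.mem_iff.2 (List.mem_append_right _ hk)
    have := E.simple k (mem_star.1 hku).1 j (mem_star.1 hj).1 u v (other_spec hj).2.1.symm
      (mem_star.1 hku).2 (mem_star.1 hkv).2 (mem_star.1 hj).2 (other_spec hj).2.2
    exact hdisj j List.mem_cons_self k hk this.symm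
  -- The candidates for the count vector of u: all rearrangements of that of v.
  set T := ((List.range 6).map (E.count E.m g v)).permutations.toFinset with hT
  have hcard : T.card ≤ 720 := by
    refine (List.toFinset_card_le _).trans_eq ?_
    rw [List.length_permutations]
    simp [Nat.factorial]
  -- Union bound over the candidates t. The fixed edges contribute known counts, so t prescribes the
  -- counts of the random ones. The truncated subtraction is exact whenever t is the actual count
  -- vector.
  calc resampleAll l₂ (fun g => if E.key g u = E.key g v then 1 else 0) g
      ≤ resampleAll l₂ (fun h => ∑ t ∈ T, if ∀ c ∈ range 6, l₂.countP (fun k => h k = c) =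
          (fun c => t.getD c 0 - l₁.countP (fun k => g k = c)) c then 1 else 0) g := by
        refine resampleAll_le_of_le fun h hoff _ => ?_
        by_cases hkey : E.key h u = E.key h v
        swap
        · rw [if_neg hkey]; exact zero_le
        rw [if_pos hkey]
        have hcv : E.count E.m h v = E.count E.m g v := by
          funext c
          refine List.countP_congr fun i hi => ?_
          rw [hoff i fun hi' => hlv i hi' hi]
        have ht : (List.range 6).map (E.count E.m h u) ∈ T := by
          rw [hT, List.mem_toFinset, List.mem_permutations, ← hcv]
          exact map_count_perm_of_key_eq hm hkey
        refine le_trans ?_ (single_le_sum (fun _ _ => zero_le) ht)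
        rw [if_pos]
        intro c hc
        have hc6 := mem_range.1 hc
        have h1 : E.count E.m h u c = l₁.countP (fun k => g k = c) + l₂.countP (fun k => h k = c) := by
          rw [count, hperm.countP_eq, List.countP_append]
          congr 1
          refine List.countP_congr fun i hi => ?_
          rw [hoff i fun hi' => hdisj i hi i hi' rfl]
        simp only [List.getD_eq_getElem?_getD, List.getElem?_map, List.getElem?_range hc6,
          Option.map_some, Option.getD_some, h1]
        omega
    _ = ∑ t ∈ T, _ := by rw [resampleAll_sum]
    _ ≤ ∑ t ∈ T, p := sum_le_sum fun t _ => resampleAll_counts_le hnodup₂ hlen₂ _ _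
    _ ≤ _ := by
        rw [sum_const, nsmul_eq_mul]
        gcongr
        exact_mod_cast hcard

end EdgeArray

/-! ### The probability of failure of a machine. -/

namespace WordRAM

/-- The probability that after `t` steps from `c` the machine has not halted with a store that
satisfies `Q`. -/
noncomputable def failProb (w : ℕ) (Q : Store → Prop) (t : ℕ) (c : Config) : ℝ≥0∞ :=
  (run w t c).toOuterMeasure {c | ¬ (c.Halted ∧ Q c.store)}

section FailProb

variable {w : ℕ} {Q : Store → Prop}

theorem failProb_le_one (t : ℕ) (c : Config) : failProb w Q t c ≤ 1 := by
  rw [failProb, PMF.toOuterMeasure_apply, ← (run w t c).tsum_coe]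
  exact ENNReal.tsum_le_tsum fun _ => Set.indicator_le_self _ _ _

theorem failProb_succ (t : ℕ) (c : Config) :
    failProb w Q (t + 1) c = ∑' c', step w c c' * failProb w Q t c' :=
  PMF.toOuterMeasure_bind_apply _ _ _

theorem failProb_succ_of_step_eq_pure {c c' : Config} (h : step w c = PMF.pure c') (t : ℕ) :
    failProb w Q (t + 1) c = failProb w Q t c' := by
  rw [failProb, run, h, PMF.pure_bind]
  rfl

theorem failProb_zero_of_not {c : Config} (h : ¬ (c.Halted ∧ Q c.store)) :
    failProb w Q 0 c = 1 := by
  rw [failProb, run]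
  have : c ∈ {c : Config | ¬ (c.Halted ∧ Q c.store)} := h
  rw [PMF.toOuterMeasure_pure_apply, if_pos this]

theorem failProb_of_halted {c : Config} (h : c.Halted) (hQ : Q c.store) (t : ℕ) :
    failProb w Q t c = 0 := by
  obtain ⟨K, σ⟩ := c
  obtain rfl : K = [] := h
  induction t with
  | zero =>
    rw [failProb, run, PMF.toOuterMeasure_pure_apply, if_neg]
    exact fun h' => h' ⟨rfl, hQ⟩
  | succ t ih => rw [failProb_succ_of_step_eq_pure (c' := ⟨[], σ⟩) (by rw [step]), ih]

/-- A halted configuration never changes, so success is permanent. Hence step counts can be rounded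
up freely later on. -/
theorem failProb_succ_le (t : ℕ) (c : Config) : failProb w Q (t + 1) c ≤ failProb w Q t c := by
  induction t generalizing c with
  | zero =>
    by_cases h : c.Halted ∧ Q c.store
    · rw [failProb_of_halted h.1 h.2]; exact zero_le
    · rw [failProb_zero_of_not h]; exact failProb_le_one _ _
  | succ t ih =>
    rw [failProb_succ, failProb_succ t]
    exact ENNReal.tsum_le_tsum fun c' => mul_le_mul_right (ih c') _

theorem failProb_antitone (c : Config) : Antitone fun t => failProb w Q t c :=
  antitone_nat_of_succ_le fun t => failProb_succ_le t c

theorem failProb_le_of_le {s t : ℕ} (h : s ≤ t) (c : Config) :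
    failProb w Q t c ≤ failProb w Q s c :=
  failProb_antitone c h

end FailProb

/-- Write `x` into the register `r`, for a word `x`. -/
def Store.set (σ : Store) (r x : ℕ) : Store :=
  { σ with reg := Function.update σ.reg r x }

theorem Store.setReg_eq_set {w x : ℕ} (hx : x < 2 ^ w) (σ : Store) (r : ℕ) :
    σ.setReg w r x = σ.set r x := by
  rw [setReg, Nat.mod_eq_of_lt hx, set]

theorem Store.reg_set (σ : Store) (r x r' : ℕ) :
    (σ.set r x).reg r' = if r' = r then x else σ.reg r' :=
  Function.update_apply _ _ _ _

theorem Store.mem_set (σ : Store) (r x : ℕ) : (σ.set r x).mem = σ.mem := rfl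

/-! ### Execution of straight-line code, branches, loops and draws. -/

namespace Program

/-- Programs without loops and random draws. -/
def Straight : Program → Prop
  | rand _ _ => False
  | whileLt _ _ _ => False
  | seq p q => p.Straight ∧ q.Straight
  | ifLt _ _ p q => p.Straight ∧ q.Straight
  | _ => True

/-- A bound on the number of steps of a straight program. -/
def cost : Program → ℕ
  | seq p q => p.cost + q.cost + 1
  | ifLt _ _ p q => max p.cost q.cost + 1
  | _ => 1

/-- The effect of a straight program. -/
def exec (w : ℕ) : Program → Store → Store
  | const r k, σ => σ.setReg w r k
  | add r a b, σ => σ.setReg w r (σ.reg a + σ.reg b)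
  | sub r a b, σ => σ.setReg w r (σ.reg a - σ.reg b)
  | mul r a b, σ => σ.setReg w r (σ.reg a * σ.reg b)
  | load r a, σ => σ.setReg w r (σ.mem (σ.reg a))
  | store a r, σ => σ.setMem w (σ.reg a) (σ.reg r)
  | seq p q, σ => q.exec w (p.exec w σ)
  | ifLt a b p q, σ => if σ.reg a < σ.reg b then p.exec w σ else q.exec w σ
  | rand _ _, σ => σ
  | whileLt _ _ _, σ => σ

theorem exec_seq (w : ℕ) (p q : Program) (σ : Store) :
    (seq p q).exec w σ = q.exec w (p.exec w σ) := rfl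

theorem exec_ifLt (w a b : ℕ) (p q : Program) (σ : Store) :
    (ifLt a b p q).exec w σ = if σ.reg a < σ.reg b then p.exec w σ else q.exec w σ := rfl

end Program

infixr:60 " ;; " => Program.seq

section

variable {w : ℕ} {Q : Store → Prop}

theorem failProb_seq (t : ℕ) (p q : Program) (K : List Program) (σ : Store) :
    failProb w Q (t + 1) ⟨(p ;; q) :: K, σ⟩ = failProb w Q t ⟨p :: q :: K, σ⟩ :=
  failProb_succ_of_step_eq_pure (by rw [step]) t

theorem failProb_ifLt (t a b : ℕ) (p q : Program) (K : List Program) (σ : Store) :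
    failProb w Q (t + 1) ⟨.ifLt a b p q :: K, σ⟩ =
      failProb w Q t ⟨(if σ.reg a < σ.reg b then p else q) :: K, σ⟩ :=
  failProb_succ_of_step_eq_pure (by rw [step]) t

theorem failProb_whileLt_of_lt {a b : ℕ} {σ : Store} (h : σ.reg a < σ.reg b) (t : ℕ) (p : Program)
    (K : List Program) :
    failProb w Q (t + 1) ⟨.whileLt a b p :: K, σ⟩ =
      failProb w Q t ⟨p :: .whileLt a b p :: K, σ⟩ :=
  failProb_succ_of_step_eq_pure (by rw [step, if_pos h]) t

theorem failProb_whileLt_of_not_lt {a b : ℕ} {σ : Store} (h : ¬ σ.reg a < σ.reg b) (t : ℕ)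
    (p : Program) (K : List Program) :
    failProb w Q (t + 1) ⟨.whileLt a b p :: K, σ⟩ = failProb w Q t ⟨K, σ⟩ :=
  failProb_succ_of_step_eq_pure (by rw [step, if_neg h]) t

theorem uniformBelow_six :
    uniformBelow 6 = (PMF.uniformOfFintype (Fin 6)).bind fun i => PMF.pure (i : ℕ) :=
  PMF.map_id _

/-- The link between the machine and `resample`: a draw from six values turns failure into an
average over colours. -/
theorem failProb_rand_six {a r : ℕ} {σ : Store} (h : σ.reg a = 6) (hw : 6 ≤ 2 ^ w) (t : ℕ)
    (K : List Program) :
    failProb w Q (t + 1) ⟨.rand r a :: K, σ⟩ =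
      (∑ c ∈ Finset.range 6, failProb w Q t ⟨K, σ.set r c⟩) / 6 := by
  have hs : ∀ i : Fin 6, σ.setReg w r i = σ.set r i := fun i =>
    Store.setReg_eq_set (by omega) σ r
  rw [failProb, run, step, h, uniformBelow_six, PMF.bind_map, PMF.bind_bind]
  simp only [PMF.pure_bind, Function.comp_apply, hs]
  rw [PMF.toOuterMeasure_bind_apply, tsum_fintype, ← Fin.sum_univ_eq_sum_range
      (fun c => failProb w Q t ⟨K, σ.set r c⟩) 6, ENNReal.div_eq_inv_mul, Finset.mul_sum]
  refine Finset.sum_congr rfl fun i _ => ?_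
  rw [PMF.uniformOfFintype_apply, Fintype.card_fin]
  rfl

/-- An inequality only, since `cost` charges the more expensive branch and spare steps can only
reduce failure. -/
theorem failProb_straight {p : Program} (hp : p.Straight) (t : ℕ) (K : List Program) (σ : Store) :
    failProb w Q (t + p.cost) ⟨p :: K, σ⟩ ≤ failProb w Q t ⟨K, p.exec w σ⟩ := by
  induction p generalizing t K σ with
  | rand => exact hp.elim
  | whileLt => exact hp.elim
  | seq p q ihp ihq =>
    rw [Program.cost, show t + (p.cost + q.cost + 1) = t + q.cost + p.cost + 1 by ring,
      failProb_seq]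
    exact (ihp hp.1 _ _ _).trans (ihq hp.2 _ _ _)
  | ifLt a b p q ihp ihq =>
    rw [Program.cost, ← add_assoc, failProb_ifLt, Program.exec_ifLt]
    split_ifs with h
    · exact (failProb_le_of_le (Nat.add_le_add_left (le_max_left _ _) t) _).trans (ihp hp.1 _ _ _)
    · exact (failProb_le_of_le (Nat.add_le_add_left (le_max_right _ _) t) _).trans (ihq hp.2 _ _ _)
  | _ => exact (failProb_succ_of_step_eq_pure (by rw [step]; rfl) t).le

end

/-! ### Correctness on halting from vanishing failure. -/

section Tail

variable {w : ℕ}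

theorem toOuterMeasure_not_halted_le {Q : Store → Prop} {P : Program} {σ : Store} (t : ℕ) :
    (runProgram w P σ t).toOuterMeasure {c | ¬ c.Halted} ≤ failProb w Q t ⟨[P], σ⟩ :=
  (runProgram w P σ t).toOuterMeasure.mono fun _ hc hc' => hc hc'.1

/-- If the probability of failure becomes arbitrarily small, then every configuration in which
the machine halts is successful. -/
theorem of_halted_of_failProb_small {Q : Store → Prop} {c₀ : Config}
    (h : ∀ ε : ℝ≥0∞, 0 < ε → ∃ t, failProb w Q t c₀ < ε) (t : ℕ) {c : Config}
    (hc : c ∈ (run w t c₀).support) (hh : c.Halted) : Q c.store := by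
  by_contra hQ
  -- A halted unsuccessful configuration stays put, so its mass at time t is contained in the
  -- failure at every later time.
  have key : ∀ s : ℕ, ∀ c₀, run w t c₀ c ≤ failProb w Q (t + s) c₀ := by
    intro s
    clear hc
    induction t with
    | zero =>
      intro c₀
      rw [run, PMF.pure_apply]
      split_ifs with he
      · subst he
        rw [zero_add]
        induction s with
        | zero => rw [failProb_zero_of_not fun h' => hQ h'.2]
        | succ s ih =>
          refine ih.trans_eq ?_
          obtain ⟨K, σ⟩ := c
          obtain rfl : K = [] := hh
          rw [failProb_succ_of_step_eq_pure (c' := ⟨[], σ⟩) (by rw [step])]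
      · exact zero_le
    | succ t ih =>
      intro c₀
      rw [show t + 1 + s = t + s + 1 by ring, failProb_succ, run, PMF.bind_apply]
      exact ENNReal.tsum_le_tsum fun c₁ => mul_le_mul_right (ih c₁) _
  obtain ⟨s, hs⟩ := h _ (pos_iff_ne_zero.2 ((PMF.mem_support_iff _ _).1 hc))
  exact absurd ((key s c₀).trans (failProb_le_of_le (Nat.le_add_left s t) _)) hs.not_ge

end Tail

end WordRAM

/-! ### The layout of the memory and the invariants of its tables. -/

open WordRAM

theorem WordRAM.Store.set_set (σ : Store) (r x y : ℕ) : (σ.set r x).set r y = σ.set r y := by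
  simp [Store.set]

/-- The two stores agree on all registers outside `S`. -/
def WordRAM.AgreeOff (S : List ℕ) (σ σ' : Store) : Prop :=
  ∀ r, r ∉ S → σ'.reg r = σ.reg r

theorem WordRAM.AgreeOff.trans {S T : List ℕ} {σ σ' σ'' : Store} (h : AgreeOff S σ σ')
    (h' : AgreeOff T σ' σ'') : AgreeOff (S ++ T) σ σ'' := fun r hr => by
  rw [List.mem_append, not_or] at hr
  rw [h' r hr.2, h r hr.1]

theorem WordRAM.AgreeOff.mono {S T : List ℕ} {σ σ' : Store} (h : AgreeOff S σ σ')
    (hST : S ⊆ T) : AgreeOff T σ σ' := fun r hr => h r fun hr' => hr (hST hr')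

/-- The tables that the program keeps in memory. -/
structure Tables where
  deg : ℕ → ℕ
  flag : ℕ → ℕ
  stk : ℕ → ℕ
  cnt : ℕ → ℕ → ℕ
  adj : ℕ → ℕ → ℕ
  col : ℕ → ℕ

namespace Tables

open Function

def setDeg (D : Tables) (u x : ℕ) : Tables := { D with deg := update D.deg u x }
def setFlag (D : Tables) (u x : ℕ) : Tables := { D with flag := update D.flag u x }
def setStk (D : Tables) (i x : ℕ) : Tables := { D with stk := update D.stk i x }
def setCnt (D : Tables) (c u x : ℕ) : Tables :=
  { D with cnt := update D.cnt c (update (D.cnt c) u x) }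
def setAdj (D : Tables) (i u x : ℕ) : Tables :=
  { D with adj := update D.adj i (update (D.adj i) u x) }
def setCol (D : Tables) (j x : ℕ) : Tables := { D with col := update D.col j x }

end Tables

namespace EdgeArray

variable (E : EdgeArray)

/-- The length of the rows in memory. -/
def width : ℕ := 3 * E.m + E.n + 1

/-- The address of the entry `u` of the row `r`. -/
def cell (r u : ℕ) : ℕ := E.width * r + u

/-- Words of `w` bits are long enough for the program. -/
structure WordSize (w : ℕ) : Prop where
  cells : E.width * (E.m + 11) ≤ 2 ^ w
  keys : (E.m ^ 7 + E.m) ^ 6 < 2 ^ w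

/-- The memory holds the edges and the tables `D`. -/
structure Stored (mem : ℕ → ℕ) (D : Tables) : Prop where
  fst : ∀ j < E.m, mem (2 * j) = E.a j
  snd : ∀ j < E.m, mem (2 * j + 1) = E.b j
  col : ∀ j < E.m, mem (2 * E.m + j) = D.col j
  deg : ∀ u < E.n, mem (E.cell 1 u) = D.deg u
  flag : ∀ u < E.n, mem (E.cell 2 u) = D.flag u
  stk : ∀ i < E.n, mem (E.cell 3 i) = D.stk i
  cnt : ∀ c < 6, ∀ u < E.n, mem (E.cell (4 + c) u) = D.cnt c u
  adj : ∀ i, ∀ u < E.n, mem (E.cell (10 + i) u) = D.adj i u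

/-- The registers hold the constants that the program uses. -/
structure Ready (σ : Store) : Prop where
  r0 : σ.reg 0 = E.n
  r1 : σ.reg 1 = E.m
  r2 : σ.reg 2 = 1
  r3 : σ.reg 3 = E.width
  r4 : σ.reg 4 = 6
  r5 : σ.reg 5 = E.m ^ 7
  r19 : σ.reg 19 = 0
  r20 : σ.reg 20 = 2 * E.m

variable {E}

theorem Ready.of_agreeOff {S : List ℕ} {σ σ' : Store} (h : E.Ready σ) (h' : AgreeOff S σ σ')
    (hS : ∀ r ∈ [0, 1, 2, 3, 4, 5, 19, 20], r ∉ S) : E.Ready σ' := by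
  simp only [List.forall_mem_cons, List.not_mem_nil, false_imp_iff, implies_true, and_true] at hS
  obtain ⟨h0, h1, h2, h3, h4, h5, h19, h20⟩ := hS
  exact ⟨(h' _ h0).trans h.r0, (h' _ h1).trans h.r1, (h' _ h2).trans h.r2, (h' _ h3).trans h.r3,
    (h' _ h4).trans h.r4, (h' _ h5).trans h.r5, (h' _ h19).trans h.r19, (h' _ h20).trans h.r20⟩

theorem lt_width {u : ℕ} (h : u < E.n) : u < E.width := by unfold width; omega

/-- Columns are shorter than the width, so division by the width recovers the row. -/
theorem cell_inj {r u r' u' : ℕ} (hu : u < E.n) (hu' : u' < E.n) :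
    E.cell r u = E.cell r' u' ↔ r = r' ∧ u = u' := by
  refine ⟨fun h => ?_, fun h => by rw [h.1, h.2]⟩
  have h1 := lt_width hu
  have h2 := lt_width hu'
  unfold cell at h
  have hpos : 0 < E.width := by omega
  have := congrArg (· / E.width) h
  simp only [Nat.mul_add_div hpos, Nat.div_eq_of_lt h1, Nat.div_eq_of_lt h2] at this
  have h3 : r = r' := by simpa using this
  subst h3
  exact ⟨rfl, Nat.add_left_cancel h⟩

/-- Row 0 is reserved for the 2m input cells and the m output colours; the tables lie beyond it. -/
theorem le_cell {r u : ℕ} (hr : 1 ≤ r) : 3 * E.m < E.cell r u := by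
  have : E.width * 1 ≤ E.width * r := Nat.mul_le_mul_left _ hr
  unfold cell
  have : 3 * E.m < E.width := by unfold width; omega
  omega

theorem WordSize.cell_lt {w r u : ℕ} (h : E.WordSize w) (hr : r ≤ E.m + 10) (hu : u < E.n) :
    E.cell r u < 2 ^ w := by
  refine lt_of_lt_of_le ?_ h.cells
  have h1 := lt_width hu
  have : E.width * r ≤ E.width * (E.m + 10) := Nat.mul_le_mul_left _ hr
  unfold cell
  linarith

theorem WordSize.width_lt {w : ℕ} (h : E.WordSize w) : 11 * E.width ≤ 2 ^ w := by
  refine le_trans ?_ h.cells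
  rw [mul_comm]
  exact Nat.mul_le_mul_left _ (by omega)

section Updates

open Function

variable {mem : ℕ → ℕ} {D : Tables} {r u x : ℕ}

theorem Stored.congr {D' : Tables} (h : E.Stored mem D) (hcol : ∀ j < E.m, D.col j = D'.col j)
    (hdeg : ∀ u < E.n, D.deg u = D'.deg u) (hflag : ∀ u < E.n, D.flag u = D'.flag u)
    (hstk : ∀ i < E.n, D.stk i = D'.stk i)
    (hcnt : ∀ c < 6, ∀ u < E.n, D.cnt c u = D'.cnt c u)
    (hadj : ∀ i, ∀ u < E.n, D.adj i u = D'.adj i u) : E.Stored mem D' where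
  fst := h.fst
  snd := h.snd
  col j hj := (h.col j hj).trans (hcol j hj)
  deg u hu := (h.deg u hu).trans (hdeg u hu)
  flag u hu := (h.flag u hu).trans (hflag u hu)
  stk u hu := (h.stk u hu).trans (hstk u hu)
  cnt c hc u hu := (h.cnt c hc u hu).trans (hcnt c hc u hu)
  adj i u hu := (h.adj i u hu).trans (hadj i u hu)

/-- The tables after the entry `u` of the row `r` has been changed to `x`. -/
theorem Stored.update_cell (h : E.Stored mem D) (hr : 1 ≤ r) (hu : u < E.n) {D' : Tables}
    (hcol : D'.col = D.col)
    (hdeg : ∀ v < E.n, D'.deg v = if r = 1 ∧ v = u then x else D.deg v)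
    (hflag : ∀ v < E.n, D'.flag v = if r = 2 ∧ v = u then x else D.flag v)
    (hstk : ∀ v < E.n, D'.stk v = if r = 3 ∧ v = u then x else D.stk v)
    (hcnt : ∀ c < 6, ∀ v < E.n, D'.cnt c v = if r = 4 + c ∧ v = u then x else D.cnt c v)
    (hadj : ∀ i, ∀ v < E.n, D'.adj i v = if r = 10 + i ∧ v = u then x else D.adj i v) :
    E.Stored (update mem (E.cell r u) x) D' := by
  have hc := le_cell (E := E) (u := u) hr
  have key : ∀ r' v, v < E.n → update mem (E.cell r u) x (E.cell r' v) =
      if r = r' ∧ v = u then x else mem (E.cell r' v) := fun r' v hv => by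
    simp only [update_apply, cell_inj hv hu, eq_comm (a := r)]
  constructor
  · intro j hj; rw [update_of_ne (by omega), h.fst j hj]
  · intro j hj; rw [update_of_ne (by omega), h.snd j hj]
  · intro j hj; rw [update_of_ne (by omega), h.col j hj, hcol]
  · intro v hv; rw [key _ v hv, hdeg v hv, h.deg v hv]
  · intro v hv; rw [key _ v hv, hflag v hv, h.flag v hv]
  · intro v hv; rw [key _ v hv, hstk v hv, h.stk v hv]
  · intro c hc v hv; rw [key _ v hv, hcnt c hc v hv, h.cnt c hc v hv]
  · intro i v hv; rw [key _ v hv, hadj i v hv, h.adj i v hv]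

theorem Stored.setDeg (h : E.Stored mem D) (hu : u < E.n) :
    E.Stored (update mem (E.cell 1 u) x) (D.setDeg u x) := by
  refine h.update_cell le_rfl hu rfl ?_ ?_ ?_ ?_ ?_ <;> intros <;>
    simp [Tables.setDeg, update_apply] <;> omega

theorem Stored.setFlag (h : E.Stored mem D) (hu : u < E.n) :
    E.Stored (update mem (E.cell 2 u) x) (D.setFlag u x) := by
  refine h.update_cell (by omega) hu rfl ?_ ?_ ?_ ?_ ?_ <;> intros <;>
    simp [Tables.setFlag, update_apply] <;> omega

theorem Stored.setStk (h : E.Stored mem D) (hu : u < E.n) :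
    E.Stored (update mem (E.cell 3 u) x) (D.setStk u x) := by
  refine h.update_cell (by omega) hu rfl ?_ ?_ ?_ ?_ ?_ <;> intros <;>
    simp [Tables.setStk, update_apply] <;> omega

theorem Stored.setCnt {c : ℕ} (h : E.Stored mem D) (hc : c < 6) (hu : u < E.n) :
    E.Stored (update mem (E.cell (4 + c) u) x) (D.setCnt c u x) := by
  refine h.update_cell (by omega) hu rfl ?_ ?_ ?_ ?_ ?_
  · intro v _; rw [if_neg (by omega)]; rfl
  · intro v _; rw [if_neg (by omega)]; rfl
  · intro v _; rw [if_neg (by omega)]; rfl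
  · intro d _ v _
    simp only [Tables.setCnt, update_apply]
    by_cases hd : d = c
    · subst hd; simp [update_apply]
    · simp [hd, Ne.symm hd]
  · intro i v _; rw [if_neg (by omega)]; rfl

theorem Stored.setAdj {i : ℕ} (h : E.Stored mem D) (hu : u < E.n) :
    E.Stored (update mem (E.cell (10 + i) u) x) (D.setAdj i u x) := by
  refine h.update_cell (by omega) hu rfl ?_ ?_ ?_ ?_ ?_
  · intro v _; rw [if_neg (by omega)]; rfl
  · intro v _; rw [if_neg (by omega)]; rfl
  · intro v _; rw [if_neg (by omega)]; rfl
  · intro c _ v _; rw [if_neg (by omega)]; rfl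
  · intro d v _
    simp only [Tables.setAdj, update_apply]
    by_cases hd : d = i
    · subst hd; simp [update_apply]
    · simp [hd, Ne.symm hd]

theorem Stored.setCol {j : ℕ} (h : E.Stored mem D) (hj : j < E.m) :
    E.Stored (update mem (2 * E.m + j) x) (D.setCol j x) := by
  have hc : ∀ r v, 1 ≤ r → E.cell r v ≠ 2 * E.m + j := fun r v hr => by
    have := le_cell (E := E) (u := v) hr; omega
  constructor
  · intro k hk; rw [update_of_ne (by omega), h.fst k hk]
  · intro k hk; rw [update_of_ne (by omega), h.snd k hk]
  · intro k hk
    simp only [Tables.setCol, update_apply, h.col k hk, Nat.add_left_cancel_iff]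
  · intro v hv; rw [update_of_ne (hc _ _ (by omega)), h.deg v hv]; rfl
  · intro v hv; rw [update_of_ne (hc _ _ (by omega)), h.flag v hv]; rfl
  · intro v hv; rw [update_of_ne (hc _ _ (by omega)), h.stk v hv]; rfl
  · intro c hc' v hv; rw [update_of_ne (hc _ _ (by omega)), h.cnt c hc' v hv]; rfl
  · intro i v hv; rw [update_of_ne (hc _ _ (by omega)), h.adj i v hv]; rfl

end Updates

end EdgeArray

/-! ### Subprograms for the tables; registers 14 and 15 are scratch, register 19 remains 0. -/

namespace WordRAM.Program

/-- Register `14` becomes the address of the entry `u` of the row `k + q`. -/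
def rowAddr (k q u : ℕ) : Program :=
  const 14 k ;; add 14 14 q ;; mul 14 14 3 ;; add 14 14 u

/-- Read the entry `u` of the row `k + q` into the register `r`. -/
def readCell (r k q u : ℕ) : Program := rowAddr k q u ;; load r 14

/-- Write the register `r` into the entry `u` of the row `k + q`. -/
def writeCell (k q u r : ℕ) : Program := rowAddr k q u ;; store 14 r

end WordRAM.Program

namespace EdgeArray

open WordRAM.Program

variable {E : EdgeArray} {w : ℕ} {σ : Store}

theorem exec_const {r k : ℕ} (hk : k < 2 ^ w) : (const r k).exec w σ = σ.set r k :=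
  Store.setReg_eq_set hk σ r

theorem exec_add {r a b x : ℕ} (h : σ.reg a + σ.reg b = x) (hx : x < 2 ^ w) :
    (add r a b).exec w σ = σ.set r x := by
  rw [exec, h, Store.setReg_eq_set hx]

theorem exec_sub {r a b x : ℕ} (h : σ.reg a - σ.reg b = x) (hx : x < 2 ^ w) :
    (sub r a b).exec w σ = σ.set r x := by
  rw [exec, h, Store.setReg_eq_set hx]

theorem exec_mul {r a b x : ℕ} (h : σ.reg a * σ.reg b = x) (hx : x < 2 ^ w) :
    (mul r a b).exec w σ = σ.set r x := by
  rw [exec, h, Store.setReg_eq_set hx]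

theorem exec_load {r a x : ℕ} (h : σ.mem (σ.reg a) = x) (hx : x < 2 ^ w) :
    (load r a).exec w σ = σ.set r x := by
  rw [exec, h, Store.setReg_eq_set hx]

theorem exec_rowAddr (hw : E.WordSize w) (h3 : σ.reg 3 = E.width) {k q u : ℕ} (hq : q ≠ 14)
    (hu : u ≠ 14) (hk : k + σ.reg q ≤ E.m + 10) (hun : σ.reg u < E.n) :
    (rowAddr k q u).exec w σ = σ.set 14 (E.cell (k + σ.reg q) (σ.reg u)) := by
  have h1 := hw.cell_lt hk hun
  have h2 := hw.cells
  have hpos : 1 ≤ E.width := by unfold width; omega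
  have h4 : E.m + 11 ≤ E.width * (E.m + 11) := Nat.le_mul_of_pos_left _ hpos
  have h5 : E.width * (k + σ.reg q) ≤ E.cell (k + σ.reg q) (σ.reg u) := by
    unfold cell; omega
  rw [rowAddr, exec_seq, exec_const (by omega), exec_seq,
    exec_add (x := k + σ.reg q) (by simp [Store.reg_set, hq]) (by omega), Store.set_set, exec_seq,
    exec_mul (x := E.width * (k + σ.reg q)) (by simp [Store.reg_set, h3, mul_comm]) (by omega),
    Store.set_set, exec_add (x := E.cell (k + σ.reg q) (σ.reg u))
      (by simp [Store.reg_set, hu, cell]) h1, Store.set_set]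

theorem exec_readCell (hw : E.WordSize w) (h3 : σ.reg 3 = E.width) {r k q u : ℕ} (hq : q ≠ 14)
    (hu : u ≠ 14) (hk : k + σ.reg q ≤ E.m + 10) (hun : σ.reg u < E.n)
    (hx : σ.mem (E.cell (k + σ.reg q) (σ.reg u)) < 2 ^ w) :
    (readCell r k q u).exec w σ = (σ.set 14 (E.cell (k + σ.reg q) (σ.reg u))).set r
      (σ.mem (E.cell (k + σ.reg q) (σ.reg u))) := by
  rw [readCell, exec_seq, exec_rowAddr hw h3 hq hu hk hun, exec]
  simp only [Store.reg_set, Store.mem_set, if_true]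
  rw [Store.setReg_eq_set hx]

theorem exec_writeCell (hw : E.WordSize w) (h3 : σ.reg 3 = E.width) {r k q u : ℕ} (hq : q ≠ 14)
    (hu : u ≠ 14) (hr : r ≠ 14) (hk : k + σ.reg q ≤ E.m + 10) (hun : σ.reg u < E.n)
    (hx : σ.reg r < 2 ^ w) :
    (writeCell k q u r).exec w σ = ⟨Function.update σ.reg 14 (E.cell (k + σ.reg q) (σ.reg u)),
      Function.update σ.mem (E.cell (k + σ.reg q) (σ.reg u)) (σ.reg r)⟩ := by
  rw [writeCell, exec_seq, exec_rowAddr hw h3 hq hu hk hun, exec]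
  simp only [Store.reg_set, Store.mem_set, if_true, if_neg hr, Store.setMem]
  rw [Nat.mod_eq_of_lt hx]
  rfl

end EdgeArray

namespace WordRAM.Program

/-- Count one more edge of colour `c` at `u`. -/
def increment (c u : ℕ) : Program := readCell 15 4 c u ;; add 15 15 2 ;; writeCell 4 c u 15

/-- Count one edge less of colour `c` at `u`. -/
def decrement (c u : ℕ) : Program := readCell 15 4 c u ;; sub 15 15 2 ;; writeCell 4 c u 15

/-- Append the edge `j` to the list of the edges at `u`. -/
def attach (u j : ℕ) : Program :=
  readCell 15 1 19 u ;; writeCell 10 15 u j ;; add 15 15 2 ;; writeCell 1 19 u 15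

/-- Push the vertex `x` on the stack, unless it is there already. -/
def push (x : ℕ) : Program :=
  readCell 15 2 19 x ;;
    -- The last branch only overwrites a scratch register and serves as an empty instruction.
    ifLt 15 2 (writeCell 2 19 x 2 ;; writeCell 3 19 6 x ;; add 6 6 2) (const 15 0)

/-- Registers `11` and `10` become the `q`-th edge at the vertex in register `8`, and its other
endpoint. -/
def fetch (q : ℕ) : Program :=
  readCell 11 10 q 8 ;; add 14 11 11 ;; load 10 14 ;; add 14 14 2 ;; load 15 14 ;;
    -- The other endpoint is the sum of both endpoints minus the vertex, without a case distinction.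
    add 10 10 15 ;; sub 10 10 8

/-- The product of the first `k` factors of the key of `u`. -/
def partialKey (u r : ℕ) : ℕ → Program
  | 0 => const r 1
  | k + 1 => partialKey u r k ;; readCell 15 (4 + k) 19 u ;; add 15 15 5 ;; mul r r 15

end WordRAM.Program

namespace EdgeArray

open WordRAM.Program

variable {E : EdgeArray} {w : ℕ} {σ : Store} {D : Tables}

theorem increment_spec (hw : E.WordSize w) (hR : E.Ready σ) (hS : E.Stored σ.mem D) {c u : ℕ}
    (hc : c ∉ [14, 15]) (hu : u ∉ [14, 15]) (hcσ : σ.reg c < 6) (huσ : σ.reg u < E.n)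
    (hx : D.cnt (σ.reg c) (σ.reg u) < E.width) :
    E.Stored ((increment c u).exec w σ).mem
      (D.setCnt (σ.reg c) (σ.reg u) (D.cnt (σ.reg c) (σ.reg u) + 1)) ∧
    AgreeOff [14, 15] σ ((increment c u).exec w σ) := by
  simp only [List.mem_cons, List.not_mem_nil, or_false, not_or] at hc hu
  have hv := hS.cnt _ hcσ _ huσ
  have hwd := hw.width_lt
  rw [increment, exec_seq, exec_readCell hw hR.r3 hc.1 hu.1 (by omega) huσ (by omega), exec_seq,
    exec_add (x := D.cnt (σ.reg c) (σ.reg u) + 1) (by simp [Store.reg_set, hv, hR.r2]) (by omega),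
    Store.set_set, exec_writeCell hw (by simp [Store.reg_set, hR.r3]) hc.1 hu.1 (by omega)
      (by simp [Store.reg_set, hc]; omega) (by simpa [Store.reg_set, hu] using huσ)
      (by simp [Store.reg_set]; omega)]
  refine ⟨?_, fun r hr => ?_⟩
  · simpa [Store.reg_set, Store.mem_set, hu, hc] using hS.setCnt hcσ huσ
  · simp only [List.mem_cons, List.not_mem_nil, or_false, not_or] at hr
    simp [Store.reg_set, hr]

theorem decrement_spec (hw : E.WordSize w) (hR : E.Ready σ) (hS : E.Stored σ.mem D) {c u : ℕ}
    (hc : c ∉ [14, 15]) (hu : u ∉ [14, 15]) (hcσ : σ.reg c < 6) (huσ : σ.reg u < E.n)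
    (hx : D.cnt (σ.reg c) (σ.reg u) < E.width) :
    E.Stored ((decrement c u).exec w σ).mem
      (D.setCnt (σ.reg c) (σ.reg u) (D.cnt (σ.reg c) (σ.reg u) - 1)) ∧
    AgreeOff [14, 15] σ ((decrement c u).exec w σ) := by
  simp only [List.mem_cons, List.not_mem_nil, or_false, not_or] at hc hu
  have hv := hS.cnt _ hcσ _ huσ
  have hwd := hw.width_lt
  rw [decrement, exec_seq, exec_readCell hw hR.r3 hc.1 hu.1 (by omega) huσ (by omega), exec_seq,
    exec_sub (x := D.cnt (σ.reg c) (σ.reg u) - 1) (by simp [Store.reg_set, hv, hR.r2]) (by omega),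
    Store.set_set, exec_writeCell hw (by simp [Store.reg_set, hR.r3]) hc.1 hu.1 (by omega)
      (by simp [Store.reg_set, hc]; omega) (by simpa [Store.reg_set, hu] using huσ)
      (by simp [Store.reg_set]; omega)]
  refine ⟨?_, fun r hr => ?_⟩
  · simpa [Store.reg_set, Store.mem_set, hu, hc] using hS.setCnt hcσ huσ
  · simp only [List.mem_cons, List.not_mem_nil, or_false, not_or] at hr
    simp [Store.reg_set, hr]

theorem attach_spec (hw : E.WordSize w) (hR : E.Ready σ) (hS : E.Stored σ.mem D) {u j : ℕ}
    (hu : u ∉ [14, 15]) (hj : j ∉ [14, 15]) (huσ : σ.reg u < E.n) (hjσ : σ.reg j < E.m)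
    (hx : D.deg (σ.reg u) ≤ E.m) :
    E.Stored ((attach u j).exec w σ).mem
      ((D.setAdj (D.deg (σ.reg u)) (σ.reg u) (σ.reg j)).setDeg (σ.reg u)
        (D.deg (σ.reg u) + 1)) ∧
    AgreeOff [14, 15] σ ((attach u j).exec w σ) := by
  simp only [List.mem_cons, List.not_mem_nil, or_false, not_or] at hu hj
  have hv := hS.deg _ huσ
  have hwd := hw.width_lt
  have hmw : E.m < E.width := by unfold width; omega
  rw [attach, exec_seq, exec_readCell hw hR.r3 (by omega) hu.1 (by rw [hR.r19]; omega) huσ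
      (by rw [hR.r19, add_zero]; omega), exec_seq,
    exec_writeCell hw (by simp [Store.reg_set, hR.r3]) (by omega) hu.1 hj.1
      (by simp [Store.reg_set, hR.r19, hv]; omega)
      (by simpa [Store.reg_set, hu] using huσ)
      (by simp [Store.reg_set, hj]; omega), exec_seq,
    exec_add (x := D.deg (σ.reg u) + 1)
      (by simp [Store.reg_set, hv, hR.r2, hR.r19]) (by omega),
    exec_writeCell hw (by simp [Store.reg_set, hR.r3]) (by omega) hu.1 (by omega)
      (by simp [Store.reg_set, hR.r19])
      (by simpa [Store.reg_set, hu] using huσ)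
      (by simp [Store.reg_set]; omega)]
  refine ⟨?_, fun r hr => ?_⟩
  · simpa [Store.reg_set, Store.mem_set, hu, hj, hR.r19, hv] using (hS.setAdj huσ).setDeg huσ
  · simp only [List.mem_cons, List.not_mem_nil, or_false, not_or] at hr
    simp [Store.reg_set, Function.update_apply, hr]

theorem push_spec_of_flag (hw : E.WordSize w) (hR : E.Ready σ) (hS : E.Stored σ.mem D) {x : ℕ}
    (hx : x ∉ [14, 15]) (hxσ : σ.reg x < E.n) (hf : D.flag (σ.reg x) = 1) :
    ((push x).exec w σ).mem = σ.mem ∧ AgreeOff [14, 15] σ ((push x).exec w σ) := by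
  simp only [List.mem_cons, List.not_mem_nil, or_false, not_or] at hx
  have hv := hS.flag _ hxσ
  have hwd := hw.width_lt
  have hpos : 1 ≤ E.width := by unfold width; omega
  rw [push, exec_seq, exec_readCell hw hR.r3 (by omega) hx.1 (by rw [hR.r19]; omega) hxσ
      (by rw [hR.r19, add_zero]; omega), exec_ifLt, if_neg (by
        simp [Store.reg_set, hR.r19, hR.r2, hv, hf]), exec_const (by omega)]
  refine ⟨rfl, fun r hr => ?_⟩
  simp only [List.mem_cons, List.not_mem_nil, or_false, not_or] at hr
  simp [Store.reg_set, hr]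

theorem push_spec_of_not_flag (hw : E.WordSize w) (hR : E.Ready σ) (hS : E.Stored σ.mem D) {x : ℕ}
    (hx : x ∉ [6, 14, 15]) (hxσ : σ.reg x < E.n) (hf : D.flag (σ.reg x) = 0) (h6 : σ.reg 6 < E.n) :
    E.Stored ((push x).exec w σ).mem ((D.setFlag (σ.reg x) 1).setStk (σ.reg 6) (σ.reg x)) ∧
      ((push x).exec w σ).reg 6 = σ.reg 6 + 1 ∧
      AgreeOff [6, 14, 15] σ ((push x).exec w σ) := by
  simp only [List.mem_cons, List.not_mem_nil, or_false, not_or] at hx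
  have hv := hS.flag _ hxσ
  have hwd := hw.width_lt
  have hnw : E.n < E.width := by unfold width; omega
  rw [push, exec_seq, exec_readCell hw hR.r3 (by omega) hx.2.1 (by rw [hR.r19]; omega) hxσ
      (by rw [hR.r19, add_zero]; omega), exec_ifLt, if_pos (by
        simp [Store.reg_set, hR.r19, hR.r2, hv, hf]), exec_seq,
    exec_writeCell hw (by simp [Store.reg_set, hR.r3]) (by omega) hx.2.1 (by omega)
      (by simp [Store.reg_set, hR.r19])
      (by simpa [Store.reg_set, hx] using hxσ)
      (by have : 1 < 2 ^ w := by omega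
          simpa [Store.reg_set, hR.r2] using this), exec_seq,
    exec_writeCell hw (by simp [Store.reg_set, hR.r3]) (by omega) (by omega) hx.2.1
      (by simp [Store.reg_set, hR.r19])
      (by simpa [Store.reg_set, hx] using h6)
      (by simp [Store.reg_set, hx]; omega),
    exec_add (x := σ.reg 6 + 1) (by simp [Store.reg_set, hR.r2]) (by omega)]
  refine ⟨?_, by simp [Store.reg_set], fun r hr => ?_⟩
  · simpa [Store.reg_set, Store.mem_set, hx, hR.r19, hv, hR.r2] using (hS.setFlag hxσ).setStk h6
  · simp only [List.mem_cons, List.not_mem_nil, or_false, not_or] at hr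
    simp [Store.reg_set, Function.update_apply, hr]

theorem fetch_spec (hw : E.WordSize w) (hR : E.Ready σ) (hS : E.Stored σ.mem D) {q : ℕ}
    (hq : q ≠ 14) (h8 : σ.reg 8 < E.n) (hqm : σ.reg q ≤ E.m)
    (hj : D.adj (σ.reg q) (σ.reg 8) ∈ E.star E.m (σ.reg 8)) :
    ((fetch q).exec w σ).mem = σ.mem ∧
      ((fetch q).exec w σ).reg 11 = D.adj (σ.reg q) (σ.reg 8) ∧
      ((fetch q).exec w σ).reg 10 = E.other (σ.reg 8) (D.adj (σ.reg q) (σ.reg 8)) ∧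
      AgreeOff [10, 11, 14, 15] σ ((fetch q).exec w σ) := by
  have hv := hS.adj (σ.reg q) _ h8
  have hwd := hw.width_lt
  have hjm := (mem_star.1 hj).1
  set j := D.adj (σ.reg q) (σ.reg 8)
  have ha := hS.fst j hjm
  have hb := hS.snd j hjm
  have ha' := E.a_lt j hjm
  have hb' := E.b_lt j hjm
  have hd : 3 * E.m + E.n + 1 = E.width := rfl
  rw [fetch, exec_seq, exec_readCell hw hR.r3 hq (by omega) (by omega) h8 (by omega), exec_seq,
    exec_add (x := 2 * j) (by simp [Store.reg_set, hv]; omega) (by omega), exec_seq,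
    exec_load (x := E.a j) (by simp [Store.reg_set, Store.mem_set, ha]) (by omega), exec_seq,
    exec_add (x := 2 * j + 1) (by simp [Store.reg_set, hR.r2]) (by omega), exec_seq,
    exec_load (x := E.b j) (by simp [Store.reg_set, Store.mem_set, hb]) (by omega), exec_seq,
    exec_add (x := E.a j + E.b j) (by simp [Store.reg_set]) (by omega),
    exec_sub (x := E.other (σ.reg 8) j) (by simp [Store.reg_set, other])
      (by unfold other; omega)]
  refine ⟨rfl, by simp [Store.reg_set, hv], by simp [Store.reg_set], fun r hr => ?_⟩
  simp only [List.mem_cons, List.not_mem_nil, or_false, not_or] at hr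
  simp [Store.reg_set, hr]

theorem partialKey_spec (hw : E.WordSize w) (hR : E.Ready σ) (hS : E.Stored σ.mem D) {u r : ℕ}
    (hu : u ∉ [14, 15]) (hr : r ∉ [0, 1, 2, 3, 4, 5, 19, 20, 14, 15]) (hur : u ≠ r)
    (huσ : σ.reg u < E.n) (hD : ∀ c < 6, D.cnt c (σ.reg u) ≤ E.m) (hm : 1 ≤ E.m) {k : ℕ}
    (hk : k ≤ 6) :
    ((partialKey u r k).exec w σ).mem = σ.mem ∧
      ((partialKey u r k).exec w σ).reg r =
        ∏ c ∈ Finset.range k, (E.m ^ 7 + D.cnt c (σ.reg u)) ∧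
      AgreeOff [r, 14, 15] σ ((partialKey u r k).exec w σ) := by
  have hwd := hw.width_lt
  have hd : 3 * E.m + E.n + 1 = E.width := rfl
  simp only [List.mem_cons, List.not_mem_nil, or_false, not_or] at hu hr
  -- All partial products are at most (m⁷ + m)⁶ and fit in a word, so the multiplications do not
  -- wrap around.
  have hprod : ∀ k ≤ 6, ∏ c ∈ Finset.range k, (E.m ^ 7 + D.cnt c (σ.reg u)) < 2 ^ w := by
    intro k hk
    refine lt_of_le_of_lt ?_ hw.keys
    calc _ ≤ ∏ c ∈ Finset.range k, (E.m ^ 7 + E.m) :=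
          Finset.prod_le_prod' fun c hc => Nat.add_le_add_left
            (hD c ((Finset.mem_range.1 hc).trans_le hk)) _
      _ = (E.m ^ 7 + E.m) ^ k := by simp
      _ ≤ _ := Nat.pow_le_pow_right (by omega) hk
  induction k with
  | zero =>
    rw [partialKey, exec_const (by omega)]
    refine ⟨rfl, by simp [Store.reg_set], fun q hq => ?_⟩
    simp only [List.mem_cons, List.not_mem_nil, or_false, not_or] at hq
    simp [Store.reg_set, hq]
  | succ k ih =>
    obtain ⟨h1, h2, h3⟩ := ih (by omega)
    rw [partialKey, exec_seq]
    set σ' := (partialKey u r k).exec w σ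
    have hR' : E.Ready σ' := hR.of_agreeOff h3 (by simp; omega)
    have huσ' : σ'.reg u = σ.reg u := h3 u (by simp; omega)
    have hv := hS.cnt k (by omega) _ huσ
    have hDk := hD k (by omega)
    have hkey := hprod (k + 1) hk
    have hm7 : E.m ^ 7 + D.cnt k (σ.reg u) < 2 ^ w := by
      refine lt_of_le_of_lt ?_ hw.keys
      calc _ ≤ E.m ^ 7 + E.m := by omega
        _ ≤ _ := Nat.le_self_pow (by omega) _
    rw [exec_seq, exec_readCell hw hR'.r3 (by omega) hu.1 (by rw [hR'.r19]; omega) (by omega)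
        (by rw [hR'.r19, add_zero, huσ', h1]; omega), exec_seq,
      exec_add (x := E.m ^ 7 + D.cnt k (σ.reg u))
        (by simp [Store.reg_set, hR'.r19, hR'.r5, huσ', h1, hv]; exact add_comm _ _) hm7,
      exec_mul (x := ∏ c ∈ Finset.range (k + 1), (E.m ^ 7 + D.cnt c (σ.reg u)))
        (by simp [Store.reg_set, hr, h2, Finset.prod_range_succ]) hkey]
    refine ⟨h1, by simp [Store.reg_set], fun q hq => ?_⟩
    rw [← h3 q hq]
    simp only [List.mem_cons, List.not_mem_nil, or_false, not_or] at hq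
    simp [Store.reg_set, hq]

end EdgeArray

/-! ### Recolouring the edges at a vertex. -/

namespace WordRAM.Program

/-- Write the register `c` as the colour of the edge `j`. -/
def writeColor (j c : ℕ) : Program := add 14 20 j ;; store 14 c

/-- Fetch the edge number `18` at the vertex in register `8`, and remove its colour. -/
def uncolor : Program :=
  fetch 18 ;; add 14 20 11 ;; load 13 14 ;; decrement 13 8 ;; decrement 13 10

/-- Give the colour in register `12` to the edge in register `11`. -/
def applyColor : Program :=
  writeColor 11 12 ;; increment 12 8 ;; increment 12 10 ;; push 10 ;; add 18 18 2

/-- The old colour is discounted before the draw, so that the work depending on the new colour is a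
straight program after a single draw. -/
def recolorEdge : Program := uncolor ;; rand 12 4 ;; applyColor

def recolorLoop : Program := whileLt 18 9 recolorEdge

end WordRAM.Program

/-- The list `L` is stored as a stack, with its head on top. -/
def StackIs (stk : ℕ → ℕ) : List ℕ → Prop
  | [] => True
  | x :: L => stk L.length = x ∧ StackIs stk L

theorem StackIs.congr {stk stk' : ℕ → ℕ} {L : List ℕ} (h : StackIs stk L)
    (h' : ∀ i < L.length, stk' i = stk i) : StackIs stk' L := by
  induction L with
  | nil => trivial
  | cons x L ih =>
    exact ⟨(h' _ (by simp)).trans h.1, ih h.2 fun i hi => h' i (by simp; omega)⟩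

namespace EdgeArray

open WordRAM.Program Function

variable (E : EdgeArray)

/-- The tables for the stack `L` and the colouring `f`. -/
def tables (L : List ℕ) (stk f : ℕ → ℕ) : Tables where
  deg := E.deg
  flag u := if u ∈ L then 1 else 0
  stk := stk
  cnt c u := E.count E.m f u c
  adj i u := (E.star E.m u).getD i 0
  col := f

/-- The store holds the stack `L` and the colouring `f`. -/
structure Holds (σ : Store) (L : List ℕ) (f : ℕ → ℕ) : Prop where
  ready : E.Ready σ
  top : σ.reg 6 = L.length
  stored : ∃ stk, StackIs stk L ∧ E.Stored σ.mem (E.tables L stk f)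
  nodup : L.Nodup
  lt : ∀ u ∈ L, u < E.n
  col_lt : ∀ j < E.m, f j < 6

/-- The state of the loop that recolours the edges at `v`. -/
structure Recoloring (v : ℕ) (σ : Store) (L : List ℕ) (k : ℕ) (f : ℕ → ℕ) : Prop where
  holds : E.Holds σ L f
  mem : v ∈ L
  r7 : σ.reg 7 = 0
  r8 : σ.reg 8 = v
  r9 : σ.reg 9 = E.deg v
  r18 : σ.reg 18 = k
  cover : ∀ j < E.m, E.key f (E.a j) = E.key f (E.b j) → E.a j ∈ L ∨ E.b j ∈ L ∨
    ∃ i ∈ E.star E.m v, E.a j = E.other v i ∨ E.b j = E.other v i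

variable {E} {w : ℕ} {σ : Store} {L : List ℕ} {f : ℕ → ℕ}

theorem length_le_of_nodup (h : L.Nodup) (hL : ∀ u ∈ L, u < E.n) : L.length ≤ E.n := by
  have := (h.subperm fun u hu => List.mem_range.2 (hL u hu) : L.Subperm (List.range E.n)).length_le
  simpa using this

/-- Written additively, since subtraction of natural numbers truncates. -/
theorem count_update {u j : ℕ} (h : j ∈ E.star E.m u) (f : ℕ → ℕ) (c d : ℕ) :
    E.count E.m (update f j c) u d + (if f j = d then 1 else 0) =
      E.count E.m f u d + if c = d then 1 else 0 := by
  have hp := List.perm_cons_erase h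
  have hn : j ∉ (E.star E.m u).erase j := (hp.nodup_iff.1 (nodup_star _ _)).notMem
  rw [count, count, hp.countP_eq, hp.countP_eq, List.countP_cons, List.countP_cons]
  have : ((E.star E.m u).erase j).countP (fun i => update f j c i = d) =
      ((E.star E.m u).erase j).countP fun i => f i = d := by
    refine List.countP_congr fun i hi => ?_
    rw [update_of_ne]
    rintro rfl
    exact hn hi
  rw [this]
  simp only [update_self, decide_eq_true_eq]
  omega

theorem count_pos {u j : ℕ} (h : j ∈ E.star E.m u) (f : ℕ → ℕ) :
    0 < E.count E.m f u (f j) :=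
  List.countP_pos_iff.2 ⟨j, h, by simp⟩

theorem writeColor_spec {D : Tables} (hw : E.WordSize w) (hR : E.Ready σ) (hS : E.Stored σ.mem D)
    {j c : ℕ} (hc : c ≠ 14) (hjσ : σ.reg j < E.m) (hcσ : σ.reg c < 6) :
    E.Stored ((writeColor j c).exec w σ).mem (D.setCol (σ.reg j) (σ.reg c)) ∧
      AgreeOff [14] σ ((writeColor j c).exec w σ) := by
  have hwd := hw.width_lt
  have hd : 3 * E.m + E.n + 1 = E.width := rfl
  rw [writeColor, exec_seq, exec_add (x := 2 * E.m + σ.reg j) (by rw [hR.r20]) (by omega), exec]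
  simp only [Store.setMem, Store.reg_set, if_true, if_neg hc]
  rw [Nat.mod_eq_of_lt (by omega)]
  refine ⟨hS.setCol hjσ, fun r hr => ?_⟩
  simp only [List.mem_cons, List.not_mem_nil, or_false] at hr
  simp [Store.reg_set, hr]

theorem uncolor_spec (hw : E.WordSize w) {D : Tables} (hR : E.Ready σ)
    (hS : E.Stored σ.mem D) {v j : ℕ} (h8 : σ.reg 8 = v) (hv : v < E.n)
    (h18 : σ.reg 18 ≤ E.m) (hj : D.adj (σ.reg 18) v = j) (hjv : j ∈ E.star E.m v)
    (hcol : D.col j < 6) (hcnt : ∀ c < 6, ∀ u < E.n, D.cnt c u ≤ E.m) :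
    E.Stored (uncolor.exec w σ).mem ((D.setCnt (D.col j) v (D.cnt (D.col j) v - 1)).setCnt
        (D.col j) (E.other v j) (D.cnt (D.col j) (E.other v j) - 1)) ∧
      (uncolor.exec w σ).reg 11 = j ∧ (uncolor.exec w σ).reg 10 = E.other v j ∧
      AgreeOff [10, 11, 13, 14, 15] σ (uncolor.exec w σ) := by
  have hwd := hw.width_lt
  have hd : 3 * E.m + E.n + 1 = E.width := rfl
  obtain ⟨hx, hxv, -⟩ := other_spec hjv
  have hjm := (mem_star.1 hjv).1
  obtain ⟨hmem, h11, h10, hA⟩ := fetch_spec hw hR hS (q := 18) (by omega) (h8 ▸ hv) h18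
    (by rw [h8, hj]; exact hjv)
  rw [h8, hj] at h11 h10
  rw [uncolor, exec_seq]
  generalize (fetch 18).exec w σ = σ₁ at *
  have hR₁ : E.Ready σ₁ := hR.of_agreeOff hA (by decide)
  have h8₁ : σ₁.reg 8 = v := (hA 8 (by decide)).trans h8
  rw [← hmem] at hS
  rw [exec_seq, exec_add (x := 2 * E.m + j) (by rw [hR₁.r20, h11]) (by omega), exec_seq,
    exec_load (x := D.col j) (by simp [Store.reg_set, Store.mem_set, hS.col j hjm]) (by omega)]
  set σ₂ := (σ₁.set 14 (2 * E.m + j)).set 13 (D.col j) with hσ₂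
  have hA₂ : AgreeOff [13, 14] σ₁ σ₂ := fun r hr => by
    simp only [List.mem_cons, List.not_mem_nil, or_false, not_or] at hr
    simp [hσ₂, Store.reg_set, hr]
  have hR₂ : E.Ready σ₂ := hR₁.of_agreeOff hA₂ (by decide)
  have h8₂ : σ₂.reg 8 = v := (hA₂ 8 (by decide)).trans h8₁
  have h10₂ : σ₂.reg 10 = E.other v j := (hA₂ 10 (by decide)).trans h10
  have h11₂ : σ₂.reg 11 = j := (hA₂ 11 (by decide)).trans h11
  have h13₂ : σ₂.reg 13 = D.col j := by simp [hσ₂, Store.reg_set]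
  have hS₂ : E.Stored σ₂.mem D := hS
  clear_value σ₂
  have hb := hcnt _ hcol _ hv
  obtain ⟨hS₃, hA₃⟩ := decrement_spec hw hR₂ hS₂ (c := 13) (u := 8) (by decide) (by decide)
    (by omega) (by omega) (by rw [h13₂, h8₂]; omega)
  rw [exec_seq]
  rw [h13₂, h8₂] at hS₃
  generalize (decrement 13 8).exec w σ₂ = σ₃ at *
  have hR₃ : E.Ready σ₃ := hR₂.of_agreeOff hA₃ (by decide)
  have h10₃ : σ₃.reg 10 = E.other v j := (hA₃ 10 (by decide)).trans h10₂
  have h13₃ : σ₃.reg 13 = D.col j := (hA₃ 13 (by decide)).trans h13₂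
  have hval : (D.setCnt (D.col j) v (D.cnt (D.col j) v - 1)).cnt (D.col j) (E.other v j) =
      D.cnt (D.col j) (E.other v j) := by simp [Tables.setCnt, hxv]
  have hb' := hcnt _ hcol _ hx
  obtain ⟨hS₄, hA₄⟩ := decrement_spec hw hR₃ hS₃ (c := 13) (u := 10) (by decide) (by decide)
    (by omega) (by omega) (by rw [h13₃, h10₃, hval]; omega)
  rw [h13₃, h10₃, hval] at hS₄
  refine ⟨hS₄, ?_, ?_, ?_⟩
  · rw [hA₄ 11 (by decide), hA₃ 11 (by decide), h11₂]
  · rw [hA₄ 10 (by decide), h10₃]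
  · exact (((hA.trans hA₂).trans hA₃).trans hA₄).mono (by decide)

theorem _root_.Tables.cnt_setCnt (D : Tables) (c u x d v : ℕ) :
    (D.setCnt c u x).cnt d v = if d = c ∧ v = u then x else D.cnt d v := by
  by_cases hd : d = c
  · subst hd; simp [Tables.setCnt, update_apply]
  · simp [Tables.setCnt, hd]

theorem _root_.Tables.cnt_setCol (D : Tables) (j x : ℕ) : (D.setCol j x).cnt = D.cnt := rfl

/-- Changing the colour of one edge changes the tables as the program does. -/
theorem stored_tables_update {mem : ℕ → ℕ} {stk : ℕ → ℕ} {v j c : ℕ} (hjv : j ∈ E.star E.m v)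
    {D D₁ D₂ D₃ D₄ : Tables} (hD : D = E.tables L stk f)
    (h₁ : D₁ = D.setCnt (f j) v (D.cnt (f j) v - 1))
    (h₂ : D₂ = D₁.setCnt (f j) (E.other v j) (D.cnt (f j) (E.other v j) - 1))
    (h₃ : D₃ = (D₂.setCol j c).setCnt c v (D₂.cnt c v + 1))
    (h₄ : D₄ = D₃.setCnt c (E.other v j) (D₃.cnt c (E.other v j) + 1))
    (hS : E.Stored mem D₄) : E.Stored mem (E.tables L stk (update f j c)) := by
  obtain ⟨hx, hxv, hx'⟩ := other_spec hjv
  have hjx : j ∈ E.star E.m (E.other v j) := mem_star.2 ⟨(mem_star.1 hjv).1, hx'⟩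
  subst h₄ h₃ h₂ h₁ hD
  refine hS.congr (fun i _ => rfl) (fun u _ => rfl) (fun u _ => rfl) (fun u _ => rfl)
    (fun d _ u _ => ?_) (fun i u _ => rfl)
  simp only [Tables.cnt_setCnt, Tables.cnt_setCol, tables]
  have h1 := count_update hjv f c d
  have h2 := count_update hjx f c d
  -- Positivity of the old counts makes the decrements of the program true subtractions.
  have h1' := count_pos hjv f
  have h2' := count_pos hjx f
  by_cases huv : u = v
  · subst huv
    simp only [hxv, hxv.symm, and_true, and_false, if_false]
    generalize f j = p at h1 h1' ⊢
    by_cases hd1 : d = p <;> by_cases hd2 : d = c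
    · subst hd1 hd2; simp only [if_true] at h1 ⊢; omega
    · subst hd1; simp only [Ne.symm hd2, hd2, if_true, if_false] at h1 ⊢; omega
    · subst hd2; simp only [Ne.symm hd1, hd1, if_true, if_false] at h1 ⊢; omega
    · simp only [Ne.symm hd1, hd1, Ne.symm hd2, hd2, if_false] at h1 ⊢; omega
  · by_cases hux : u = E.other v j
    · rw [← hux] at hxv h2 h2' ⊢
      simp only [hxv, hxv.symm, and_true, and_false, if_false]
      generalize f j = p at h2 h2' ⊢
      by_cases hd1 : d = p <;> by_cases hd2 : d = c
      · subst hd1 hd2; simp only [if_true] at h2 ⊢; omega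
      · subst hd1; simp only [Ne.symm hd2, hd2, if_true, if_false] at h2 ⊢; omega
      · subst hd2; simp only [Ne.symm hd1, hd1, if_true, if_false] at h2 ⊢; omega
      · simp only [Ne.symm hd1, hd1, Ne.symm hd2, hd2, if_false] at h2 ⊢; omega
    · rw [count_update_of_ne fun hju => ?_]
      · simp only [huv, hux, and_false, if_false]
      · rcases endpoint_eq hjv (mem_star.1 hju).2 with h | h
        · exact huv h
        · exact hux h

end EdgeArray

namespace EdgeArray

open WordRAM.Program Function

variable {E : EdgeArray} {w : ℕ} {σ : Store} {L : List ℕ} {f : ℕ → ℕ}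

theorem Holds.push {stk : ℕ → ℕ} {x : ℕ} (hw : E.WordSize w) (hR : E.Ready σ)
    (hS : E.Stored σ.mem (E.tables L stk f)) (hstk : StackIs stk L) (h6 : σ.reg 6 = L.length)
    (hL : L.Nodup) (hlt : ∀ u ∈ L, u < E.n) (hf : ∀ j < E.m, f j < 6) (h10 : σ.reg 10 = x)
    (hx : x < E.n) :
    E.Holds ((push 10).exec w σ) (L.insert x) f ∧
      AgreeOff [6, 14, 15] σ ((push 10).exec w σ) := by
  have hlt' : ∀ u ∈ L.insert x, u < E.n := fun u hu => by
    rcases List.mem_insert_iff.1 hu with rfl | hu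
    · exact hx
    · exact hlt u hu
  by_cases hxL : x ∈ L
  · obtain ⟨hmem, hA⟩ := push_spec_of_flag hw hR hS (x := 10) (by decide) (h10 ▸ hx)
      (by rw [h10]; exact if_pos hxL)
    rw [List.insert_of_mem hxL] at hlt' ⊢
    exact ⟨⟨hR.of_agreeOff hA (by decide), (hA 6 (by decide)).trans h6,
      ⟨stk, hstk, by rw [hmem]; exact hS⟩, hL, hlt', hf⟩, hA.mono (by decide)⟩
  -- Together with x the stack still consists of distinct vertices, so there is room for one more.
  · have hLn : L.length < E.n := by
      have := length_le_of_nodup (E := E) (List.Nodup.cons hxL hL) fun u hu => by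
        rcases List.mem_cons.1 hu with rfl | hu
        · exact hx
        · exact hlt u hu
      simpa using this
    obtain ⟨hS', h6', hA⟩ := push_spec_of_not_flag hw hR hS (x := 10) (by decide) (h10 ▸ hx)
      (by rw [h10]; exact if_neg hxL) (h6 ▸ hLn)
    rw [List.insert_of_not_mem hxL] at hlt' ⊢
    refine ⟨⟨hR.of_agreeOff hA (by decide), by rw [h6', h6, List.length_cons],
      ⟨update stk L.length x, ⟨by simp, hstk.congr fun i hi => update_of_ne (by omega) _ _⟩, ?_⟩,
      hL.cons hxL, hlt', hf⟩, hA⟩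
    rw [h6, h10] at hS'
    refine hS'.congr (fun _ _ => rfl) (fun _ _ => rfl) (fun u _ => ?_) (fun _ _ => rfl)
      (fun _ _ _ _ => rfl) (fun _ _ _ => rfl)
    simp only [Tables.setStk, Tables.setFlag, tables, update_apply, List.mem_cons]
    by_cases hux : u = x <;> simp [hux]

theorem Holds.of_agreeOff {S : List ℕ} {σ' : Store} (h : E.Holds σ L f) (hA : AgreeOff S σ σ')
    (hmem : σ'.mem = σ.mem) (hS : ∀ r ∈ [0, 1, 2, 3, 4, 5, 19, 20], r ∉ S) (h6 : 6 ∉ S) :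
    E.Holds σ' L f :=
  ⟨h.ready.of_agreeOff hA hS, (hA 6 h6).trans h.top, by rw [hmem]; exact h.stored, h.nodup, h.lt,
    h.col_lt⟩

theorem AgreeOff_set (σ : Store) (r x : ℕ) : AgreeOff [r] σ (σ.set r x) := fun q hq => by
  simp only [List.mem_cons, List.not_mem_nil, or_false] at hq
  simp [Store.reg_set, hq]

theorem applyColor_spec (hw : E.WordSize w) {stk : ℕ → ℕ} {D₁ D₂ : Tables} {v j c : ℕ}
    (hv : v < E.n) (hjv : j ∈ E.star E.m v) (hR : E.Ready σ)
    (h₁ : D₁ = (E.tables L stk f).setCnt (f j) v ((E.tables L stk f).cnt (f j) v - 1))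
    (h₂ : D₂ = D₁.setCnt (f j) (E.other v j) ((E.tables L stk f).cnt (f j) (E.other v j) - 1))
    (hS : E.Stored σ.mem D₂) (hstk : StackIs stk L) (h6 : σ.reg 6 = L.length)
    (hL : L.Nodup) (hlt : ∀ u ∈ L, u < E.n) (hf : ∀ j < E.m, f j < 6) (h8 : σ.reg 8 = v)
    (h10 : σ.reg 10 = E.other v j) (h11 : σ.reg 11 = j) (h12 : σ.reg 12 = c) (hc : c < 6)
    (h18 : σ.reg 18 < E.m) :
    E.Holds (applyColor.exec w σ) (L.insert (E.other v j)) (update f j c) ∧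
      (applyColor.exec w σ).reg 18 = σ.reg 18 + 1 ∧
      AgreeOff [6, 14, 15, 18] σ (applyColor.exec w σ) := by
  have hwd := hw.width_lt
  have hd : 3 * E.m + E.n + 1 = E.width := rfl
  obtain ⟨hx, hxv, -⟩ := other_spec hjv
  have hjm := (mem_star.1 hjv).1
  -- Counts bounded by m stay below the width, so the increments do not overflow.
  have hcnt : ∀ d u, D₂.cnt d u ≤ E.m := by
    intro d u
    have hle : ∀ d u, (E.tables L stk f).cnt d u ≤ E.m := fun d u => count_le _ _ _ _
    rw [h₂, h₁, Tables.cnt_setCnt, Tables.cnt_setCnt]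
    have h1 := hle d u
    have h2 := hle (f j) v
    have h3 := hle (f j) (E.other v j)
    split_ifs <;> omega
  obtain ⟨hS₁, hA₁⟩ := writeColor_spec hw hR hS (j := 11) (c := 12) (by decide) (by omega)
    (by omega)
  rw [applyColor, exec_seq]
  rw [h11, h12] at hS₁
  generalize (writeColor 11 12).exec w σ = σ₁ at *
  have hR₁ : E.Ready σ₁ := hR.of_agreeOff hA₁ (by decide)
  have h8₁ : σ₁.reg 8 = v := (hA₁ 8 (by decide)).trans h8
  have h10₁ : σ₁.reg 10 = E.other v j := (hA₁ 10 (by decide)).trans h10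
  have h12₁ : σ₁.reg 12 = c := (hA₁ 12 (by decide)).trans h12
  have hb := hcnt c v
  obtain ⟨hS₂, hA₂⟩ := increment_spec hw hR₁ hS₁ (c := 12) (u := 8) (by decide) (by decide)
    (by omega) (by omega) (by rw [h12₁, h8₁, Tables.cnt_setCol]; omega)
  rw [h12₁, h8₁, Tables.cnt_setCol] at hS₂
  rw [exec_seq]
  generalize (increment 12 8).exec w σ₁ = σ₂ at *
  have hR₂ : E.Ready σ₂ := hR₁.of_agreeOff hA₂ (by decide)
  have h10₂ : σ₂.reg 10 = E.other v j := (hA₂ 10 (by decide)).trans h10₁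
  have h12₂ : σ₂.reg 12 = c := (hA₂ 12 (by decide)).trans h12₁
  obtain ⟨D₃, h₃⟩ : ∃ D₃, D₃ = (D₂.setCol j c).setCnt c v (D₂.cnt c v + 1) := ⟨_, rfl⟩
  rw [← h₃] at hS₂
  have hb' : D₃.cnt c (E.other v j) ≤ E.m := by
    rw [h₃, Tables.cnt_setCnt, if_neg fun h => hxv h.2]
    exact hcnt _ _
  obtain ⟨hS₃, hA₃⟩ := increment_spec hw hR₂ hS₂ (c := 12) (u := 10) (by decide) (by decide)
    (by omega) (by omega) (by rw [h12₂, h10₂]; omega)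
  rw [h12₂, h10₂] at hS₃
  rw [exec_seq]
  generalize (increment 12 10).exec w σ₂ = σ₃ at *
  have hR₃ : E.Ready σ₃ := hR₂.of_agreeOff hA₃ (by decide)
  have hS₃' := stored_tables_update hjv rfl h₁ h₂ h₃ rfl hS₃
  have hA₀₃ := (hA₁.trans hA₂).trans hA₃
  have hf' : ∀ i < E.m, update f j c i < 6 := fun i hi => by
    rw [update_apply]
    split_ifs
    · exact hc
    · exact hf i hi
  obtain ⟨hH, hA₄⟩ := Holds.push hw hR₃ hS₃' hstk ((hA₀₃ 6 (by decide)).trans h6) hL hlt hf'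
    ((hA₃ 10 (by decide)).trans h10₂) hx
  rw [exec_seq]
  generalize (push 10).exec w σ₃ = σ₄ at *
  have h18' : σ₄.reg 18 = σ.reg 18 := (hA₄ 18 (by decide)).trans (hA₀₃ 18 (by decide))
  rw [exec_add (x := σ.reg 18 + 1) (by rw [h18', hH.ready.r2]) (by omega)]
  refine ⟨hH.of_agreeOff (AgreeOff_set _ _ _) rfl (by decide) (by decide),
    by simp [Store.reg_set], ?_⟩
  exact ((hA₀₃.trans hA₄).trans (AgreeOff_set _ _ _)).mono (by decide)

theorem straight_uncolor : uncolor.Straight := by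
  simp [uncolor, fetch, decrement, readCell, writeCell, rowAddr, Straight]

theorem straight_applyColor : applyColor.Straight := by
  simp [applyColor, writeColor, increment, push, readCell, writeCell, rowAddr, Straight]

theorem cost_recolorEdge : uncolor.cost + applyColor.cost + 4 ≤ 200 := by
  simp [uncolor, fetch, decrement, applyColor, writeColor, increment, push, readCell, writeCell,
    rowAddr, cost]

/-- One iteration of the loop that recolours the edges at `v`. -/
theorem failProb_recolorEdge {Q : Store → Prop} (hw : E.WordSize w) {v k : ℕ}
    (hσ : E.Recoloring v σ L k f) (hk : k < E.deg v) {t : ℕ} {K : List Program}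
    {φ : (ℕ → ℕ) → ℝ≥0∞}
    (hφ : ∀ σ' f', E.Recoloring v σ' (L.insert (E.other v ((E.star E.m v).getD k 0))) (k + 1) f' →
      failProb w Q t ⟨recolorLoop :: K, σ'⟩ ≤ φ f') :
    failProb w Q (t + 200) ⟨recolorLoop :: K, σ⟩ ≤
      resample ((E.star E.m v).getD k 0) φ f := by
  have hv : v < E.n := hσ.holds.lt v hσ.mem
  have hdm : E.deg v ≤ E.m := length_star_le _ _
  obtain ⟨stk, hstk, hS⟩ := hσ.holds.stored
  obtain ⟨j, hj⟩ : ∃ j, (E.star E.m v).getD k 0 = j := ⟨_, rfl⟩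
  have hjv : j ∈ E.star E.m v := by
    rw [← hj, List.getD_eq_getElem _ _ hk]
    exact List.getElem_mem _
  rw [hj] at hφ ⊢
  have h6w : 6 ≤ 2 ^ w := by
    have := hw.width_lt
    have hd : 3 * E.m + E.n + 1 = E.width := rfl
    omega
  obtain ⟨hS₁, h11, h10, hA⟩ := uncolor_spec hw (σ := σ) hσ.holds.ready hS hσ.r8 hv
    (by rw [hσ.r18]; omega) (by rw [hσ.r18]; exact hj) hjv
    (hσ.holds.col_lt j (mem_star.1 hjv).1) (fun c _ u _ => count_le _ _ _ _)
  refine (failProb_le_of_le (Nat.add_le_add_left cost_recolorEdge t) _).trans ?_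
  rw [recolorLoop, show t + (uncolor.cost + applyColor.cost + 4) =
      t + applyColor.cost + 1 + 1 + uncolor.cost + 1 + 1 by ring,
    failProb_whileLt_of_lt (by rw [hσ.r18, hσ.r9]; exact hk), recolorEdge, failProb_seq]
  refine (failProb_straight straight_uncolor _ _ _).trans ?_
  have h4 : (uncolor.exec w σ).reg 4 = 6 := (hA 4 (by decide)).trans hσ.holds.ready.r4
  rw [failProb_seq, failProb_rand_six h4 h6w, resample]
  refine ENNReal.div_le_div_right (Finset.sum_le_sum fun c hc => ?_) _
  refine (failProb_straight straight_applyColor _ _ _).trans ?_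
  have hc6 := Finset.mem_range.1 hc
  set σ₁ := (uncolor.exec w σ).set 12 c with hσ₁
  have hA₁ : AgreeOff ([10, 11, 13, 14, 15] ++ [12]) σ σ₁ := hA.trans (AgreeOff_set _ _ _)
  obtain ⟨hH, h18, hA₂⟩ := applyColor_spec hw hv hjv (hσ.holds.ready.of_agreeOff hA₁ (by decide))
    rfl rfl hS₁ hstk ((hA₁ 6 (by decide)).trans hσ.holds.top) hσ.holds.nodup hσ.holds.lt
    hσ.holds.col_lt ((hA₁ 8 (by decide)).trans hσ.r8)
    (by simpa [hσ₁, Store.reg_set] using h10) (by simpa [hσ₁, Store.reg_set] using h11)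
    (c := c) (by simp [hσ₁, Store.reg_set]) hc6
    (by rw [hA₁ 18 (by decide), hσ.r18]; omega)
  have hA₃ := hA₁.trans hA₂
  refine hφ _ _ ⟨hH, List.mem_insert_of_mem hσ.mem, (hA₃ 7 (by decide)).trans hσ.r7,
    (hA₃ 8 (by decide)).trans hσ.r8, (hA₃ 9 (by decide)).trans hσ.r9,
    by rw [h18, hA₁ 18 (by decide), hσ.r18], fun i hi hkey => ?_⟩
  -- An edge that meets v or the other end of j is covered, because both of these vertices are now
  -- on the stack.
  by_cases ha : E.a i = v ∨ E.a i = E.other v j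
  · rcases ha with ha | ha
    · exact Or.inl (List.mem_insert_of_mem (ha ▸ hσ.mem))
    · exact Or.inl (ha ▸ List.mem_insert_self)
  by_cases hb : E.b i = v ∨ E.b i = E.other v j
  · rcases hb with hb | hb
    · exact Or.inr (Or.inl (List.mem_insert_of_mem (hb ▸ hσ.mem)))
    · exact Or.inr (Or.inl (hb ▸ List.mem_insert_self))
  -- For the remaining edges neither key has changed, so the old invariant applies.
  have hja : j ∉ E.star E.m (E.a i) := fun h => ha (endpoint_eq hjv (mem_star.1 h).2)
  have hjb : j ∉ E.star E.m (E.b i) := fun h => hb (endpoint_eq hjv (mem_star.1 h).2)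
  rw [key_update_of_ne hja, key_update_of_ne hjb] at hkey
  rcases hσ.cover i hi hkey with h | h | h
  · exact Or.inl (List.mem_insert_of_mem h)
  · exact Or.inr (Or.inl (List.mem_insert_of_mem h))
  · exact Or.inr (Or.inr h)

/-- The loop that recolours the edges at `v`. -/
theorem failProb_recolorLoop {Q : Store → Prop} (hw : E.WordSize w) {v : ℕ} {t : ℕ}
    {K : List Program} {φ : (ℕ → ℕ) → ℝ≥0∞} {l : List ℕ} {k : ℕ}
    (hl : (E.star E.m v).drop k = l) (hσ : E.Recoloring v σ L k f)
    (hφ : ∀ σ' f', E.Recoloring v σ' (l.foldl (fun L j => L.insert (E.other v j)) L) (E.deg v) f' →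
      failProb w Q t ⟨K, σ'⟩ ≤ φ f') (hk : k ≤ E.deg v) :
    failProb w Q (t + 1 + 200 * l.length) ⟨recolorLoop :: K, σ⟩ ≤ resampleAll l φ f := by
  induction l generalizing k σ L f with
  | nil =>
    have hkd : E.deg v ≤ k := by
      have := congrArg List.length hl
      rw [List.length_drop, List.length_nil] at this
      exact Nat.le_of_sub_eq_zero this
    obtain rfl : k = E.deg v := le_antisymm hk hkd
    rw [List.length_nil, mul_zero, add_zero, recolorLoop,
      failProb_whileLt_of_not_lt (by rw [hσ.r18, hσ.r9]; exact lt_irrefl _)]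
    exact hφ σ f hσ
  | cons j l ih =>
    have hkd : k < E.deg v := by
      by_contra h
      rw [List.drop_eq_nil_of_le (not_lt.1 h)] at hl
      exact absurd hl (by simp)
    have hsplit := List.drop_eq_getElem_cons (l := E.star E.m v) (i := k) hkd
    rw [hsplit, List.cons_eq_cons] at hl
    have hj : (E.star E.m v).getD k 0 = j := by rw [List.getD_eq_getElem _ _ hkd]; exact hl.1
    rw [List.length_cons, show t + 1 + 200 * (l.length + 1) = t + 1 + 200 * l.length + 200 by ring,
      resampleAll_cons]
    have := failProb_recolorEdge (Q := Q) (K := K) (t := t + 1 + 200 * l.length) hw hσ hkd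
      (φ := resampleAll l φ) fun σ' f' hσ' => ih hl.2 hσ' (by rw [hj]; exact hφ) hkd
    rwa [hj] at this

end EdgeArray

/-! ### The main loop and its invariant. -/

namespace WordRAM.Program

/-- Registers `8` and `9` become the top of the stack, and its degree. -/
def readTop : Program := sub 15 6 2 ;; readCell 8 3 19 15 ;; readCell 9 1 19 8

/-- Registers `16` and `17` become the keys of the vertex in register `8` and of its neighbour
number `7`. -/
def readKeys : Program := fetch 7 ;; partialKey 8 16 6 ;; partialKey 10 17 6

/-- Register 19 supplies the value 0 that clears the stack mark of the vertex. The scan index is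
reset for the next top. -/
def pop : Program := writeCell 2 19 8 19 ;; sub 6 6 2 ;; const 7 0

def startRecoloring : Program := const 7 0 ;; const 18 0

/-- Equality is tested by two strict comparisons, the only ones available. -/
def compareKeys : Program :=
  ifLt 16 17 (add 7 7 2) (ifLt 17 16 (add 7 7 2) (startRecoloring ;; recolorLoop))

/-- A recoloured vertex is not removed, hence it will be scanned again from its first neighbour
before it can be popped. -/
def mainLoop : Program := whileLt 19 6 (readTop ;; ifLt 7 9 (readKeys ;; compareKeys) pop)

end WordRAM.Program

namespace EdgeArray

open WordRAM.Program Function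

variable (E : EdgeArray)

/-- The state of the main loop: the stack is `L`, the next neighbour of the top of the stack has
number `i`, and the colouring is `f`. -/
structure Scanning (σ : Store) (L : List ℕ) (i : ℕ) (f : ℕ → ℕ) : Prop where
  holds : E.Holds σ L f
  r7 : σ.reg 7 = i
  cover : ∀ j < E.m, E.key f (E.a j) = E.key f (E.b j) → E.a j ∈ L ∨ E.b j ∈ L
  scanned : ∀ v ∈ L.head?, i ≤ E.deg v ∧
    ∀ k < i, E.key f v ≠ E.key f (E.other v ((E.star E.m v).getD k 0))

/-- The store holds a colouring with distinct keys at the ends of each edge. -/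
def Solved (σ : Store) : Prop :=
  ∃ f : ℕ → ℕ, (∀ j < E.m, σ.mem (2 * E.m + j) = f j ∧ f j < 6) ∧
    ∀ j < E.m, E.key f (E.a j) ≠ E.key f (E.b j)

/-- The stack after the edges at its top `v` have been recoloured. -/
def pushNeighbors (v : ℕ) (L : List ℕ) : List ℕ :=
  (E.star E.m v).foldl (fun L j => L.insert (E.other v j)) L

variable {E} {w : ℕ} {σ : Store} {L : List ℕ} {f : ℕ → ℕ} {i v : ℕ}

theorem readTop_spec (hw : E.WordSize w) (hσ : E.Holds σ (v :: L) f) :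
    (readTop.exec w σ).mem = σ.mem ∧ (readTop.exec w σ).reg 8 = v ∧
      (readTop.exec w σ).reg 9 = E.deg v ∧ AgreeOff [8, 9, 14, 15] σ (readTop.exec w σ) := by
  have hwd := hw.width_lt
  have hd : 3 * E.m + E.n + 1 = E.width := rfl
  have hR := hσ.ready
  have hlen := length_le_of_nodup hσ.nodup hσ.lt
  rw [List.length_cons] at hlen
  have hv := hσ.lt v List.mem_cons_self
  have hdm : E.deg v ≤ E.m := length_star_le _ _
  obtain ⟨stk, hstk, hS⟩ := hσ.stored
  have hs3 : σ.mem (E.cell 3 L.length) = v := (hS.stk _ hlen).trans hstk.1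
  have hs1 : σ.mem (E.cell 1 v) = E.deg v := hS.deg _ hv
  have h6 := hσ.top
  rw [List.length_cons] at h6
  rw [readTop, exec_seq, exec_sub (x := L.length) (by rw [h6, hR.r2]; omega) (by omega), exec_seq]
  have e := exec_readCell hw (σ := σ.set 15 L.length) (r := 8) (k := 3) (q := 19) (u := 15)
    (by simp [Store.reg_set, hR.r3]) (by decide) (by decide) (by simp [Store.reg_set, hR.r19])
    (by simpa [Store.reg_set] using hlen)
    (by simp [Store.reg_set, Store.mem_set, hR.r19, hs3]; omega)
  rw [e]
  simp only [Store.reg_set, Store.mem_set, if_true, hR.r19, add_zero, hs3,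
    if_neg (show ¬ 19 = 15 by decide)]
  set σ₁ := ((σ.set 15 L.length).set 14 (E.cell 3 L.length)).set 8 v with hσ₁
  have h8 : σ₁.reg 8 = v := by simp [hσ₁, Store.reg_set]
  have h19 : σ₁.reg 19 = 0 := by simp [hσ₁, Store.reg_set, hR.r19]
  have hm : σ₁.mem = σ.mem := rfl
  rw [exec_readCell hw (by simp [hσ₁, Store.reg_set, hR.r3]) (by decide) (by decide)
    (by rw [h19]; omega) (by rw [h8]; exact hv) (by rw [h8, h19, hm, add_zero, hs1]; omega),
    h8, h19, hm, add_zero, hs1]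
  refine ⟨rfl, by simp [Store.reg_set, h8], by simp [Store.reg_set], fun r hr => ?_⟩
  simp only [List.mem_cons, List.not_mem_nil, or_false, not_or] at hr
  simp [hσ₁, Store.reg_set, hr]

theorem getD_star_mem (hi : i < E.deg v) : (E.star E.m v).getD i 0 ∈ E.star E.m v := by
  rw [List.getD_eq_getElem _ _ hi]
  exact List.getElem_mem _

theorem readKeys_spec (hw : E.WordSize w) (hσ : E.Holds σ L f) (h7 : σ.reg 7 = i)
    (h8 : σ.reg 8 = v) (hv : v < E.n) (hi : i < E.deg v) :
    (readKeys.exec w σ).mem = σ.mem ∧ (readKeys.exec w σ).reg 16 = E.key f v ∧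
      (readKeys.exec w σ).reg 17 = E.key f (E.other v ((E.star E.m v).getD i 0)) ∧
      AgreeOff [10, 11, 14, 15, 16, 17] σ (readKeys.exec w σ) := by
  have hdm : E.deg v ≤ E.m := length_star_le _ _
  obtain ⟨stk, hstk, hS⟩ := hσ.stored
  have hj := getD_star_mem hi
  obtain ⟨hm, h11, h10, hA⟩ := fetch_spec hw hσ.ready hS (q := 7) (by decide) (h8 ▸ hv)
    (by omega) (by rw [h7, h8]; exact hj)
  rw [h7, h8] at h10
  rw [readKeys, exec_seq, exec_seq]
  generalize (fetch 7).exec w σ = σ₁ at *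
  have hR₁ := hσ.ready.of_agreeOff hA (by decide)
  have h8₁ : σ₁.reg 8 = v := (hA 8 (by decide)).trans h8
  rw [← hm] at hS
  obtain ⟨hm₂, h16, hA₂⟩ := partialKey_spec hw hR₁ hS (u := 8) (r := 16) (k := 6) (by decide)
    (by decide) (by decide) (h8₁ ▸ hv) (fun c _ => count_le _ _ _ _) (by omega) le_rfl
  rw [h8₁] at h16
  generalize (partialKey 8 16 6).exec w σ₁ = σ₂ at *
  have hR₂ := hR₁.of_agreeOff hA₂ (by decide)
  have h10₂ : σ₂.reg 10 = E.other v ((E.star E.m v).getD i 0) := (hA₂ 10 (by decide)).trans h10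
  rw [← hm₂] at hS
  obtain ⟨hm₃, h17, hA₃⟩ := partialKey_spec hw hR₂ hS (u := 10) (r := 17) (k := 6) (by decide)
    (by decide) (by decide) (h10₂ ▸ (other_spec hj).1) (fun c _ => count_le _ _ _ _) (by omega)
    le_rfl
  rw [h10₂] at h17
  refine ⟨by rw [hm₃, hm₂, hm], (hA₃ 16 (by decide)).trans h16, h17, ?_⟩
  exact ((hA.trans hA₂).trans hA₃).mono (by decide)

theorem straight_readTop : readTop.Straight := by
  simp [readTop, readCell, rowAddr, Straight]

theorem straight_readKeys : readKeys.Straight := by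
  simp [readKeys, fetch, partialKey, readCell, rowAddr, Straight]

theorem straight_pop : pop.Straight := by
  simp [pop, writeCell, rowAddr, Straight]

theorem cost_scan : readTop.cost + readKeys.cost + pop.cost + startRecoloring.cost + 10 ≤ 400 := by
  simp [readTop, readKeys, pop, startRecoloring, fetch, partialKey, readCell, writeCell, rowAddr,
    cost]

variable {Q : Store → Prop} {K : List Program} {t : ℕ}

/-- With an empty stack the covering invariant leaves no place for a conflict. -/
theorem failProb_mainLoop_of_nil (hσ : E.Scanning σ [] i f) :
    failProb w E.Solved (t + 1) ⟨[mainLoop], σ⟩ = 0 := by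
  rw [mainLoop, failProb_whileLt_of_not_lt (by rw [hσ.holds.ready.r19, hσ.holds.top]; simp)]
  refine failProb_of_halted (c := ⟨[], σ⟩) rfl ?_ t
  obtain ⟨stk, -, hS⟩ := hσ.holds.stored
  refine ⟨f, fun j hj => ⟨hS.col j hj, hσ.holds.col_lt j hj⟩, fun j hj hkey => ?_⟩
  rcases hσ.cover j hj hkey with h | h <;> exact absurd h List.not_mem_nil

theorem failProb_readTop (hw : E.WordSize w) (hσ : E.Scanning σ (v :: L) i f) :
    ∃ σ', E.Scanning σ' (v :: L) i f ∧ σ'.reg 8 = v ∧ σ'.reg 9 = E.deg v ∧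
      failProb w Q (t + readTop.cost + 2) ⟨mainLoop :: K, σ⟩ ≤
        failProb w Q t ⟨ifLt 7 9 (readKeys ;; compareKeys) pop :: mainLoop :: K, σ'⟩ := by
  obtain ⟨hm, h8, h9, hA⟩ := readTop_spec hw hσ.holds
  refine ⟨_, ⟨hσ.holds.of_agreeOff hA hm (by decide) (by decide), (hA 7 (by decide)).trans hσ.r7,
    hσ.cover, hσ.scanned⟩, h8, h9, ?_⟩
  rw [mainLoop, show t + readTop.cost + 2 = t + readTop.cost + 1 + 1 by ring,
    failProb_whileLt_of_lt (by rw [hσ.holds.ready.r19, hσ.holds.top]; simp), failProb_seq]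
  exact failProb_straight straight_readTop _ _ _

/-- Popping v keeps conflicts covered: the finished scan shows that no conflicting edge meets v, so
those covered are covered by the rest of the stack. -/
theorem failProb_mainLoop_pop (hw : E.WordSize w) (hσ : E.Scanning σ (v :: L) (E.deg v) f) :
    ∃ σ', E.Scanning σ' L 0 f ∧
      failProb w Q (t + 400) ⟨mainLoop :: K, σ⟩ ≤ failProb w Q t ⟨mainLoop :: K, σ'⟩ := by
  obtain ⟨σ₁, hσ₁, h8, h9, hle⟩ := failProb_readTop (Q := Q) (K := K) (t := t + pop.cost + 1) hw hσ
  have hwd := hw.width_lt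
  have hd : 3 * E.m + E.n + 1 = E.width := rfl
  have hR := hσ₁.holds.ready
  have hv := hσ.holds.lt v List.mem_cons_self
  have hlen := length_le_of_nodup hσ.holds.nodup hσ.holds.lt
  rw [List.length_cons] at hlen
  have h6 := hσ₁.holds.top
  rw [List.length_cons] at h6
  obtain ⟨stk, hstk, hS⟩ := hσ₁.holds.stored
  refine ⟨pop.exec w σ₁, ?_, ?_⟩
  swap
  · have := cost_scan
    refine (failProb_le_of_le (by omega) _).trans (hle.trans ?_)
    rw [failProb_ifLt, if_neg (by rw [hσ₁.r7, h9]; exact lt_irrefl _)]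
    exact failProb_straight straight_pop _ _ _
  have hvL : v ∉ L := (List.nodup_cons.1 hσ.holds.nodup).1
  rw [pop, exec_seq, exec_writeCell hw hR.r3 (by decide) (by decide) (by decide)
      (by rw [hR.r19]; omega) (by omega) (by rw [hR.r19]; omega), exec_seq,
    exec_sub (x := L.length) (by simp [h6, hR.r2]) (by omega), exec_const (by omega)]
  rw [h8, hR.r19, add_zero]
  set σ₂ := ((Store.mk (update σ₁.reg 14 (E.cell 2 v)) (update σ₁.mem (E.cell 2 v) 0)).set 6
    L.length).set 7 0 with hσ₂
  have hA : AgreeOff [6, 7, 14] σ₁ σ₂ := fun r hr => by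
    simp only [List.mem_cons, List.not_mem_nil, or_false, not_or] at hr
    simp [hσ₂, Store.reg_set, hr]
  -- The scan index has reached the degree, so every edge at v has been compared under the present
  -- colouring.
  have hcover : ∀ j ∈ E.star E.m v, E.key f v ≠ E.key f (E.other v j) := by
    intro j hj
    obtain ⟨k, hk, rfl⟩ := List.getElem_of_mem hj
    have := (hσ.scanned v rfl).2 k hk
    rwa [List.getD_eq_getElem _ _ hk] at this
  refine ⟨⟨hR.of_agreeOff hA (by decide), by simp [hσ₂, Store.reg_set], ⟨stk, hstk.2, ?_⟩,
    (List.nodup_cons.1 hσ.holds.nodup).2, fun u hu => hσ.holds.lt u (List.mem_cons_of_mem v hu),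
    hσ.holds.col_lt⟩, by simp [hσ₂, Store.reg_set], fun j hj hkey => ?_, fun u _ =>
    ⟨Nat.zero_le _, fun k hk => absurd hk (Nat.not_lt_zero k)⟩⟩
  · refine (hS.setFlag (x := 0) hv).congr (fun _ _ => rfl) (fun _ _ => rfl) (fun u _ => ?_)
      (fun _ _ => rfl) (fun _ _ _ _ => rfl) (fun _ _ _ => rfl)
    simp only [Tables.setFlag, tables, update_apply, List.mem_cons]
    by_cases huv : u = v <;> simp [huv, hvL]
  · have ha : E.a j ≠ v := fun ha => by
      refine hcover j (mem_star.2 ⟨hj, Or.inl ha⟩) ?_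
      rw [← ha, hkey, other, Nat.add_sub_cancel_left]
    have hb : E.b j ≠ v := fun hb => by
      refine hcover j (mem_star.2 ⟨hj, Or.inr hb⟩) ?_
      rw [← hb, ← hkey, other, Nat.add_sub_cancel]
    simpa [ha, hb] using hσ.cover j hj hkey

theorem failProb_readKeys (hw : E.WordSize w) (hσ : E.Scanning σ (v :: L) i f)
    (hi : i < E.deg v) :
    ∃ σ', E.Scanning σ' (v :: L) i f ∧ σ'.reg 8 = v ∧ σ'.reg 9 = E.deg v ∧
      σ'.reg 16 = E.key f v ∧ σ'.reg 17 = E.key f (E.other v ((E.star E.m v).getD i 0)) ∧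
      failProb w Q (t + readTop.cost + readKeys.cost + 4) ⟨mainLoop :: K, σ⟩ ≤
        failProb w Q t ⟨compareKeys :: mainLoop :: K, σ'⟩ := by
  obtain ⟨σ₁, hσ₁, h8, h9, hle⟩ :=
    failProb_readTop (Q := Q) (K := K) (t := t + readKeys.cost + 1 + 1) hw hσ
  obtain ⟨hm, h16, h17, hA⟩ := readKeys_spec hw hσ₁.holds hσ₁.r7 h8
    (hσ.holds.lt v List.mem_cons_self) hi
  refine ⟨readKeys.exec w σ₁, ⟨hσ₁.holds.of_agreeOff hA hm (by decide) (by decide),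
    (hA 7 (by decide)).trans hσ₁.r7, hσ.cover, hσ.scanned⟩, (hA 8 (by decide)).trans h8,
    (hA 9 (by decide)).trans h9, h16, h17, ?_⟩
  refine (failProb_le_of_le (by omega) _).trans (hle.trans ?_)
  rw [failProb_ifLt, if_pos (by rw [hσ₁.r7, h9]; exact hi), failProb_seq]
  exact failProb_straight straight_readKeys _ _ _

theorem failProb_mainLoop_next (hw : E.WordSize w) (hσ : E.Scanning σ (v :: L) i f)
    (hi : i < E.deg v) (hkey : E.key f v ≠ E.key f (E.other v ((E.star E.m v).getD i 0))) :
    ∃ σ', E.Scanning σ' (v :: L) (i + 1) f ∧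
      failProb w Q (t + 400) ⟨mainLoop :: K, σ⟩ ≤ failProb w Q t ⟨mainLoop :: K, σ'⟩ := by
  obtain ⟨σ₁, hσ₁, h8, h9, h16, h17, hle⟩ :=
    failProb_readKeys (Q := Q) (K := K) (t := t + 3) hw hσ hi
  have hwd := hw.width_lt
  have hd : 3 * E.m + E.n + 1 = E.width := rfl
  have hdm : E.deg v ≤ E.m := length_star_le _ _
  refine ⟨σ₁.set 7 (i + 1), ⟨hσ₁.holds.of_agreeOff (AgreeOff_set _ _ _) rfl (by decide)
    (by decide), by simp [Store.reg_set], hσ.cover, fun u hu => ?_⟩, ?_⟩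
  · obtain rfl : v = u := by simpa using hu
    refine ⟨hi, fun k hk => ?_⟩
    rcases Nat.lt_succ_iff_lt_or_eq.1 hk with hk | rfl
    · exact (hσ.scanned v rfl).2 k hk
    · exact hkey
  · have := cost_scan
    refine (failProb_le_of_le (by omega) _).trans (hle.trans ?_)
    have e : failProb w Q (t + 1) ⟨add 7 7 2 :: mainLoop :: K, σ₁⟩ =
        failProb w Q t ⟨mainLoop :: K, σ₁.set 7 (i + 1)⟩ := by
      rw [failProb_succ_of_step_eq_pure (by rw [step]), hσ₁.r7, hσ₁.holds.ready.r2,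
        Store.setReg_eq_set (by omega)]
    rw [compareKeys, failProb_ifLt, h16, h17]
    split_ifs with h
    · exact (failProb_le_of_le (by omega) _).trans e.le
    · rw [failProb_ifLt, h16, h17, if_pos (by omega), e]

theorem mem_foldl_insert {l : List ℕ} {g : ℕ → ℕ} {x : ℕ} :
    x ∈ l.foldl (fun L j => L.insert (g j)) L ↔ x ∈ L ∨ ∃ j ∈ l, x = g j := by
  induction l generalizing L with
  | nil => simp
  | cons j l ih =>
    rw [List.foldl_cons, ih, List.mem_insert_iff]
    simp only [List.mem_cons, exists_eq_or_imp]
    tauto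

/-- Recolouring the edges at v affects only the keys of v and of its neighbours, all of which are
then on the stack. Earlier comparisons become void, so the scan index is 0 again. The bound φ may
depend on the colouring only, which lets the draws become an average. -/
theorem failProb_mainLoop_recolor (hw : E.WordSize w) (hσ : E.Scanning σ (v :: L) i f)
    (hi : i < E.deg v) (hkey : E.key f v = E.key f (E.other v ((E.star E.m v).getD i 0)))
    {φ : (ℕ → ℕ) → ℝ≥0∞}
    (hφ : ∀ σ' f', E.Scanning σ' (E.pushNeighbors v (v :: L)) 0 f' →
      failProb w Q t ⟨mainLoop :: K, σ'⟩ ≤ φ f') :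
    failProb w Q (t + 400 + 200 * E.deg v) ⟨mainLoop :: K, σ⟩ ≤
      resampleAll (E.star E.m v) φ f := by
  obtain ⟨σ₁, hσ₁, h8, h9, h16, h17, hle⟩ := failProb_readKeys (Q := Q) (K := K)
    (t := t + 1 + 200 * E.deg v + startRecoloring.cost + 3) hw hσ hi
  have hwd := hw.width_lt
  have hd : 3 * E.m + E.n + 1 = E.width := rfl
  have := cost_scan
  refine (failProb_le_of_le (by omega) _).trans (hle.trans ?_)
  rw [compareKeys, failProb_ifLt, h16, h17, if_neg (by omega), failProb_ifLt, h16, h17,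
    if_neg (by omega), failProb_seq]
  refine (failProb_straight (p := startRecoloring) ⟨trivial, trivial⟩ _ _ _).trans ?_
  rw [startRecoloring, exec_seq, exec_const (by omega), exec_const (by omega)]
  set σ₂ := (σ₁.set 7 0).set 18 0 with hσ₂
  have hA : AgreeOff ([7] ++ [18]) σ₁ σ₂ := (AgreeOff_set _ _ _).trans (AgreeOff_set _ _ _)
  have hrec : E.Recoloring v σ₂ (v :: L) 0 f :=
    ⟨hσ₁.holds.of_agreeOff hA rfl (by decide) (by decide), List.mem_cons_self,
      by simp [hσ₂, Store.reg_set], (hA 8 (by decide)).trans h8, (hA 9 (by decide)).trans h9,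
      by simp [hσ₂, Store.reg_set], fun j hj h => (hσ.cover j hj h).imp_right Or.inl⟩
  refine failProb_recolorLoop hw (List.drop_zero) hrec (fun σ' f' h => ?_) (Nat.zero_le _)
  refine hφ σ' f' ⟨h.holds, h.r7, fun j hj hk => ?_, fun u _ =>
    ⟨Nat.zero_le _, fun k hk => absurd hk (Nat.not_lt_zero k)⟩⟩
  rcases h.cover j hj hk with h | h | ⟨k, hk, h | h⟩
  · exact Or.inl h
  · exact Or.inr h
  · exact Or.inl (mem_foldl_insert.2 (Or.inr ⟨k, hk, h⟩))
  · exact Or.inr (mem_foldl_insert.2 (Or.inr ⟨k, hk, h⟩))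

end EdgeArray

/-! ### Initialisation: constants, random colouring, full stack. -/

namespace WordRAM.Program

/-- Register 3 becomes the width 3m + n + 1. Register 5 runs through m², m³, m⁶, m⁷. -/
def loadConstants : Program :=
  const 2 1 ;; const 4 6 ;; add 20 1 1 ;; add 3 20 1 ;; add 3 3 0 ;; add 3 3 2 ;;
    mul 5 1 1 ;; mul 5 5 1 ;; mul 5 5 5 ;; mul 5 5 1

/-- Append the edge number `18` to the lists of its endpoints. -/
def readEdge : Program :=
  add 14 18 18 ;; load 8 14 ;; add 14 14 2 ;; load 10 14 ;; attach 8 18 ;; attach 10 18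

/-- Give the colour in register `12` to the edge number `18`. -/
def storeEdge : Program :=
  writeColor 18 12 ;; increment 12 8 ;; increment 12 10 ;; add 18 18 2

def readEdges : Program := whileLt 18 1 (readEdge ;; rand 12 4 ;; storeEdge)

/-- Register 6 is both the height of the stack and the vertex to be pushed. -/
def pushTop : Program := writeCell 2 19 6 2 ;; writeCell 3 19 6 6 ;; add 6 6 2

/-- Push all vertices on the stack. -/
def fillStack : Program := whileLt 6 0 pushTop

/-- The program that finds a colouring. -/
def colorBlind : Program := loadConstants ;; readEdges ;; fillStack ;; mainLoop

end WordRAM.Program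

namespace EdgeArray

open WordRAM.Program Function

variable (E : EdgeArray)

/-- The store that holds the edges, before the start of the program. -/
structure IsInput (σ : Store) : Prop where
  r0 : σ.reg 0 = E.n
  r1 : σ.reg 1 = E.m
  reg : ∀ r, 2 ≤ r → σ.reg r = 0
  fst : ∀ j < E.m, σ.mem (2 * j) = E.a j
  snd : ∀ j < E.m, σ.mem (2 * j + 1) = E.b j
  mem : ∀ x, 2 * E.m ≤ x → σ.mem x = 0

/-- The tables for the first `k` edges. -/
def partialTables (k : ℕ) (f : ℕ → ℕ) : Tables where
  deg u := (E.star k u).length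
  flag _ := 0
  stk _ := 0
  cnt c u := E.count k f u c
  adj i u := (E.star k u).getD i 0
  col := f

/-- The state of the loop that reads the edges. -/
structure Reading (σ : Store) (k : ℕ) (f : ℕ → ℕ) : Prop where
  ready : E.Ready σ
  r6 : σ.reg 6 = 0
  r7 : σ.reg 7 = 0
  r18 : σ.reg 18 = k
  stored : E.Stored σ.mem (E.partialTables k f)
  col_lt : ∀ j < E.m, f j < 6

variable {E} {w : ℕ} {σ : Store} {L : List ℕ} {f : ℕ → ℕ} {k : ℕ} {Q : Store → Prop}
  {K : List Program} {t : ℕ}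

theorem loadConstants_spec (hw : E.WordSize w) (hσ : E.IsInput σ) :
    E.Reading (loadConstants.exec w σ) 0 0 := by
  have hwd := hw.width_lt
  have hd : 3 * E.m + E.n + 1 = E.width := rfl
  have h7 : E.m ^ 7 < 2 ^ w := by
    refine lt_of_le_of_lt ?_ hw.keys
    calc E.m ^ 7 ≤ E.m ^ 7 + E.m := Nat.le_add_right _ _
      _ ≤ _ := Nat.le_self_pow (by omega) _
  have hpow : ∀ i, 1 ≤ i → i ≤ 7 → E.m ^ i < 2 ^ w := fun i h1 hi => by
    rcases Nat.eq_zero_or_pos E.m with h0 | hpos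
    · rw [h0, zero_pow (by omega)]; omega
    · exact (Nat.pow_le_pow_right hpos hi).trans_lt h7
  rw [loadConstants, exec_seq, exec_const (by omega), exec_seq, exec_const (by omega), exec_seq,
    exec_add (x := 2 * E.m) (by simp [Store.reg_set, hσ.r1]; omega) (by omega), exec_seq,
    exec_add (x := 3 * E.m) (by simp [Store.reg_set, hσ.r1]; omega) (by omega), exec_seq,
    exec_add (x := 3 * E.m + E.n) (by simp [Store.reg_set, hσ.r0]) (by omega), exec_seq,
    exec_add (x := E.width) (by simp [Store.reg_set, hd]) (by omega), exec_seq,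
    exec_mul (x := E.m ^ 2) (by simp [Store.reg_set, hσ.r1]; ring)
      (hpow 2 (by omega) (by omega)), exec_seq,
    exec_mul (x := E.m ^ 3) (by simp [Store.reg_set, hσ.r1]; ring)
      (hpow 3 (by omega) (by omega)), exec_seq,
    exec_mul (x := E.m ^ 6) (b := 5) (by simp [Store.reg_set]; ring) (hpow 6 (by omega) (by omega)),
    exec_mul (x := E.m ^ 7) (by simp [Store.reg_set, hσ.r1]; ring)
      (hpow 7 (by omega) (by omega))]
  have hz := hσ.reg
  refine ⟨⟨?_, ?_, ?_, ?_, ?_, ?_, ?_, ?_⟩, ?_, ?_, ?_, ?_, fun _ _ => by simp⟩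
  · simp [Store.reg_set, hσ.r0]
  · simp [Store.reg_set, hσ.r1]
  · simp [Store.reg_set]
  · simp [Store.reg_set]
  · simp [Store.reg_set]
  · simp [Store.reg_set]
  · simp [Store.reg_set, hz]
  · simp [Store.reg_set]
  · simp [Store.reg_set, hz]
  · simp [Store.reg_set, hz]
  · simp [Store.reg_set, hz]
  · have hc : ∀ r u, 1 ≤ r → σ.mem (E.cell r u) = 0 := fun r u hr => by
      have := le_cell (E := E) (u := u) hr
      exact hσ.mem _ (by omega)
    refine ⟨hσ.fst, hσ.snd, fun j _ => hσ.mem _ (by omega), fun u _ => ?_, fun u _ => ?_,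
      fun u _ => ?_, fun c _ u _ => ?_, fun i u _ => ?_⟩
    -- The initial memory is blank, which agrees with zero counts and with the default value 0 of
    -- entries beyond the end of an adjacency list.
    all_goals
      refine (hc _ _ (by omega)).trans ?_
      simp [partialTables, star, count]

/-- An intermediate state: the new edge already belongs to the degrees and adjacency lists, but not
yet to the colour counts, as its colour has not been drawn. -/
theorem readEdge_spec (hw : E.WordSize w) (hσ : E.Reading σ k f) (hk : k < E.m) :
    E.Stored (readEdge.exec w σ).mem
      { E.partialTables (k + 1) f with cnt := (E.partialTables k f).cnt } ∧
      (readEdge.exec w σ).reg 8 = E.a k ∧ (readEdge.exec w σ).reg 10 = E.b k ∧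
      AgreeOff [8, 10, 14, 15] σ (readEdge.exec w σ) := by
  have hwd := hw.width_lt
  have hd : 3 * E.m + E.n + 1 = E.width := rfl
  have ha := E.a_lt k hk
  have hb := E.b_lt k hk
  have hab := E.ne k hk
  have hR := hσ.ready
  have hS := hσ.stored
  rw [readEdge, exec_seq, exec_add (x := 2 * k) (by rw [hσ.r18]; ring) (by omega), exec_seq,
    exec_load (x := E.a k) (by simp [Store.reg_set, Store.mem_set, hS.fst k hk]) (by omega),
    exec_seq, exec_add (x := 2 * k + 1) (by simp [Store.reg_set, hR.r2]) (by omega), exec_seq,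
    exec_load (x := E.b k) (by simp [Store.reg_set, Store.mem_set, hS.snd k hk]) (by omega)]
  set σ₁ := (((σ.set 14 (2 * k)).set 8 (E.a k)).set 14 (2 * k + 1)).set 10 (E.b k) with hσ₁
  have hA₁ : AgreeOff [8, 10, 14] σ σ₁ := fun r hr => by
    simp only [List.mem_cons, List.not_mem_nil, or_false, not_or] at hr
    simp [hσ₁, Store.reg_set, hr]
  have hR₁ := hR.of_agreeOff hA₁ (by decide)
  have h8 : σ₁.reg 8 = E.a k := by simp [hσ₁, Store.reg_set]
  have h10 : σ₁.reg 10 = E.b k := by simp [hσ₁, Store.reg_set]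
  have h18 : σ₁.reg 18 = k := (hA₁ 18 (by decide)).trans hσ.r18
  have hS₁ : E.Stored σ₁.mem (E.partialTables k f) := hS
  clear_value σ₁
  have hdeg : ∀ u, (E.partialTables k f).deg u ≤ k := fun u => length_star_le _ _
  have hda := hdeg (E.a k)
  obtain ⟨hS₂, hA₂⟩ := attach_spec hw hR₁ hS₁ (u := 8) (j := 18) (by decide) (by decide)
    (by omega) (by omega) (by rw [h8]; omega)
  rw [h8, h18] at hS₂
  rw [exec_seq]
  generalize (attach 8 18).exec w σ₁ = σ₂ at *
  have hR₂ := hR₁.of_agreeOff hA₂ (by decide)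
  have h8₂ : σ₂.reg 8 = E.a k := (hA₂ 8 (by decide)).trans h8
  have h10₂ : σ₂.reg 10 = E.b k := (hA₂ 10 (by decide)).trans h10
  have h18₂ : σ₂.reg 18 = k := (hA₂ 18 (by decide)).trans h18
  obtain ⟨D₂, hD₂⟩ : ∃ D₂, D₂ = ((E.partialTables k f).setAdj ((E.partialTables k f).deg (E.a k))
    (E.a k) k).setDeg (E.a k) ((E.partialTables k f).deg (E.a k) + 1) := ⟨_, rfl⟩
  rw [← hD₂] at hS₂
  have hdb : D₂.deg (E.b k) = (E.partialTables k f).deg (E.b k) := by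
    rw [hD₂]
    exact update_of_ne hab.symm _ _
  have hdb' := hdeg (E.b k)
  obtain ⟨hS₃, hA₃⟩ := attach_spec hw hR₂ hS₂ (u := 10) (j := 18) (by decide) (by decide)
    (by omega) (by omega) (by rw [h10₂, hdb]; omega)
  rw [h10₂, h18₂, hdb] at hS₃
  refine ⟨hS₃.congr ?_ ?_ ?_ ?_ ?_ ?_, (hA₃ 8 (by decide)).trans h8₂,
    (hA₃ 10 (by decide)).trans h10₂, ((hA₁.trans hA₂).trans hA₃).mono (by decide)⟩
  · intro j _; rw [hD₂]; rfl
  · intro u _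
    rw [hD₂]
    simp only [Tables.setDeg, Tables.setAdj, partialTables, update_apply, star_succ,
      List.length_append]
    by_cases hua : u = E.a k
    · subst hua
      simp [hab]
    · by_cases hub : u = E.b k
      · subst hub; simp
      · simp [hua, hub, Ne.symm hua, Ne.symm hub]
  · intro u _; rw [hD₂]; rfl
  · intro u _; rw [hD₂]; rfl
  · intro c _ u _; rw [hD₂]; rfl
  · intro i u _
    rw [hD₂]
    -- The new edge is written at the index given by the old degree, which is where appending puts
    -- it. Further entries are the default 0 on both sides.
    have key : ∀ v, (E.a k = v ∨ E.b k = v) → (E.star (k + 1) v).getD i 0 =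
        if i = (E.star k v).length then k else (E.star k v).getD i 0 := fun v hv => by
      rw [star_succ, if_pos hv]
      simp only [List.getD_eq_getElem?_getD, List.getElem?_append]
      by_cases h1 : i < (E.star k v).length
      · simp [h1, h1.ne]
      · rcases eq_or_ne i (E.star k v).length with h2 | h2
        · simp [h2]
        · have h3 : ¬ i - (E.star k v).length = 0 := by omega
          simp [h1, h2]
          rw [List.getElem?_eq_none (by simp; omega)]
          rfl
    simp only [Tables.setDeg, Tables.setAdj, partialTables, update_apply]
    by_cases hua : u = E.a k
    · subst hua
      rw [key _ (Or.inl rfl)]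
      by_cases h1 : i = (E.star k (E.a k)).length
      · by_cases h2 : i = (E.star k (E.b k)).length
        · simp [← h1, ← h2, hab]
        · simp [← h1, h2]
      · by_cases h2 : i = (E.star k (E.b k)).length
        · simp [h1, ← h2, hab]
        · simp [h1, h2]
    · by_cases hub : u = E.b k
      · subst hub
        rw [key _ (Or.inr rfl)]
        by_cases h2 : i = (E.star k (E.b k)).length
        · simp [← h2]
        · by_cases h1 : i = (E.star k (E.a k)).length
          · simp [h2, ← h1, hua]
          · simp [h1, h2]
      · rw [star_succ, if_neg (show ¬ (E.a k = u ∨ E.b k = u) by omega), List.append_nil]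
        by_cases h2 : i = (E.star k (E.b k)).length
        · by_cases h1 : i = (E.star k (E.a k)).length
          · simp [← h2, ← h1, hua, hub]
          · simp [← h2, h1, hub]
        · by_cases h1 : i = (E.star k (E.a k)).length
          · simp [h2, ← h1, hua]
          · simp [h1, h2]

end EdgeArray

namespace EdgeArray

open WordRAM.Program Function

variable {E : EdgeArray} {w : ℕ} {σ : Store} {L : List ℕ} {f : ℕ → ℕ} {k : ℕ} {Q : Store → Prop}
  {K : List Program} {t : ℕ}

theorem count_succ_update (k : ℕ) (f : ℕ → ℕ) (c u d : ℕ) :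
    E.count (k + 1) (update f k c) u d =
      E.count k f u d + if (E.a k = u ∨ E.b k = u) ∧ c = d then 1 else 0 := by
  rw [count, star_succ, List.countP_append, count]
  congr 1
  · refine List.countP_congr fun i hi => ?_
    rw [update_of_ne (mem_star.1 hi).1.ne]
  · by_cases h : E.a k = u ∨ E.b k = u <;> simp [h, List.countP_cons]

theorem storeEdge_spec (hw : E.WordSize w) (hk : k < E.m) (hR : E.Ready σ)
    (hS : E.Stored σ.mem { E.partialTables (k + 1) f with cnt := (E.partialTables k f).cnt })
    (h6 : σ.reg 6 = 0) (h7 : σ.reg 7 = 0) (h18 : σ.reg 18 = k) (h8 : σ.reg 8 = E.a k)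
    (h10 : σ.reg 10 = E.b k) {c : ℕ} (h12 : σ.reg 12 = c) (hc : c < 6)
    (hf : ∀ j < E.m, f j < 6) :
    E.Reading (storeEdge.exec w σ) (k + 1) (update f k c) := by
  have hwd := hw.width_lt
  have hd : 3 * E.m + E.n + 1 = E.width := rfl
  have ha := E.a_lt k hk
  have hb := E.b_lt k hk
  have hab := E.ne k hk
  obtain ⟨hS₁, hA₁⟩ := writeColor_spec hw hR hS (j := 18) (c := 12) (by decide) (by omega)
    (by omega)
  rw [h18, h12] at hS₁
  rw [storeEdge, exec_seq]
  generalize (writeColor 18 12).exec w σ = σ₁ at *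
  have hR₁ := hR.of_agreeOff hA₁ (by decide)
  have h8₁ : σ₁.reg 8 = E.a k := (hA₁ 8 (by decide)).trans h8
  have h12₁ : σ₁.reg 12 = c := (hA₁ 12 (by decide)).trans h12
  obtain ⟨D₁, hD₁⟩ : ∃ D₁, D₁ = Tables.setCol
    { E.partialTables (k + 1) f with cnt := (E.partialTables k f).cnt } k c := ⟨_, rfl⟩
  rw [← hD₁] at hS₁
  have hcnt : D₁.cnt = fun c u => E.count k f u c := by rw [hD₁]; rfl
  have hle : ∀ c u, D₁.cnt c u ≤ k := fun c u => by rw [hcnt]; exact count_le _ _ _ _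
  have hle1 := hle c (E.a k)
  have hle2 := hle c (E.b k)
  obtain ⟨hS₂, hA₂⟩ := increment_spec hw hR₁ hS₁ (c := 12) (u := 8) (by decide) (by decide)
    (by omega) (by omega) (by rw [h12₁, h8₁]; omega)
  rw [h12₁, h8₁] at hS₂
  rw [exec_seq]
  generalize (increment 12 8).exec w σ₁ = σ₂ at *
  have hR₂ := hR₁.of_agreeOff hA₂ (by decide)
  have hA₀₂ := hA₁.trans hA₂
  have h10₂ : σ₂.reg 10 = E.b k := (hA₀₂ 10 (by decide)).trans h10
  have h12₂ : σ₂.reg 12 = c := (hA₂ 12 (by decide)).trans h12₁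
  have hval : (D₁.setCnt c (E.a k) (D₁.cnt c (E.a k) + 1)).cnt c (E.b k) = D₁.cnt c (E.b k) := by
    rw [Tables.cnt_setCnt, if_neg fun h => hab h.2.symm]
  obtain ⟨hS₃, hA₃⟩ := increment_spec hw hR₂ hS₂ (c := 12) (u := 10) (by decide) (by decide)
    (by omega) (by omega) (by rw [h12₂, h10₂, hval]; omega)
  rw [h12₂, h10₂, hval] at hS₃
  rw [exec_seq]
  generalize (increment 12 10).exec w σ₂ = σ₃ at *
  have hA₀₃ := hA₀₂.trans hA₃
  have h18₃ : σ₃.reg 18 = k := (hA₀₃ 18 (by decide)).trans h18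
  have hR₃ := hR₂.of_agreeOff hA₃ (by decide)
  rw [exec_add (x := k + 1) (by rw [h18₃, hR₃.r2]) (by omega)]
  have hA := hA₀₃.trans (AgreeOff_set σ₃ 18 (k + 1))
  refine ⟨hR.of_agreeOff hA (by decide), (hA 6 (by decide)).trans h6, (hA 7 (by decide)).trans h7,
    by simp [Store.reg_set], ?_, fun j hj => ?_⟩
  · refine hS₃.congr ?_ ?_ ?_ ?_ ?_ ?_
    · intro j _; rw [hD₁]; rfl
    · intro u _; rw [hD₁]; rfl
    · intro u _; rw [hD₁]; rfl
    · intro u _; rw [hD₁]; rfl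
    · intro d _ u _
      simp only [Tables.cnt_setCnt, hcnt, partialTables, count_succ_update]
      by_cases hd : d = c
      · subst hd
        by_cases hua : u = E.a k
        · subst hua; simp [hab]
        · by_cases hub : u = E.b k
          · subst hub; simp
          · simp [hua, hub, Ne.symm hua, Ne.symm hub]
      · simp [hd, Ne.symm hd]
    · intro i u _; rw [hD₁]; rfl
  · rw [update_apply]
    split_ifs
    · exact hc
    · exact hf j hj

theorem straight_readEdge : readEdge.Straight := by
  simp [readEdge, attach, readCell, writeCell, rowAddr, Straight]

theorem straight_storeEdge : storeEdge.Straight := by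
  simp [storeEdge, writeColor, increment, readCell, writeCell, rowAddr, Straight]

theorem cost_readEdges : readEdge.cost + storeEdge.cost + 4 ≤ 200 := by
  simp [readEdge, attach, storeEdge, writeColor, increment, readCell, writeCell, rowAddr, cost]

/-- One independent draw per edge makes the initial colouring uniform: the nested averages form
`resampleAll` over the edges still to be read. -/
theorem failProb_readEdges (hw : E.WordSize w) {r : ℕ} (hr : k + r = E.m)
    (hσ : E.Reading σ k f) {φ : (ℕ → ℕ) → ℝ≥0∞}
    (hφ : ∀ σ' f', E.Reading σ' E.m f' → failProb w Q t ⟨K, σ'⟩ ≤ φ f') :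
    failProb w Q (t + 1 + 200 * r) ⟨readEdges :: K, σ⟩ ≤ resampleAll (List.range' k r) φ f := by
  induction r generalizing k σ f with
  | zero =>
    obtain rfl : k = E.m := hr
    rw [mul_zero, add_zero, readEdges,
      failProb_whileLt_of_not_lt (by rw [hσ.r18, hσ.ready.r1]; exact lt_irrefl _)]
    exact hφ σ f hσ
  | succ r ih =>
    have hk : k < E.m := by omega
    obtain ⟨hS, h8, h10, hA⟩ := readEdge_spec hw hσ hk
    have h6w : 6 ≤ 2 ^ w := by
      have := hw.width_lt
      have hd : 3 * E.m + E.n + 1 = E.width := rfl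
      omega
    have := cost_readEdges
    refine (failProb_le_of_le (s := t + 1 + 200 * r + storeEdge.cost + 1 + 1 + readEdge.cost + 1 + 1)
      (by omega) _).trans ?_
    rw [readEdges, failProb_whileLt_of_lt (by rw [hσ.r18, hσ.ready.r1]; exact hk), failProb_seq]
    refine (failProb_straight straight_readEdge _ _ _).trans ?_
    rw [failProb_seq, failProb_rand_six ((hA 4 (by decide)).trans hσ.ready.r4) h6w,
      List.range'_succ, resampleAll_cons, resample]
    refine ENNReal.div_le_div_right (Finset.sum_le_sum fun c hc => ?_) _
    refine (failProb_straight straight_storeEdge _ _ _).trans ?_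
    have hA₁ := hA.trans (AgreeOff_set (readEdge.exec w σ) 12 c)
    refine ih (by omega) (storeEdge_spec hw hk (hσ.ready.of_agreeOff hA₁ (by decide)) hS
      ((hA₁ 6 (by decide)).trans hσ.r6) ((hA₁ 7 (by decide)).trans hσ.r7)
      ((hA₁ 18 (by decide)).trans hσ.r18) ?_ ?_ (by simp [Store.reg_set]) (Finset.mem_range.1 hc)
      hσ.col_lt)
    · simpa [Store.reg_set] using h8
    · simpa [Store.reg_set] using h10

/-- The stack at the start of the main loop. -/
def fullStack (E : EdgeArray) : List ℕ := (List.range E.n).reverse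

theorem pushTop_spec (hw : E.WordSize w) (hσ : E.Holds σ (List.range k).reverse f)
    (hk : k < E.n) :
    E.Holds (pushTop.exec w σ) (List.range (k + 1)).reverse f ∧
      AgreeOff [6, 14] σ (pushTop.exec w σ) := by
  have hwd := hw.width_lt
  have hd : 3 * E.m + E.n + 1 = E.width := rfl
  have hR := hσ.ready
  have h6 : σ.reg 6 = k := by simpa using hσ.top
  obtain ⟨stk, hstk, hS⟩ := hσ.stored
  have e : pushTop.exec w σ = Store.set ⟨update σ.reg 14 (E.cell 3 k),
      update (update σ.mem (E.cell 2 k) 1) (E.cell 3 k) k⟩ 6 (k + 1) := by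
    rw [pushTop, exec_seq, exec_writeCell hw hR.r3 (by decide) (by decide) (by decide)
      (by rw [hR.r19]; omega) (by omega) (by rw [hR.r2]; omega), exec_seq,
      exec_writeCell hw (by simp [hR.r3]) (by decide) (by decide) (by decide)
      (by simp [hR.r19]) (by simp [h6, hk]) (by simp [h6]; omega),
      exec_add (x := k + 1) (by simp [h6, hR.r2]) (by omega)]
    simp [hR.r19, hR.r2, h6]
  rw [e]
  have hrange : (List.range (k + 1)).reverse = k :: (List.range k).reverse := by
    rw [List.range_succ, List.reverse_append]; rfl
  have hlen : (List.range k).reverse.length = k := by simp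
  rw [hrange]
  have hA : AgreeOff [6, 14] σ (Store.set ⟨update σ.reg 14 (E.cell 3 k),
      update (update σ.mem (E.cell 2 k) 1) (E.cell 3 k) k⟩ 6 (k + 1)) := fun r hr => by
    simp only [List.mem_cons, List.not_mem_nil, or_false, not_or] at hr
    simp [Store.reg_set, hr]
  refine ⟨⟨hR.of_agreeOff hA (by decide), by simp [Store.reg_set],
    ⟨update stk k k, ⟨by simp, hstk.congr fun i hi => update_of_ne (by omega) _ _⟩, ?_⟩,
    hσ.nodup.cons (by simp), fun u hu => ?_, hσ.col_lt⟩, hA⟩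
  · have := (hS.setFlag (x := 1) hk).setStk (x := k) hk
    refine this.congr (fun _ _ => rfl) (fun _ _ => rfl) (fun u _ => ?_)
      (fun _ _ => rfl) (fun _ _ _ _ => rfl) (fun _ _ _ => rfl)
    simp only [Tables.setStk, Tables.setFlag, tables, update_apply, List.mem_cons]
    by_cases huk : u = k <;> simp [huk]
  · rcases List.mem_cons.1 hu with rfl | hu
    · exact hk
    · exact hσ.lt u hu

theorem failProb_fillStack (hw : E.WordSize w) {r : ℕ} (hr : k + r = E.n)
    (hσ : E.Holds σ (List.range k).reverse f) (h7 : σ.reg 7 = 0) :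
    ∃ σ', E.Holds σ' E.fullStack f ∧ σ'.reg 7 = 0 ∧
      failProb w Q (t + 1 + 40 * r) ⟨fillStack :: K, σ⟩ ≤ failProb w Q t ⟨K, σ'⟩ := by
  induction r generalizing k σ with
  | zero =>
    obtain rfl : k = E.n := hr
    refine ⟨σ, hσ, h7, ?_⟩
    rw [mul_zero, add_zero, fillStack,
      failProb_whileLt_of_not_lt (by rw [hσ.top, hσ.ready.r0]; simp)]
  | succ r ih =>
    have hk : k < E.n := by omega
    obtain ⟨hH, hA⟩ := pushTop_spec hw hσ hk
    obtain ⟨σ', h1, h2, h3⟩ := ih (by omega) hH ((hA 7 (by decide)).trans h7)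
    refine ⟨σ', h1, h2, le_trans ?_ h3⟩
    have hc : pushTop.cost + 1 ≤ 40 := by simp [pushTop, writeCell, rowAddr, cost]
    refine (failProb_le_of_le (s := t + 1 + 40 * r + pushTop.cost + 1) (by omega) _).trans ?_
    rw [fillStack, failProb_whileLt_of_lt (by rw [hσ.top, hσ.ready.r0]; simpa using hk)]
    exact failProb_straight (by simp [pushTop, writeCell, rowAddr, Straight]) _ _ _

theorem Reading.holds (h : E.Reading σ E.m f) : E.Holds σ (List.range 0).reverse f :=
  ⟨h.ready, h.r6, ⟨fun _ => 0, trivial, h.stored.congr (fun _ _ => rfl) (fun _ _ => rfl)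
    (fun _ _ => by simp [partialTables, tables]) (fun _ _ => rfl) (fun _ _ _ _ => rfl)
    (fun _ _ _ => rfl)⟩, List.nodup_nil, by simp, h.col_lt⟩

/-- The program up to the main loop. -/
theorem failProb_colorBlind (hw : E.WordSize w) (hσ : E.IsInput σ) {φ : (ℕ → ℕ) → ℝ≥0∞}
    (hφ : ∀ σ' f', E.Scanning σ' E.fullStack 0 f' → failProb w Q t ⟨[mainLoop], σ'⟩ ≤ φ f') :
    failProb w Q (t + 100 + 200 * E.m + 40 * E.n) ⟨[colorBlind], σ⟩ ≤
      resampleAll (List.range E.m) φ 0 := by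
  have hc : loadConstants.cost + 5 ≤ 100 := by simp [loadConstants, cost]
  refine (failProb_le_of_le (s := t + 1 + 40 * E.n + 1 + 1 + 200 * E.m + 1 + loadConstants.cost + 1)
    (by omega) _).trans ?_
  rw [colorBlind, failProb_seq]
  refine (failProb_straight (by simp [loadConstants, Straight]) _ _ _).trans ?_
  rw [failProb_seq, show t + 1 + 40 * E.n + 1 + 1 + 200 * E.m =
    (t + 1 + 40 * E.n + 1) + 1 + 200 * E.m by ring, List.range_eq_range']
  refine failProb_readEdges hw (zero_add _) (loadConstants_spec hw hσ) fun σ' f' h => ?_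
  rw [failProb_seq]
  obtain ⟨σ₁, h1, h2, h3⟩ := failProb_fillStack (Q := Q) (K := [mainLoop]) (t := t) hw
    (zero_add _) h.holds h.r7
  -- Initially all vertices are on the stack, so conflicts are covered whatever the colouring is.
  refine h3.trans (hφ σ₁ f' ⟨h1, h2, fun j hj _ => Or.inl ?_, fun u _ =>
    ⟨Nat.zero_le _, fun k hk => absurd hk (Nat.not_lt_zero k)⟩⟩)
  simpa [fullStack] using E.a_lt j hj

end EdgeArray

/-! ### Exponential decay of the mean probability of failure. -/

namespace EdgeArray

open WordRAM.Program Function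

variable (E : EdgeArray)

/-- The worst probability of failure after `t` steps of the main loop from the stack `L`, the
number `i` of the next neighbour and the colouring `f`. -/
noncomputable def worstFail (w t : ℕ) (L : List ℕ) (i : ℕ) (f : ℕ → ℕ) : ℝ≥0∞ :=
  ⨆ σ, ⨆ _ : E.Scanning σ L i f, failProb w E.Solved t ⟨[mainLoop], σ⟩

/-- The average of the worst probability of failure over all colourings. -/
noncomputable def meanFail (w t : ℕ) (L : List ℕ) (i : ℕ) : ℝ≥0∞ :=
  resampleAll (List.range E.m) (E.worstFail w t L i) 0

/-- The number of iterations of the main loop for the stack `L` if there are no conflicts. -/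
def weight (L : List ℕ) : ℕ := (L.map fun u => E.deg u + 1).sum

variable {E} {w : ℕ} {L : List ℕ} {i v t : ℕ}

theorem meanFail_le_one : E.meanFail w t L i ≤ 1 := by
  refine (resampleAll_mono _ (ψ := fun _ => 1) (fun f => ?_) _).trans_eq
    (by rw [resampleAll_const])
  exact iSup₂_le fun σ _ => failProb_le_one _ _

theorem meanFail_nil : E.meanFail w (t + 1) [] i = 0 := by
  refine le_antisymm ((resampleAll_mono _ (ψ := fun _ => 0) (fun f => ?_) _).trans_eq
    (by rw [resampleAll_const])) zero_le
  exact iSup₂_le fun σ hσ => (failProb_mainLoop_of_nil hσ).le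

theorem meanFail_pop (hw : E.WordSize w) :
    E.meanFail w (t + 400) (v :: L) (E.deg v) ≤ E.meanFail w t L 0 := by
  refine resampleAll_mono _ (fun f => iSup₂_le fun σ hσ => ?_) _
  obtain ⟨σ', hσ', h⟩ := failProb_mainLoop_pop (Q := E.Solved) (K := []) (t := t) hw hσ
  exact h.trans (le_iSup₂_of_le σ' hσ' le_rfl)

/-- The recursion behind the time bound. The branch without conflict is bounded by dropping its
indicator, so that it too is averaged over uniform colourings; the conflict branch gains the factor
p by self-adjointness. -/
theorem meanFail_scan (hw : E.WordSize w) (hi : i < E.deg v) {Δ : ℕ} (hΔ : E.deg v ≤ Δ)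
    {p : ℝ≥0∞} (hp : ∀ f, resampleAll (E.star E.m v) (fun g => if E.key g v =
      E.key g (E.other v ((E.star E.m v).getD i 0)) then 1 else 0) f ≤ p) :
    E.meanFail w (t + (400 + 200 * Δ)) (v :: L) i ≤
      E.meanFail w (t + 200 * Δ) (v :: L) (i + 1) +
        p * E.meanFail w t (E.pushNeighbors v (v :: L)) 0 := by
  set φ : (ℕ → ℕ) → ℝ≥0∞ := fun g => if E.key g v =
    E.key g (E.other v ((E.star E.m v).getD i 0)) then 1 else 0 with hφ
  set ψ := E.worstFail w t (E.pushNeighbors v (v :: L)) 0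
  calc E.meanFail w (t + (400 + 200 * Δ)) (v :: L) i
      ≤ resampleAll (List.range E.m) (fun f => E.worstFail w (t + 200 * Δ) (v :: L) (i + 1) f +
          φ f * resampleAll (E.star E.m v) ψ f) 0 := by
        refine resampleAll_mono _ (fun f => iSup₂_le fun σ hσ => ?_) _
        by_cases hkey : E.key f v = E.key f (E.other v ((E.star E.m v).getD i 0))
        · refine le_trans ?_ le_add_self
          have hone : φ f = 1 := if_pos hkey
          rw [hone, one_mul]
          refine (failProb_le_of_le (s := t + 400 + 200 * E.deg v) (by omega) _).trans
            (failProb_mainLoop_recolor hw hσ hi hkey fun σ' f' hσ' => ?_)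
          exact le_iSup₂_of_le (f := fun σ _ => failProb w E.Solved t ⟨[mainLoop], σ⟩) σ' hσ' le_rfl
        · refine le_trans ?_ le_self_add
          obtain ⟨σ', hσ', h⟩ := failProb_mainLoop_next (Q := E.Solved) (K := [])
            (t := t + 200 * Δ) hw hσ hi hkey
          exact (failProb_le_of_le (by omega) _).trans
            (h.trans (le_iSup₂_of_le σ' hσ' le_rfl))
    _ = E.meanFail w (t + 200 * Δ) (v :: L) (i + 1) +
          resampleAll (List.range E.m) (fun f => φ f * resampleAll (E.star E.m v) ψ f) 0 := by
        rw [resampleAll_add]; rfl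
    _ ≤ _ := by
        gcongr
        -- Move the average from the future failure ψ to the indicator of the conflict, where it is
        -- at most p.
        rw [resampleAll_mul_resampleAll fun j hj => List.mem_range.2 (mem_star.1 hj).1]
        have e : p * E.meanFail w t (E.pushNeighbors v (v :: L)) 0 =
            resampleAll (List.range E.m) (fun f => p * ψ f) 0 := by
          rw [resampleAll_const_mul]; rfl
        rw [e]
        exact resampleAll_mono _ (fun f => mul_le_mul_left (hp f) _) _

theorem weight_insert_le (L : List ℕ) {x Δ : ℕ} (hx : E.deg x ≤ Δ) :
    E.weight (L.insert x) ≤ E.weight L + (Δ + 1) := by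
  by_cases h : x ∈ L
  · rw [List.insert_of_mem h]; exact Nat.le_add_right _ _
  · rw [List.insert_of_not_mem h, weight, List.map_cons, List.sum_cons, weight]; omega

theorem foldl_insert_spec {l : List ℕ} {g : ℕ → ℕ} {Δ : ℕ} (hg : ∀ j ∈ l, g j < E.n)
    (hΔ : ∀ u < E.n, E.deg u ≤ Δ) (hL : ∀ u ∈ L, u < E.n) :
    (∀ u ∈ l.foldl (fun L j => L.insert (g j)) L, u < E.n) ∧
      E.weight (l.foldl (fun L j => L.insert (g j)) L) ≤ E.weight L + l.length * (Δ + 1) := by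
  refine ⟨fun u hu => ?_, ?_⟩
  · rcases mem_foldl_insert.1 hu with h | ⟨j, hj, rfl⟩
    · exact hL u h
    · exact hg j hj
  · clear hL
    induction l generalizing L with
    | nil => simp
    | cons j l ih =>
      refine (ih fun k hk => hg k (List.mem_cons_of_mem j hk)).trans ?_
      have := weight_insert_le L (hΔ _ (hg j List.mem_cons_self))
      rw [List.length_cons, add_mul]
      dsimp only
      omega

/-- The exponential bound for the probability of failure. -/
theorem meanFail_le (hw : E.WordSize w) {Δ : ℕ} (hΔ : ∀ u < E.n, E.deg u ≤ Δ) {p β : ℝ}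
    (hp0 : 0 ≤ p) (hβ : 0 ≤ β)
    (hp : ∀ v < E.n, ∀ j ∈ E.star E.m v, ∀ f, resampleAll (E.star E.m v)
      (fun g => if E.key g v = E.key g (E.other v j) then 1 else 0) f ≤ ENNReal.ofReal p)
    (hpβ : Real.exp (-(400 * β)) +
      p * Real.exp (β * (800 * (Δ + 1) ^ 2 + (400 + 200 * Δ))) ≤ 1)
    (hL : ∀ u ∈ L, u < E.n) (hi : i ≤ L.head?.elim 0 E.deg) :
    E.meanFail w t L i ≤ ENNReal.ofReal
      (Real.exp (β * (800 * ((E.weight L : ℝ) - i) - (t - (400 + 200 * Δ))))) := by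
  induction t using Nat.strong_induction_on generalizing L i with
  | _ t ih =>
  have hx0 : (0 : ℝ) ≤ (E.weight L : ℝ) - i := by
    have : i ≤ E.weight L := by
      refine hi.trans ?_
      cases L with
      | nil => exact Nat.zero_le _
      | cons v L =>
        rw [weight, List.map_cons, List.sum_cons]
        simp only [List.head?_cons, Option.elim_some]
        omega
    exact sub_nonneg.2 (Nat.cast_le.2 this)
  rcases lt_or_ge t (400 + 200 * Δ) with ht | ht
  -- For small t the exponent is nonnegative and the bound is trivial.
  · refine meanFail_le_one.trans ?_
    rw [← ENNReal.ofReal_one]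
    refine ENNReal.ofReal_le_ofReal (Real.one_le_exp (mul_nonneg hβ ?_))
    have : (t : ℝ) ≤ 400 + 200 * Δ := by exact_mod_cast ht.le
    linarith
  obtain ⟨s, rfl⟩ := Nat.exists_eq_add_of_le' ht
  cases L with
  | nil =>
    rw [show s + (400 + 200 * Δ) = s + 399 + 200 * Δ + 1 by ring, meanFail_nil]
    exact zero_le
  | cons v L =>
    have hv := hL v List.mem_cons_self
    have hL' : ∀ u ∈ L, u < E.n := fun u hu => hL u (List.mem_cons_of_mem v hu)
    have hwt : E.weight (v :: L) = E.deg v + 1 + E.weight L := by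
      rw [weight, List.map_cons, List.sum_cons, weight]
    simp only [List.head?_cons, Option.elim_some] at hi
    rcases hi.lt_or_eq with hi | rfl
    swap
    -- A pop uses 400 steps and reduces weight minus index by exactly 1, which is worth 800.
    · rw [show s + (400 + 200 * Δ) = s + 200 * Δ + 400 by ring]
      refine (meanFail_pop hw).trans ((ih _ (by omega) hL' (Nat.zero_le _)).trans ?_)
      refine ENNReal.ofReal_le_ofReal (Real.exp_le_exp.2 (mul_le_mul_of_nonneg_left ?_ hβ))
      rw [hwt]
      push_cast
      linarith
    · have hd := hΔ v hv
      have hstep := meanFail_scan (L := L) (t := s) hw hi hd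
        (hp v hv _ (getD_star_mem hi))
      have hspec := foldl_insert_spec (E := E) (L := v :: L) (l := E.star E.m v) (g := E.other v)
        (fun j hj => (other_spec hj).1) hΔ hL
      have h1 := ih (s + 200 * Δ) (by omega) hL (i := i + 1) (by simpa using hi)
      have h2 := ih s (by omega) (L := E.pushNeighbors v (v :: L)) hspec.1 (Nat.zero_le _)
      refine hstep.trans ((add_le_add h1 (mul_le_mul_right h2 _)).trans ?_)
      rw [← ENNReal.ofReal_mul hp0, ← ENNReal.ofReal_add (Real.exp_pos _).le
        (mul_nonneg hp0 (Real.exp_pos _).le)]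
      refine ENNReal.ofReal_le_ofReal ?_
      set X := Real.exp (β * (800 * ((E.weight (v :: L) : ℝ) - i) -
        (((s + (400 + 200 * Δ) : ℕ) : ℝ) - (400 + 200 * Δ)))) with hX
      -- Advancing the index is worth 800 and costs 400 steps, so the exponent drops by 400β.
      have e1 : Real.exp (β * (800 * ((E.weight (v :: L) : ℝ) - ((i + 1 : ℕ) : ℝ)) -
          (((s + 200 * Δ : ℕ) : ℝ) - (400 + 200 * Δ)))) = X * Real.exp (-(400 * β)) := by
        rw [hX, ← Real.exp_add]
        push_cast
        ring_nf
      -- A recolouring adds at most Δ(Δ+1) to the weight and forfeits an index of at most Δ,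
      -- together at most (Δ+1)².
      have e2 : Real.exp (β * (800 * ((E.weight (E.pushNeighbors v (v :: L)) : ℝ) - ((0 : ℕ) : ℝ)) -
          ((s : ℝ) - (400 + 200 * Δ)))) ≤
          X * Real.exp (β * (800 * (Δ + 1) ^ 2 + (400 + 200 * Δ))) := by
        rw [hX, ← Real.exp_add, Real.exp_le_exp, ← mul_add]
        refine mul_le_mul_of_nonneg_left ?_ hβ
        have h3 : E.weight (E.pushNeighbors v (v :: L)) ≤ E.weight (v :: L) + Δ * (Δ + 1) :=
          hspec.2.trans (Nat.add_le_add_left (Nat.mul_le_mul_right _ hd) _)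
        have h4 : (E.weight (E.pushNeighbors v (v :: L)) : ℝ) ≤
            E.weight (v :: L) + Δ * (Δ + 1) := by exact_mod_cast h3
        have h5 : (i : ℝ) ≤ Δ := by exact_mod_cast hi.le.trans hd
        push_cast
        nlinarith
      rw [e1]
      calc _ ≤ X * Real.exp (-(400 * β)) +
            p * (X * Real.exp (β * (800 * (Δ + 1) ^ 2 + (400 + 200 * Δ)))) := by gcongr
        _ = X * (Real.exp (-(400 * β)) +
            p * Real.exp (β * (800 * (Δ + 1) ^ 2 + (400 + 200 * Δ)))) := by ring
        _ ≤ X * 1 := by gcongr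
        _ = X := mul_one X

theorem weight_fullStack : E.weight E.fullStack = 2 * E.m + E.n := by
  have h := E.sum_length_star (k := E.m) le_rfl
  have : E.weight E.fullStack = ∑ u ∈ Finset.range E.n, (E.deg u + 1) := by
    rw [weight, fullStack, List.map_reverse, List.sum_reverse]
    rfl
  rw [this, Finset.sum_add_distrib]
  simp only [deg, h]
  simp

/-- The exponential bound for the probability that the program fails. -/
theorem failProb_colorBlind_le (hw : E.WordSize w) {σ : Store} (hσ : E.IsInput σ) {Δ : ℕ}
    (hΔ : ∀ u < E.n, E.deg u ≤ Δ) {p β : ℝ} (hp0 : 0 ≤ p) (hβ : 0 ≤ β)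
    (hp : ∀ v < E.n, ∀ j ∈ E.star E.m v, ∀ f, resampleAll (E.star E.m v)
      (fun g => if E.key g v = E.key g (E.other v j) then 1 else 0) f ≤ ENNReal.ofReal p)
    (hpβ : Real.exp (-(400 * β)) +
      p * Real.exp (β * (800 * (Δ + 1) ^ 2 + (400 + 200 * Δ))) ≤ 1) :
    failProb w E.Solved (t + 100 + 200 * E.m + 40 * E.n) ⟨[colorBlind], σ⟩ ≤ ENNReal.ofReal
      (Real.exp (β * (800 * (2 * E.m + E.n) - (t - (400 + 200 * Δ))))) := by
  refine (failProb_colorBlind hw hσ (φ := E.worstFail w t E.fullStack 0) fun σ' f' h =>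
    le_iSup₂_of_le (f := fun σ _ => failProb w E.Solved t ⟨[mainLoop], σ⟩) σ' h le_rfl).trans ?_
  refine (meanFail_le hw hΔ hp0 hβ hp hpβ (L := E.fullStack) (i := 0) (t := t) ?_
    (Nat.zero_le _)).trans_eq ?_
  · simp [fullStack]
  · rw [weight_fullStack]
    push_cast
    rw [sub_zero]

end EdgeArray

/-! ### The choice of the rate and of the lower bound for δ. -/

section Estimates

open Real

variable {R : ℝ} {δ Δ n m : ℕ}

/-- The rate of the exponential bound. -/
noncomputable def decayRate (δ Δ : ℕ) : ℝ := log δ / (4800 * ((Δ : ℝ) + 1) ^ 2)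

/-- From exp x ≥ 1 + x and (1 - x/2)(1 + x) ≥ 1 on [0, 1]. -/
theorem exp_neg_le_one_sub_half {x : ℝ} (h0 : 0 ≤ x) (h1 : x ≤ 1) : exp (-x) ≤ 1 - x / 2 := by
  have h2 : 1 + x ≤ exp x := by linarith [add_one_le_exp x]
  have h3 : exp (-x) * exp x = 1 := by rw [← exp_add]; simp
  have h4 : 1 ≤ (1 - x / 2) * (1 + x) := by nlinarith
  have h5 : 1 ≤ (1 - x / 2) * exp x :=
    h4.trans (mul_le_mul_of_nonneg_left h2 (by linarith))
  nlinarith [exp_pos x, exp_pos (-x)]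

/-- A scan without conflict gains 200β. The loss by recolouring is p times an exponential that β
keeps below δ^(1/4), hence at most of order δ^(-9/4), whereas β is at least of order 1/(R²δ²). The
spare δ^(1/4) absorbs R² and the constants. -/
theorem decayRate_spec (hR : 1 ≤ R) (hδ : (6291456 * R ^ 2) ^ 4 ≤ (δ : ℝ)) (hδΔ : δ ≤ Δ)
    (hΔ : (Δ : ℝ) ≤ R * δ) :
    exp (-(400 * decayRate δ Δ)) + 720 * ((δ : ℝ) / 6) ^ (-(5 / 2) : ℝ) *
      exp (decayRate δ Δ * (800 * ((Δ : ℝ) + 1) ^ 2 + (400 + 200 * Δ))) ≤ 1 := by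
  have hA : 6291456 ≤ 6291456 * R ^ 2 := by nlinarith
  have hδ4 : (6291456 : ℝ) ^ 4 ≤ δ := (pow_le_pow_left₀ (by norm_num) hA 4).trans hδ
  have hδ3 : (3 : ℝ) ≤ δ := le_trans (by norm_num) hδ4
  have hδ0 : (0 : ℝ) < δ := by linarith
  have hlog1 : 1 ≤ log δ := by
    rw [le_log_iff_exp_le hδ0]
    linarith [exp_one_lt_d9]
  have hlogδ : log δ ≤ δ := (log_le_sub_one_of_pos hδ0).trans (by linarith)
  have hδΔ' : (δ : ℝ) ≤ Δ := by exact_mod_cast hδΔ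
  set D : ℝ := ((Δ : ℝ) + 1) ^ 2 with hD
  have hD0 : 0 < D := by positivity
  have hDΔ : (Δ : ℝ) + 1 ≤ D := by rw [hD]; nlinarith
  have hβ : decayRate δ Δ * (4800 * D) = log δ := by
    rw [decayRate, ← hD]; field_simp
  set β := decayRate δ Δ
  have hβ0 : 0 < β := by
    by_contra h
    nlinarith [mul_nonneg (neg_nonneg.2 (not_lt.1 h)) (by positivity : 0 ≤ 4800 * D)]
  -- The exponent is at most 1200β(Δ+1)², which is log δ / 4 by the choice of β.
  have hexp : exp (β * (800 * D + (400 + 200 * Δ))) ≤ (δ : ℝ) ^ (1 / 4 : ℝ) := by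
    rw [rpow_def_of_pos hδ0, exp_le_exp, ← hβ]
    have : β * (800 * D + (400 + 200 * Δ)) ≤ β * (1200 * D) :=
      mul_le_mul_of_nonneg_left (by linarith) hβ0.le
    linarith
  have hx1 : 400 * β ≤ 1 := by
    have : 400 * β * (12 * D) ≤ 1 * (12 * D) := by
      calc 400 * β * (12 * D) = log δ := by rw [← hβ]; ring
        _ ≤ _ := by linarith
    exact le_of_mul_le_mul_right this (by positivity)
  have h1 := exp_neg_le_one_sub_half (by positivity : 0 ≤ 400 * β) hx1
  -- Rounding: 720 · 89 ≤ 65536.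
  have h6 : (6 : ℝ) ^ (5 / 2 : ℝ) ≤ 89 := by
    refine le_of_sq_le_sq ?_ (by norm_num)
    rw [← rpow_natCast, ← rpow_mul (by norm_num)]
    norm_num
  have hp : 720 * ((δ : ℝ) / 6) ^ (-(5 / 2) : ℝ) ≤ 65536 * (δ : ℝ) ^ (-(5 / 2) : ℝ) := by
    rw [div_rpow hδ0.le (by norm_num), rpow_neg (by norm_num : (0 : ℝ) ≤ 6), div_inv_eq_mul]
    have : 0 < (δ : ℝ) ^ (-(5 / 2) : ℝ) := rpow_pos_of_pos hδ0 _
    nlinarith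
  have hroot : 6291456 * R ^ 2 ≤ (δ : ℝ) ^ (1 / 4 : ℝ) := by
    calc 6291456 * R ^ 2 = ((6291456 * R ^ 2) ^ 4) ^ (1 / 4 : ℝ) := by
          rw [← rpow_natCast (6291456 * R ^ 2) 4, ← rpow_mul (by positivity)]; norm_num
      _ ≤ _ := rpow_le_rpow (by positivity) hδ (by norm_num)
  have hr0 : 0 < (δ : ℝ) ^ (1 / 4 : ℝ) := rpow_pos_of_pos hδ0 _
  have hDle : D ≤ 4 * R ^ 2 * δ ^ 2 := by
    have : (Δ : ℝ) + 1 ≤ 2 * R * δ := by nlinarith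
    calc D ≤ (2 * R * δ) ^ 2 := by rw [hD]; gcongr
      _ = _ := by ring
  have hpow : (δ : ℝ) ^ (-(5 / 2) : ℝ) * (δ : ℝ) ^ (1 / 4 : ℝ) * ((δ : ℝ) ^ (1 / 4 : ℝ) * δ ^ 2) = 1 := by
    rw [← rpow_natCast (δ : ℝ) 2, ← rpow_add hδ0, ← rpow_add hδ0, ← rpow_add hδ0]
    norm_num
  set y := (δ : ℝ) ^ (-(5 / 2) : ℝ) * (δ : ℝ) ^ (1 / 4 : ℝ) with hy
  have hy0 : 0 < y := mul_pos (rpow_pos_of_pos hδ0 _) hr0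
  -- Multiplied by 24(Δ+1)², the right side is log δ ≥ 1. On the left, (Δ+1)² ≤ 4R²δ² gives 65536 ·
  -- 24 · 4 = 6291456, the constant in the hypothesis on δ.
  have h2 : 65536 * y ≤ 200 * β := by
    have : 65536 * y * (24 * D) ≤ 200 * β * (24 * D) := by
      calc 65536 * y * (24 * D) ≤ 65536 * y * (24 * (4 * R ^ 2 * δ ^ 2)) := by gcongr
        _ = y * ((6291456 * R ^ 2) * δ ^ 2) := by ring
        _ ≤ y * ((δ : ℝ) ^ (1 / 4 : ℝ) * δ ^ 2) := by gcongr
        _ = 1 := hpow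
        _ ≤ log δ := hlog1
        _ = _ := by rw [← hβ]; ring
    exact le_of_mul_le_mul_right this (by positivity)
  have h3 : 720 * ((δ : ℝ) / 6) ^ (-(5 / 2) : ℝ) * exp (β * (800 * D + (400 + 200 * Δ))) ≤
      65536 * y := by
    calc _ ≤ 65536 * (δ : ℝ) ^ (-(5 / 2) : ℝ) * (δ : ℝ) ^ (1 / 4 : ℝ) := by gcongr
      _ = _ := by rw [hy]; ring
  linarith

/-- With |E| ≥ nδ/2 this compares (log n)(Δ+1)² with (log δ) nδ(1+Δ-δ). If Δ ≤ 2δ, it holds because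
log x / x decreases. Otherwise 1+Δ-δ is comparable to Δ, and R log n ≤ 2n suffices; this is why C
does not depend on R. -/
theorem log_le_decayRate_mul (hR : 1 ≤ R) (hδ : (6291456 * R ^ 2) ^ 4 ≤ (δ : ℝ)) (hδΔ : δ ≤ Δ)
    (hΔ : (Δ : ℝ) ≤ R * δ) (hn : Δ + 1 ≤ n) (hm : n * δ ≤ 2 * m) :
    log n ≤ decayRate δ Δ * (100000 * (m * (1 + ((Δ : ℝ) - δ)))) := by
  have hA : 6291456 ≤ 6291456 * R ^ 2 := by nlinarith
  have hδ4 : (6291456 : ℝ) ^ 4 ≤ δ := (pow_le_pow_left₀ (by norm_num) hA 4).trans hδ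
  have hδ3 : (3 : ℝ) ≤ δ := le_trans (by norm_num) hδ4
  have hδ0 : (0 : ℝ) < δ := by linarith
  have hlog1 : 1 ≤ log δ := by
    rw [le_log_iff_exp_le hδ0]
    linarith [exp_one_lt_d9]
  have hδΔ' : (δ : ℝ) ≤ Δ := by exact_mod_cast hδΔ
  have hn' : (Δ : ℝ) + 1 ≤ n := by exact_mod_cast hn
  have hm' : (n : ℝ) * δ ≤ 2 * m := by exact_mod_cast hm
  have hn0 : (0 : ℝ) < n := by linarith
  have hD0 : 0 < ((Δ : ℝ) + 1) ^ 2 := by positivity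
  suffices h : log n * ((Δ : ℝ) + 1) ^ 2 ≤
      log δ * (10 * (n * δ * (1 + ((Δ : ℝ) - δ)))) by
    have h' : log n ≤ log δ * (10 * (n * δ * (1 + ((Δ : ℝ) - δ)))) / ((Δ : ℝ) + 1) ^ 2 :=
      (le_div_iff₀ hD0).2 h
    refine h'.trans ?_
    rw [decayRate, div_mul_eq_mul_div, div_le_div_iff₀ hD0 (by positivity)]
    -- Here 10 · 4800 · 2 = 96000 is rounded up to 100000.
    have : 10 * (n * δ * (1 + ((Δ : ℝ) - δ))) * 4800 ≤ 100000 * (m * (1 + ((Δ : ℝ) - δ))) := by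
      have : n * δ * (1 + ((Δ : ℝ) - δ)) ≤ 2 * m * (1 + ((Δ : ℝ) - δ)) :=
        mul_le_mul_of_nonneg_right hm' (by linarith)
      have hpos : 0 ≤ (m : ℝ) * (1 + ((Δ : ℝ) - δ)) := by
        refine mul_nonneg (Nat.cast_nonneg _) (by linarith)
      linarith
    calc _ = (10 * (n * δ * (1 + ((Δ : ℝ) - δ))) * 4800) * (log δ * ((Δ : ℝ) + 1) ^ 2) := by ring
      _ ≤ (100000 * (m * (1 + ((Δ : ℝ) - δ)))) * (log δ * ((Δ : ℝ) + 1) ^ 2) := by gcongr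
      _ = _ := by ring
  rcases le_or_gt (Δ : ℝ) (2 * δ) with hc | hc
  · have hanti : log n * δ ≤ log δ * n := by
      have := log_div_self_antitoneOn (a := (δ : ℝ)) (b := n)
        (show exp 1 ≤ (δ : ℝ) by linarith [exp_one_lt_d9])
        (show exp 1 ≤ (n : ℝ) by linarith [exp_one_lt_d9]) (by linarith)
      rwa [div_le_div_iff₀ hn0 hδ0] at this
    have hlogn : 0 ≤ log n := log_nonneg (by linarith)
    have hsq : ((Δ : ℝ) + 1) ^ 2 ≤ 10 * δ * (1 + (Δ - δ)) * δ := by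
      have h1 : (Δ : ℝ) + 1 ≤ 3 * δ := by linarith
      have h2 : ((Δ : ℝ) + 1) ^ 2 ≤ 9 * δ * δ := by nlinarith
      nlinarith [mul_pos hδ0 hδ0]
    calc log n * ((Δ : ℝ) + 1) ^ 2 ≤ log n * (10 * δ * (1 + (Δ - δ)) * δ) := by gcongr
      _ = (log n * δ) * (10 * δ * (1 + ((Δ : ℝ) - δ))) := by ring
      _ ≤ (log δ * n) * (10 * δ * (1 + ((Δ : ℝ) - δ))) := by
          refine mul_le_mul_of_nonneg_right hanti ?_
          have : 0 ≤ (Δ : ℝ) - δ := by linarith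
          positivity
      _ = _ := by ring
  · have h1 : ((Δ : ℝ) + 1) / 2 ≤ 1 + (Δ - δ) := by linarith
    have h2 : (Δ : ℝ) + 1 ≤ 2 * R * δ := by nlinarith
    -- The lower bound on δ exceeds R², and n > Δ ≥ δ.
    have hsqrt : R ≤ √n := by
      refine le_sqrt_of_sq_le ?_
      have : R ^ 2 ≤ (6291456 * R ^ 2) ^ 4 := by
        calc R ^ 2 ≤ 6291456 * R ^ 2 := by nlinarith
          _ ≤ _ := le_self_pow₀ (by linarith) (by norm_num)
      linarith
    have hlogn : log n ≤ 2 * √n := by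
      have h3 : log (√n) ≤ √n := (log_le_sub_one_of_pos (sqrt_pos.2 hn0)).trans (by linarith)
      rw [log_sqrt hn0.le] at h3
      linarith
    have hnn : √n * √n = n := mul_self_sqrt hn0.le
    have h4 : log n * R ≤ 2 * n := by
      calc log n * R ≤ (2 * √n) * √n := by gcongr
        _ = 2 * n := by rw [mul_assoc, hnn]
    have hΔ0 : (0 : ℝ) ≤ Δ := Nat.cast_nonneg _
    calc log n * ((Δ : ℝ) + 1) ^ 2 = log n * ((Δ : ℝ) + 1) * ((Δ : ℝ) + 1) := by ring
      _ ≤ log n * (2 * R * δ) * ((Δ : ℝ) + 1) := by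
          have : 0 ≤ log n := log_nonneg (by linarith)
          gcongr
      _ = (log n * R) * (2 * δ * ((Δ : ℝ) + 1)) := by ring
      _ ≤ (2 * n) * (2 * δ * ((Δ : ℝ) + 1)) := by gcongr
      _ = 1 * (8 * (n * δ * (((Δ : ℝ) + 1) / 2))) := by ring
      _ ≤ log δ * (10 * (n * δ * (1 + ((Δ : ℝ) - δ)))) := by
          have : 0 ≤ (n : ℝ) * δ * (((Δ : ℝ) + 1) / 2) := by positivity
          gcongr
          norm_num

end Estimates

/-! ### Word length and the final tail bound. -/

namespace EdgeArray

variable {E : EdgeArray}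

/-- With N = n + m + 2 the keys are the largest numbers that occur, at most (N⁸)⁶ = N⁴⁸; the
exponent 61 leaves room. -/
theorem wordSize_of_clog_le {w : ℕ} (h : 61 * Nat.clog 2 (E.n + E.m + 2) ≤ w) : E.WordSize w := by
  set N := E.n + E.m + 2 with hN
  have h2 : 2 ≤ N := by omega
  have hm : E.m ≤ N := by omega
  have hw : N ^ 61 ≤ 2 ^ w := by
    calc N ^ 61 ≤ (2 ^ Nat.clog 2 N) ^ 61 := Nat.pow_le_pow_left (Nat.le_pow_clog one_lt_two _) _
      _ = 2 ^ (61 * Nat.clog 2 N) := by rw [← pow_mul, mul_comm]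
      _ ≤ _ := Nat.pow_le_pow_right two_pos h
  constructor
  · have h1 : E.width ≤ 3 * N := by unfold width; omega
    have h3 : E.m + 11 ≤ 10 * N := by omega
    have h4 : 30 ≤ N ^ 5 := le_trans (by norm_num) (Nat.pow_le_pow_left h2 5)
    calc E.width * (E.m + 11) ≤ 3 * N * (10 * N) := Nat.mul_le_mul h1 h3
      _ = 30 * N ^ 2 := by ring
      _ ≤ N ^ 5 * N ^ 2 := Nat.mul_le_mul_right _ h4
      _ = N ^ 7 := by ring
      _ ≤ N ^ 61 := Nat.pow_le_pow_right (by omega) (by norm_num)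
      _ ≤ _ := hw
  · have h1 : E.m ^ 7 + E.m ≤ N ^ 8 := by
      calc E.m ^ 7 + E.m ≤ N ^ 7 + N ^ 7 :=
            Nat.add_le_add (Nat.pow_le_pow_left hm 7) (hm.trans (Nat.le_self_pow (by norm_num) _))
        _ = 2 * N ^ 7 := by ring
        _ ≤ N * N ^ 7 := Nat.mul_le_mul_right _ h2
        _ = N ^ 8 := by ring
    calc (E.m ^ 7 + E.m) ^ 6 ≤ (N ^ 8) ^ 6 := Nat.pow_le_pow_left h1 6
      _ = N ^ 48 := by rw [← pow_mul]
      _ < N ^ 61 := Nat.pow_lt_pow_right (by omega) (by norm_num)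
      _ ≤ _ := hw

/-- The program fails to find a colouring in time `200000 s m (1 + Δ - δ)` with probability at most
`n ^ (-s)`. -/
theorem failProb_colorBlind_le_inv_pow {R : ℝ} {δ Δ w : ℕ} {σ : Store} (hR : 1 ≤ R)
    (hδ : (6291456 * R ^ 2) ^ 4 ≤ (δ : ℝ)) (hδΔ : δ ≤ Δ) (hΔ : (Δ : ℝ) ≤ R * δ)
    (hdeg : ∀ u < E.n, δ ≤ E.deg u ∧ E.deg u ≤ Δ) (hn : Δ + 1 ≤ E.n) (hw : E.WordSize w)
    (hσ : E.IsInput σ) (s : ℕ) :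
    failProb w E.Solved (200000 * s * (E.m * (1 + (Δ - δ)))) ⟨[Program.colorBlind], σ⟩ ≤
      ((E.n : ℝ≥0∞) ^ s)⁻¹ := by
  rcases Nat.eq_zero_or_pos s with rfl | hs
  · simpa using failProb_le_one _ _
  have hA : 6291456 ≤ 6291456 * R ^ 2 := by nlinarith
  have hδ65 : (65 : ℝ) ≤ δ :=
    le_trans (by norm_num) ((pow_le_pow_left₀ (by norm_num) hA 4).trans hδ)
  have hδ65' : 65 ≤ δ := by exact_mod_cast hδ65
  have hsum : E.n * δ ≤ 2 * E.m := by
    rw [← sum_length_star le_rfl]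
    have := Finset.card_nsmul_le_sum (Finset.range E.n) (fun u => (E.star E.m u).length) δ
      fun u hu => (hdeg u (Finset.mem_range.1 hu)).1
    rwa [Finset.card_range, smul_eq_mul] at this
  have hnm : E.n ≤ E.m := by nlinarith
  have hlog := log_le_decayRate_mul hR hδ hδΔ hΔ hn hsum
  have hspec := decayRate_spec hR hδ hδΔ hΔ
  set β := decayRate δ Δ with hβdef
  have hβ : 0 ≤ β := by
    rw [hβdef, decayRate]
    have := Real.log_nonneg (by linarith : (1 : ℝ) ≤ δ)
    positivity
  have hp : ∀ v < E.n, ∀ j ∈ E.star E.m v, ∀ f, resampleAll (E.star E.m v)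
      (fun g => if E.key g v = E.key g (E.other v j) then 1 else 0) f ≤
        ENNReal.ofReal (720 * ((δ : ℝ) / 6) ^ (-(5 / 2) : ℝ)) := by
    intro v hv j hj f
    refine (resampleAll_key_eq_le (by omega) hj f).trans ?_
    rw [ENNReal.ofReal_mul (by norm_num : (0 : ℝ) ≤ 720), ENNReal.ofReal_ofNat]
    refine mul_le_mul' le_rfl (ENNReal.ofReal_le_ofReal ?_)
    have h1 := (hdeg v hv).1
    -- Neither setting aside one edge nor the integer division costs more than the added 1.
    have h2 : δ ≤ 6 * ((E.deg v - 1) / 6 + 1) := by omega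
    have h3 : (δ : ℝ) ≤ 6 * (((E.deg v - 1) / 6 : ℕ) + 1) := by exact_mod_cast h2
    have h4 : (0 : ℝ) < δ / 6 := by linarith
    have h5 : (δ : ℝ) / 6 ≤ ((E.deg v - 1) / 6 : ℕ) + 1 := by linarith
    exact Real.rpow_le_rpow_of_nonpos h4 h5 (by norm_num)
  set T := 200000 * s * (E.m * (1 + (Δ - δ))) with hT
  have hTm : 200000 * E.m ≤ T := by
    rw [hT, mul_assoc]
    refine Nat.mul_le_mul_left _ ?_
    calc E.m = 1 * (E.m * 1) := by ring
      _ ≤ _ := Nat.mul_le_mul hs (Nat.mul_le_mul_left _ (by omega))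
  obtain ⟨t, ht⟩ : ∃ t, T = t + 100 + 200 * E.m + 40 * E.n :=
    ⟨T - (100 + 200 * E.m + 40 * E.n), by omega⟩
  have hmain := failProb_colorBlind_le (t := t) hw hσ (fun u hu => (hdeg u hu).2)
    (by positivity) hβ hp hspec
  rw [← ht] at hmain
  refine hmain.trans ?_
  have hn0 : (0 : ℝ) < E.n := by exact_mod_cast (by omega : 0 < E.n)
  have hle : β * (800 * (2 * E.m + E.n) - (t - (400 + 200 * Δ))) ≤ -(s * Real.log E.n) := by
    have hTr : (T : ℝ) = 200000 * s * (E.m * (1 + ((Δ : ℝ) - δ))) := by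
      rw [hT]; push_cast [Nat.cast_sub hδΔ]; ring
    have hTt : (T : ℝ) = t + 100 + 200 * E.m + 40 * E.n := by exact_mod_cast ht
    have hTm' : 200000 * (E.m : ℝ) ≤ T := by exact_mod_cast hTm
    have hnm' : (E.n : ℝ) ≤ E.m := by exact_mod_cast hnm
    have hn' : (Δ : ℝ) + 1 ≤ E.n := by exact_mod_cast hn
    -- Half of the time T ≥ 200000m pays for the initial weight, the initialisation and the shift,
    -- as n ≤ m and Δ < n.
    have h1 : 800 * (2 * E.m + E.n) - (t - (400 + 200 * Δ)) ≤ -(T / 2 : ℝ) := by linarith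
    calc _ ≤ β * -(T / 2 : ℝ) := mul_le_mul_of_nonneg_left h1 hβ
      _ = -(s * (β * (100000 * (E.m * (1 + ((Δ : ℝ) - δ)))))) := by rw [hTr]; ring
      _ ≤ _ := neg_le_neg (mul_le_mul_of_nonneg_left hlog (Nat.cast_nonneg _))
  refine (ENNReal.ofReal_le_ofReal (Real.exp_le_exp.2 hle)).trans_eq ?_
  rw [Real.exp_neg, ENNReal.ofReal_inv_of_pos (Real.exp_pos _), Real.exp_nat_mul,
    Real.exp_log hn0, ENNReal.ofReal_pow hn0.le, ENNReal.ofReal_natCast]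

end EdgeArray

/-! ### From presentations of simple graphs to edge arrays. -/

namespace SimpleGraph.EdgeListing

variable {V : Type u} [Fintype V] {G : SimpleGraph V} [Fintype G.edgeSet] (I : G.EdgeListing)

theorem adj (j : Fin G.edgeFinset.card) : G.Adj (I.fst j) (I.snd j) := by
  have := (I.edge j).2
  rwa [I.edge_eq, mem_edgeSet] at this

theorem mem_edge {v : V} (j : Fin G.edgeFinset.card) :
    v ∈ (I.edge j : Sym2 V) ↔ (I.num (I.fst j) : ℕ) = I.num v ∨ (I.num (I.snd j) : ℕ) = I.num v := by
  rw [I.edge_eq, Sym2.mem_iff, Fin.val_inj, Fin.val_inj, I.num.injective.eq_iff,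
    I.num.injective.eq_iff, eq_comm, @eq_comm _ v (I.snd j)]

/-- The number of an endpoint of the `j`-th edge. -/
def endpoint (p : Fin G.edgeFinset.card → V) (j : ℕ) : ℕ :=
  if h : j < G.edgeFinset.card then I.num (p ⟨j, h⟩) else 0

variable {I} in
theorem endpoint_of_lt {p : Fin G.edgeFinset.card → V} {j : ℕ} (h : j < G.edgeFinset.card) :
    I.endpoint p j = I.num (p ⟨j, h⟩) := dif_pos h

variable {I} in
theorem endpoint_lt (p : Fin G.edgeFinset.card → V) (j : ℕ) (h : j < G.edgeFinset.card) :
    I.endpoint p j < Fintype.card V := by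
  rw [endpoint_of_lt h]; exact (I.num _).2

/-- The graph on the numbers of the vertices. -/
def toEdgeArray : EdgeArray where
  n := Fintype.card V
  m := G.edgeFinset.card
  a := I.endpoint I.fst
  b := I.endpoint I.snd
  a_lt := endpoint_lt _
  b_lt := endpoint_lt _
  ne j h := by
    rw [endpoint_of_lt h, endpoint_of_lt h, Ne, Fin.val_inj, I.num.injective.eq_iff]
    exact (I.adj _).ne
  simple j hj k hk u v huv h1 h2 h3 h4 := by
    have hu : u < Fintype.card V := by
      rcases h1 with h1 | h1 <;> exact h1 ▸ endpoint_lt _ _ hj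
    have hv : v < Fintype.card V := by
      rcases h2 with h2 | h2 <;> exact h2 ▸ endpoint_lt _ _ hj
    obtain ⟨x, hx⟩ : ∃ x, (I.num x : ℕ) = u := ⟨I.num.symm ⟨u, hu⟩, by simp⟩
    obtain ⟨y, hy⟩ : ∃ y, (I.num y : ℕ) = v := ⟨I.num.symm ⟨v, hv⟩, by simp⟩
    have hxy : x ≠ y := fun h => huv (by rw [← hx, ← hy, h])
    rw [← hx, endpoint_of_lt hj, endpoint_of_lt hj, ← mem_edge] at h1
    rw [← hy, endpoint_of_lt hj, endpoint_of_lt hj, ← mem_edge] at h2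
    rw [← hx, endpoint_of_lt hk, endpoint_of_lt hk, ← mem_edge] at h3
    rw [← hy, endpoint_of_lt hk, endpoint_of_lt hk, ← mem_edge] at h4
    have := I.edge.injective (Subtype.ext (((Sym2.mem_and_mem_iff hxy).1 ⟨h1, h2⟩).trans
      ((Sym2.mem_and_mem_iff hxy).1 ⟨h3, h4⟩).symm))
    exact congrArg Fin.val this

theorem mem_star {j : ℕ} {v : V} : j ∈ I.toEdgeArray.star G.edgeFinset.card (I.num v) ↔
    ∃ h : j < G.edgeFinset.card, v ∈ (I.edge ⟨j, h⟩ : Sym2 V) := by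
  rw [EdgeArray.mem_star, exists_prop_congr (fun h => I.mem_edge ⟨j, h⟩) Iff.rfl]
  constructor
  · rintro ⟨h, h'⟩
    exact ⟨h, by simpa only [toEdgeArray, endpoint_of_lt h] using h'⟩
  · rintro ⟨h, h'⟩
    exact ⟨h, by simpa only [toEdgeArray, endpoint_of_lt h] using h'⟩

/-- A neighbour x of v corresponds to the index of the edge vx. The predicate is arbitrary, so that
this yields degrees as well as colour counts. -/
theorem ncard_eq_countP (v : V) (P : G.edgeSet → Prop) (q : ℕ → Bool)
    (h : ∀ j, P (I.edge j) ↔ q j) :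
    {x | ∃ h : G.Adj v x, P ⟨s(v, x), h⟩}.ncard =
      (I.toEdgeArray.star G.edgeFinset.card (I.num v)).countP q := by
  classical
  rw [List.countP_eq_length_filter,
    ← List.toFinset_card_of_nodup ((EdgeArray.nodup_star _ _).filter _), ← Set.ncard_coe_finset]
  refine Set.ncard_congr (fun x hx => (I.edge.symm ⟨s(v, x), hx.1⟩ : ℕ)) ?_ ?_ ?_
  · rintro x ⟨hx, hP⟩
    rw [Finset.mem_coe, List.mem_toFinset, List.mem_filter, mem_star]
    refine ⟨⟨Fin.isLt _, by simp⟩, ?_⟩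
    rw [← h]
    simpa using hP
  · intro x y hx hy hxy
    have := congrArg Subtype.val (I.edge.symm.injective (Fin.val_inj.1 hxy))
    exact Sym2.congr_right.1 this
  · intro j hj
    rw [Finset.mem_coe, List.mem_toFinset, List.mem_filter, mem_star] at hj
    obtain ⟨⟨hjm, x, hx⟩, hq⟩ := hj
    have hP := (h ⟨j, hjm⟩).2 hq
    have hadj : G.Adj v x := by
      rw [← mem_edgeSet, ← hx]; exact (I.edge ⟨j, hjm⟩).2
    have he : I.edge ⟨j, hjm⟩ = ⟨s(v, x), hadj⟩ := Subtype.ext hx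
    refine ⟨x, ⟨hadj, he ▸ hP⟩, ?_⟩
    rw [← he]
    simp

theorem deg_toEdgeArray (v : V) [Fintype (G.neighborSet v)] :
    I.toEdgeArray.deg (I.num v) = G.degree v := by
  have := I.ncard_eq_countP v (fun _ => True) (fun _ => true) (by simp)
  rw [List.countP_true] at this
  refine this.symm.trans ?_
  simp only [exists_prop, and_true]
  rw [← card_neighborSet_eq_degree, ← Nat.card_eq_fintype_card, Nat.card_coe_set_eq]
  rfl

theorem isInput : I.toEdgeArray.IsInput I.input where
  r0 := rfl
  r1 := rfl
  reg r hr := by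
    simp only [input]
    rw [if_neg (by omega), if_neg (by omega)]
  fst j hj := by
    have h1 : 2 * j / 2 = j := by omega
    have hj' : j < G.edgeFinset.card := hj
    simp [input, toEdgeArray, endpoint, h1]
  snd j hj := by
    have h1 : (2 * j + 1) / 2 = j := by omega
    have h2 : (2 * j + 1) % 2 = 1 := by omega
    simp [input, toEdgeArray, endpoint, h1, h2]
  mem x hx := by
    have hx' : 2 * G.edgeFinset.card ≤ x := hx
    simp only [input]
    rw [dif_neg (by omega)]

/-- The key is symmetric in the counts. For correctness only this direction matters: distinct keys
force distinct palettes, for any number of edges. -/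
theorem key_eq_of_palette_eq {φ : G.EdgeLabeling (Fin 6)} {f : ℕ → ℕ}
    (hf : ∀ j : Fin G.edgeFinset.card, f j = φ (I.edge j)) {x y : V} (h : palette φ x = palette φ y) :
    I.toEdgeArray.key f (I.num x) = I.toEdgeArray.key f (I.num y) := by
  have hcount : ∀ v (i : Fin 6), I.toEdgeArray.count G.edgeFinset.card f (I.num v) i =
      colorCount φ v i := fun v i => by
    refine (I.ncard_eq_countP v (fun e => φ e = i) _ fun j => ?_).symm
    rw [decide_eq_true_iff, hf, Fin.val_inj]
  have hkey : ∀ v, I.toEdgeArray.key f (I.num v) =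
      (((Finset.univ : Finset (Fin 6)).val.map (colorCount φ v)).map
        fun c => G.edgeFinset.card ^ 7 + c).prod := fun v => by
    rw [EdgeArray.key, Finset.prod_range, Multiset.map_map]
    exact Finset.prod_congr rfl fun i _ => congrArg _ (hcount v i)
  have := congrArg (fun l : List ℕ => (l : Multiset ℕ)) h
  simp only [palette, Multiset.sort_eq] at this
  rw [hkey, hkey, this]

theorem exists_isOutput_of_solved {σ : Store} (h : I.toEdgeArray.Solved σ) :
    ∃ φ : G.EdgeLabeling (Fin 6), DistinguishesNeighbors φ ∧ I.IsOutput σ φ := by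
  obtain ⟨f, hf, hkey⟩ := h
  have hlt : ∀ e, f (I.edge.symm e) < 6 := fun e => (hf _ (Fin.isLt _)).2
  have hφ : ∀ j : Fin G.edgeFinset.card, f j = (⟨f (I.edge.symm (I.edge j)), hlt _⟩ : Fin 6) := by simp
  refine ⟨fun e => ⟨f (I.edge.symm e), hlt e⟩, fun x y hxy hp => ?_, fun j => ?_⟩
  · have hkeys := I.key_eq_of_palette_eq hφ hp
    obtain ⟨j, hj⟩ := I.edge.surjective ⟨s(x, y), hxy⟩
    have he := I.edge_eq j
    have hk := hkey j j.2
    simp only [toEdgeArray] at hk hkeys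
    rw [endpoint_of_lt j.2, endpoint_of_lt j.2] at hk
    rw [hj] at he
    rcases Sym2.eq_iff.1 he with ⟨rfl, rfl⟩ | ⟨rfl, rfl⟩
    · exact hk hkeys
    · exact hk hkeys.symm
  · rw [← hφ]
    exact (hf j j.2).1

end SimpleGraph.EdgeListing

/-- For the existence of a colouring the program is run on some presentation. -/
theorem SimpleGraph.nonempty_edgeListing {V : Type u} [Fintype V] (G : SimpleGraph V)
    [Fintype G.edgeSet] : Nonempty G.EdgeListing := by
  let e : Fin G.edgeFinset.card ≃ G.edgeSet :=
    (Fintype.equivFinOfCardEq (by rw [edgeFinset_card])).symm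
  have h : ∀ z : Sym2 V, ∃ p : V × V, z = s(p.1, p.2) := fun z =>
    z.ind fun x y => ⟨(x, y), rfl⟩
  choose p hp using h
  exact ⟨⟨Fintype.equivFin V, e, fun j => (p (e j)).1, fun j => (p (e j)).2, fun j => hp _⟩⟩

theorem PMF.exists_mem_support_of_toOuterMeasure_compl_lt_one {α : Type*} {p : PMF α} {s : Set α}
    (h : p.toOuterMeasure sᶜ < 1) : ∃ x ∈ p.support, x ∈ s := by
  by_contra! hs
  exact h.ne ((PMF.toOuterMeasure_apply_eq_one_iff _ _).2 hs)

theorem mainTheorem8 :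
    ∃ (P : WordRAM.Program) (κ C : ℕ), ∀ R : ℝ, 1 ≤ R → ∃ δ₀ : ℕ,
      ∀ (V : Type u) [Fintype V] [DecidableEq V] (G : SimpleGraph V) [DecidableRel G.Adj],
        δ₀ ≤ G.minDegree → (G.maxDegree : ℝ) ≤ R * (G.minDegree : ℝ) →
        -- a colouring with 6 colours exists
        (∃ φ : G.EdgeLabeling (Fin 6), SimpleGraph.DistinguishesNeighbors φ) ∧
        -- the program finds one, for every presentation of `G` and every word length `w` that is
        -- at least a constant multiple of the logarithm of the size of `G`
        ∀ (I : G.EdgeListing) (w : ℕ),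
          (κ + 1) * Nat.clog 2 (Fintype.card V + G.edgeFinset.card + 2) ≤ w →
          -- the output is correct whenever the program halts
          (∀ (t : ℕ), ∀ c ∈ (WordRAM.runProgram w P I.input t).support, c.Halted →
            ∃ φ : G.EdgeLabeling (Fin 6),
              SimpleGraph.DistinguishesNeighbors φ ∧ I.IsOutput c.store φ) ∧
          -- the running time is `O(|E| (1 + Δ - δ))` with high probability
          ∀ s : ℕ,
            (WordRAM.runProgram w P I.input
              (C * s * (G.edgeFinset.card * (1 + (G.maxDegree - G.minDegree))))).toOuterMeasure
                {c | ¬ c.Halted} ≤ ((Fintype.card V : ℝ≥0∞) ^ s)⁻¹ := by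
  -- The word length needs the factor 61 = κ + 1, and δ₀ is the threshold of `decayRate_spec`.
  refine ⟨Program.colorBlind, 60, 200000, fun R hR => ⟨⌈(6291456 * R ^ 2) ^ 4⌉₊, ?_⟩⟩
  intro V _ _ G _ hδ hΔ
  have hδ' : (6291456 * R ^ 2) ^ 4 ≤ (G.minDegree : ℝ) := Nat.ceil_le.1 hδ
  have hδ1 : 1 ≤ G.minDegree := by
    refine le_trans (Nat.one_le_ceil_iff.2 ?_) hδ
    positivity
  have hne : Nonempty V := by
    by_contra h
    rw [not_nonempty_iff] at h
    simp at hδ1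
  have hδΔ : G.minDegree ≤ G.maxDegree :=
    (G.minDegree_le_degree hne.some).trans (G.degree_le_maxDegree _)
  have hn : G.maxDegree + 1 ≤ Fintype.card V := G.maxDegree_lt_card_verts
  have hn2 : 2 ≤ Fintype.card V := by omega
  have hfail : ∀ (I : G.EdgeListing) (w : ℕ),
      61 * Nat.clog 2 (Fintype.card V + G.edgeFinset.card + 2) ≤ w → ∀ s : ℕ,
      failProb w I.toEdgeArray.Solved
        (200000 * s * (G.edgeFinset.card * (1 + (G.maxDegree - G.minDegree))))
        ⟨[Program.colorBlind], I.input⟩ ≤ ((Fintype.card V : ℝ≥0∞) ^ s)⁻¹ := fun I w hw s => by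
    refine EdgeArray.failProb_colorBlind_le_inv_pow (E := I.toEdgeArray) hR hδ' hδΔ hΔ ?_ hn
      (EdgeArray.wordSize_of_clog_le hw) I.isInput s
    intro u hu
    obtain ⟨v, rfl⟩ : ∃ v, (I.num v : ℕ) = u := ⟨I.num.symm ⟨u, hu⟩, by simp⟩
    rw [I.deg_toEdgeArray]
    exact ⟨G.minDegree_le_degree v, G.degree_le_maxDegree v⟩
  have hcard : (1 : ℝ≥0∞) < Fintype.card V := by exact_mod_cast hn2
  constructor
  -- With s = 1 the probability of failure is at most 1/n < 1, so some run ends in a solution.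
  · obtain ⟨I⟩ := G.nonempty_edgeListing
    obtain ⟨c, -, hc⟩ := PMF.exists_mem_support_of_toOuterMeasure_compl_lt_one
      ((hfail I _ le_rfl 1).trans_lt (by rw [pow_one]; exact ENNReal.inv_lt_one.2 hcard))
    obtain ⟨φ, hφ, -⟩ := I.exists_isOutput_of_solved hc.2
    exact ⟨φ, hφ⟩
  · refine fun I w hw => ⟨fun t c hc hh => I.exists_isOutput_of_solved ?_, fun s =>
      (toOuterMeasure_not_halted_le _).trans (hfail I w hw s)⟩
    refine of_halted_of_failProb_small (fun ε hε => ?_) t hc hh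
    -- As s grows, n^(-s) tends to 0, so failure becomes arbitrarily small.
    have := ENNReal.tendsto_pow_atTop_nhds_zero_of_lt_one (ENNReal.inv_lt_one.2 hcard)
    obtain ⟨s, hs⟩ := (this.eventually (gt_mem_nhds hε)).exists
    rw [← ENNReal.inv_pow] at hs
    exact ⟨_, (hfail I w hw s).trans_lt hs⟩
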